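/- Let $n\ge 2$, $p\ge 2$, $k_\pm\ge 0$. Write $x=(x',x_n)\in\mathbb R^n$, $B_r^+=\{|x|<r,\ x_n>0\}$, $(\partial B_r)^+=\{|x|=r,\ x_n>0\}$, $\Gamma_r=\{|x'|<r,\ x_n=0\}$, $s^+=\max\{s,0\}$, $s^-=\max\{-s,0\}$. Let $u$ be a weak solution of $$\Delta u=0\ \text{ in } B_1^+,\qquad \frac{\partial u}{\partial x_n}=k_+(u^+)^{p-1}-k_-(u^-)^{p-1}\ \text{ on }\Gamma_1,$$ that is, $u\in W^{1,2}(B_1^+)$ has its trace on $\Gamma_1$ in $L^p(\Gamma_1)$ and $$\int_{B_1^+}\nabla u\cdot\nabla\xi\,dx=-\int_{\Gamma_1}\big(k_+(u^+)^{p-1}-k_-(u^-)^{p-1}\big)\xi\,dx'\qquad\text{for all }\xi\in C_c^\infty(B_1);$$ in $B_1^+$ we take the harmonic representative of $u$, and on $\Gamma_1$ its trace. Let $F(u)=k_-(u^-)^p+k_+(u^+)^p$ and $$D(r)=\int_{B_r^+}|\nabla u|^2dx,\qquad H(r)=\int_{(\partial B_r)^+}u^2\,d\sigma,\qquad \varphi(r)=\frac{H(r)}{|(\partial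 B_r)^+|},$$ $$N(r)=r\,\frac{D(r)}{H(r)},\qquad \tilde N(r)=r\,\frac{D(r)+\frac2p\int_{\Gamma_r}F(u)\,dx'}{H(r)},$$ where for $u\equiv0$ the quotients $0/0$ are read as $0$. Then $M:=\sup_{B_{1/2}^+}|u|<\infty$ and there are positive constants $C_n,C_n',C_n''$ depending only on $n$ such that the following hold. 1. The limit $\mu:=\lim_{r\to0^+}\tilde N(r)$ exists in $[0,\infty)$, the limit $N(0+)=\lim_{r\to0^+}N(r)$ exists, and $N(0+)=\mu$. 2. (a) The function $r\mapsto r^{-2\mu}\varphi(r)$ is nondecreasing on $(0,1/2)$, and for $0<r<1/2$ $$\varphi(r)\le(2r)^{2\mu}\varphi(1/2)\le C_n(2r)^{2\mu}M^2 .$$ (b) There is a constant $C\ge 0$ with $$\int_{\Gamma_r}F(u)\,dx'\le C\,\big(rD(r)+H(r)\big)\quad\text{for all }0<r<1/2,\qquad(*)$$ for instance $C=C_n'\max\{k_+,k_-\}M^{p-2}$. For every $\delta>0$ there is $R_0=R_0(\delta)\in(0,1/2]$ such that for every $C\ge0$ satisfying $(*)$ and all $0<r<R\le R_0$ $$\varphi(R)\le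 e^{2C(1-\frac2p)(\mu+\delta+1)(R-r)}\Big(\frac Rr\Big)^{2(\mu+\delta)}\varphi(r).$$ 3. For all $0<r<1/2$ and $x\in B_r^+$, $$|u(x)|\le C_n''(4r)^\mu M= C_n''\,8^\mu\,(r/2)^\mu\,M .$$ -/

import Mathlib

open Set Filter Topology MeasureTheory

namespace PenalizedObstacle

noncomputable section

/-- Euclidean space of dimension `n = d + 1`; the distinguished coordinate `x_n` is the last one. -/
abbrev Space (d : ℕ) := EuclideanSpace ℝ (Fin (d + 1))

/-- The space of the tangential variables `x'`, of dimension `n - 1 = d`. -/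
abbrev Tangential (d : ℕ) := EuclideanSpace ℝ (Fin d)

variable {d : ℕ}

/-- The point `(x', t)`. -/
def pt (x' : Tangential d) (t : ℝ) : Space d :=
  WithLp.toLp 2 (Fin.snoc (α := fun _ => ℝ) (fun i => x' i) t)

/-- The open upper half ball `B_r^+ = {|x| < r, x_n > 0}`. -/
def halfBall (d : ℕ) (r : ℝ) : Set (Space d) :=
  {x | x ∈ Metric.ball (0 : Space d) r ∧ 0 < x (Fin.last d)}

/-- The flat integral `∫_{Γ_r} f(x', 0) dx'`, where `Γ_r = {|x'| < r, x_n = 0}`. -/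
def flatIntegral (f : Space d → ℝ) (r : ℝ) : ℝ :=
  ∫ x' in Metric.ball (0 : Tangential d) r, f (pt x' 0)

/-- The surface integral `∫_{(∂B_r)^+} f dσ` over the open upper half sphere of radius `r`,
written by scaling to the unit sphere with its surface measure. -/
def sphereIntegral (f : Space d → ℝ) (r : ℝ) : ℝ :=
  r ^ d * ∫ ω in {ω : Metric.sphere (0 : Space d) 1 | 0 < (ω : Space d) (Fin.last d)},
    f (r • (ω : Space d)) ∂((volume : Measure (Space d)).toSphere)

/-- The flux `k_+ (s^+)^(p-1) - k_- (s^-)^(p-1)`. -/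
def flux (p kp km s : ℝ) : ℝ :=
  kp * (max s 0) ^ (p - 1) - km * (max (-s) 0) ^ (p - 1)

/-- `F(s) = k_- (s^-)^p + k_+ (s^+)^p`. -/
def potential (p kp km s : ℝ) : ℝ :=
  km * (max (-s) 0) ^ p + kp * (max s 0) ^ p

/-- `u` is a weak solution of `Δu = 0` in `B_1^+`, `∂u/∂x_n = k_+ (u^+)^(p-1) - k_- (u^-)^(p-1)`
on `Γ`: it belongs to `W^{1,2}(B_1^+)`, its trace on `Γ` is in `L^p`, and the weak
formulation holds. On `B_1^+` the function `u` is the harmonic representative of its class, and its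
values on `Γ` are those of its trace, i.e. the almost everywhere existing vertical limits. -/
structure IsSolution (p kp km : ℝ) (u : Space d → ℝ) : Prop where
  harmonic : InnerProductSpace.HarmonicOnNhd u (halfBall d 1)
  memLp : MemLp u 2 (volume.restrict (halfBall d 1))
  memLp_gradient : MemLp (fun x => gradient u x) 2 (volume.restrict (halfBall d 1))
  trace : ∀ᵐ x' ∂(volume.restrict (Metric.ball (0 : Tangential d) 1)),
    Tendsto (fun t : ℝ => u (pt x' t)) (𝓝[>] 0) (𝓝 (u (pt x' 0)))
  memLp_trace : MemLp (fun x' : Tangential d => u (pt x' 0)) (ENNReal.ofReal p)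
    (volume.restrict (Metric.ball (0 : Tangential d) 1))
  weak : ∀ ξ : Space d → ℝ, ContDiff ℝ (⊤ : ℕ∞) ξ → HasCompactSupport ξ →
    tsupport ξ ⊆ Metric.ball (0 : Space d) 1 →
    ∫ x in halfBall d 1, inner ℝ (gradient u x) (gradient ξ x) =
      -flatIntegral (fun x => flux p kp km (u x) * ξ x) 1

/-- `D(r) = ∫_{B_r^+} |∇u|² dx`. -/
def dirichlet (u : Space d → ℝ) (r : ℝ) : ℝ :=
  ∫ x in halfBall d r, ‖gradient u x‖ ^ 2

/-- `H(r) = ∫_{(∂B_r)^+} u² dσ`. -/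
def height (u : Space d → ℝ) (r : ℝ) : ℝ :=
  sphereIntegral (fun x => u x ^ 2) r

/-- `∫_{Γ_r} F(u) dx'`. -/
def penalty (p kp km : ℝ) (u : Space d → ℝ) (r : ℝ) : ℝ :=
  flatIntegral (fun x => potential p kp km (u x)) r

/-- Almgren's frequency `N(r)`. -/
def frequency (u : Space d → ℝ) (r : ℝ) : ℝ :=
  r * (dirichlet u r / height u r)

/-- The perturbed Almgren frequency `Ñ(r)`. -/
def perturbedFrequency (p kp km : ℝ) (u : Space d → ℝ) (r : ℝ) : ℝ :=
  r * ((dirichlet u r + 2 / p * penalty p kp km u r) / height u r)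

/-- The mean `φ(r)` of `u²` over `(∂B_r)^+`. -/
def sphereMean (u : Space d → ℝ) (r : ℝ) : ℝ :=
  height u r / sphereIntegral (fun _ : Space d => (1 : ℝ)) r

/-- `sup_{B_{1/2}^+} |u|`. -/
def supHalf (u : Space d → ℝ) : ℝ :=
  sSup ((fun x => |u x|) '' halfBall d (1 / 2))

/-- `C` is a constant in `∫_{Γ_r} F(u) dx' ≤ C (r D(r) + H(r))`, valid for all `0 < r < 1/2`. -/
def PenaltyBound (p kp km : ℝ) (u : Space d → ℝ) (C : ℝ) : Prop :=
  ∀ r : ℝ, 0 < r → r < 1 / 2 →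
    penalty p kp km u r ≤ C * (r * dirichlet u r + height u r)

end

end PenalizedObstacle

/-! Write D, P, H for `dirichlet`, `penalty`, `height`, put E = D + (2/p) P, and recall n = d + 1.
The argument is Almgren's, and rests on two identities on half spheres. Testing the equation with u
times a radial cutoff gives ∫ u u_r = D + P over the half sphere of radius s. Hence h = `heightMean
u`, the integral of u(sω)² over the unit half sphere, satisfies h' = 2 (D + P) / s^d
(`hasDerivAt_heightMean`), and H' = (d/s) H + 2 (D + P). The Rellich–Pohozaev identity (`pohozaev`)
gives s E' = (d - 1) D + (2/p) d P + 2 s ∫ u_r² for almost every s. Cauchy–Schwarz bounds ∫ u_r²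
below by (D + P)² / H, and p ≥ 2 gives E ≤ D + P; therefore E' ≥ ((d - 1)/s + 2 (D + P)/H) E = (H'/H
- 1/s) E. This says that s E / H, the perturbed frequency, is nondecreasing
(`perturbedFrequency_mono`), and μ is its limit at 0.

The remaining claims are consequences. The trace inequality ∫_{Γ_r} u² ≤ 2 (r D + H) (`flat_sq_le`)
and the local boundedness of u control P by r D + H, so the two frequencies differ by O(r) and have
the same limit. The bound s E ≥ μ H makes r^(-2μ) h nondecreasing; near the origin s E ≤ (μ + δ) H,
and together with the control of P this gives the doubling inequality with its exponential factor.
The pointwise bound is the sub-mean-value property of u² up to the flat boundary (`local_bound`).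

The difficulty is regularity: near the flat boundary u is only known to be W^{1,2}. Identities on
spheres are therefore proved against radial cutoffs η(x) = ∫_{|x|}^∞ χ and read off for almost every
radius (`ae_eq_ballIntegral`). Products ηw with w bounded, C¹ inside and W^{1,2} are made legitimate
test functions by shifting w upwards and letting the shift tend to 0 (`weak_admissible`).

The Pohozaev identity is obtained without second derivatives of u. Test with η(x) (u(tx) - u(x)).
Convexity of |·|² and of the boundary potential turns the equation into X(t) ≥ 0 = X(1), where X
involves only dilated energies (`dilate_deficit_nonneg`). After a change of variables the dilation
falls on η, so X is differentiable at 1, and X'(1) = 0 is the identity (`pohozaev_cutoff`).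

Unique continuation is not needed: if H vanishes at one radius, it vanishes with D and P at all
smaller ones, and μ = 0 serves. -/

namespace PenalizedObstacle

noncomputable section

open scoped ENNReal NNReal

set_option linter.unusedSectionVars false

/-! ### Polar coordinates and integration along rays -/

section Polar

variable {E : Type*} [NormedAddCommGroup E] [InnerProductSpace ℝ E] [FiniteDimensional ℝ E]
  [MeasurableSpace E] [BorelSpace E] [Nontrivial E]

/-- The measure `s ^ k ds` on the open half line. -/
def powMeasure (k : ℕ) : Measure ℝ :=
  (volume.restrict (Ioi (0 : ℝ))).withDensity fun s => ENNReal.ofReal (s ^ k)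

theorem map_volumeIoiPow (k : ℕ) :
    (Measure.volumeIoiPow k).map ((↑) : Ioi (0 : ℝ) → ℝ) = powMeasure k := by
  ext s hs
  rw [Measure.map_apply measurable_subtype_coe hs, Measure.volumeIoiPow,
    withDensity_apply _ (measurable_subtype_coe hs), powMeasure, withDensity_apply _ hs,
    setLIntegral_subtype measurableSet_Ioi _ fun a : ℝ => ENNReal.ofReal (a ^ k),
    Measure.restrict_restrict hs, Subtype.image_preimage_coe, inter_comm]

/-- This carries `homeomorphUnitSphereProd` over to a radial variable in ℝ instead of the subtype of
positive reals, so that interval integrals can be used. The omitted origin is a null set. -/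
theorem measurePreserving_polar :
    MeasurePreserving (fun q : Metric.sphere (0 : E) 1 × ℝ => q.2 • (q.1 : E))
      ((volume : Measure E).toSphere.prod (powMeasure (Module.finrank ℝ E - 1))) volume := by
  have hm : Measurable (fun q : Metric.sphere (0 : E) 1 × ℝ => q.2 • (q.1 : E)) := by fun_prop
  refine ⟨hm, ?_⟩
  have h1 := (volume : Measure E).measurePreserving_homeomorphUnitSphereProd
  have h2 : ((volume : Measure E).toSphere.prod (powMeasure (Module.finrank ℝ E - 1))) =
      ((volume : Measure E).toSphere.prod (Measure.volumeIoiPow (Module.finrank ℝ E - 1))).map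
        (Prod.map id ((↑) : Ioi (0 : ℝ) → ℝ)) := by
    rw [← map_volumeIoiPow, ← Measure.map_prod_map _ _ measurable_id measurable_subtype_coe,
      Measure.map_id]
  rw [h2, ← h1.map_eq, Measure.map_map (by fun_prop) h1.measurable, Measure.map_map hm (by
    exact (measurable_id.prodMap measurable_subtype_coe).comp h1.measurable)]
  have h3 : (fun q : Metric.sphere (0 : E) 1 × ℝ => q.2 • (q.1 : E)) ∘
      (Prod.map id ((↑) : Ioi (0 : ℝ) → ℝ) ∘ homeomorphUnitSphereProd E) =
      ((↑) : ({0}ᶜ : Set E) → E) := by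
    funext x
    have : ‖(x : E)‖ ≠ 0 := norm_ne_zero_iff.2 x.2
    simp [smul_smul, this]
  rw [h3, map_comap_subtype_coe (measurableSet_singleton _).compl,
    restrict_compl_singleton]

/-- The integral of `f` over the sphere of radius `s`, by scaling to the unit sphere. -/
def sphereInt (f : E → ℝ) (s : ℝ) : ℝ :=
  s ^ (Module.finrank ℝ E - 1) *
    ∫ ω : Metric.sphere (0 : E) 1, f (s • (ω : E)) ∂((volume : Measure E).toSphere)

theorem integrable_powMeasure_prod_iff {g : Metric.sphere (0 : E) 1 × ℝ → ℝ} (k : ℕ) :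
    Integrable g ((volume : Measure E).toSphere.prod (powMeasure k)) ↔
    Integrable (fun q => q.2 ^ k * g q)
      ((volume : Measure E).toSphere.prod (volume.restrict (Ioi 0))) := by
  rw [powMeasure, prod_withDensity_right (by fun_prop),
    integrable_withDensity_iff_integrable_smul' (by fun_prop) (by simp)]
  refine integrable_congr ?_
  have : ∀ᵐ q ∂((volume : Measure E).toSphere.prod (volume.restrict (Ioi (0:ℝ)))), 0 < q.2 := by
    have := (Measure.quasiMeasurePreserving_snd (μ := (volume : Measure E).toSphere)
      (ν := volume.restrict (Ioi (0:ℝ)))).ae (ae_restrict_mem measurableSet_Ioi)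
    exact this
  filter_upwards [this] with q hq
  rw [ENNReal.toReal_ofReal (by positivity), smul_eq_mul]

theorem integral_powMeasure_prod (g : Metric.sphere (0 : E) 1 × ℝ → ℝ) (k : ℕ) :
    ∫ q, g q ∂((volume : Measure E).toSphere.prod (powMeasure k)) =
    ∫ q, q.2 ^ k * g q ∂((volume : Measure E).toSphere.prod (volume.restrict (Ioi 0))) := by
  rw [powMeasure, prod_withDensity_right (by fun_prop),
    integral_withDensity_eq_integral_toReal_smul (by fun_prop) (by simp)]
  refine integral_congr_ae ?_
  have : ∀ᵐ q ∂((volume : Measure E).toSphere.prod (volume.restrict (Ioi (0:ℝ)))), 0 < q.2 := by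
    have := (Measure.quasiMeasurePreserving_snd (μ := (volume : Measure E).toSphere)
      (ν := volume.restrict (Ioi (0:ℝ)))).ae (ae_restrict_mem measurableSet_Ioi)
    exact this
  filter_upwards [this] with q hq
  rw [ENNReal.toReal_ofReal (by positivity), smul_eq_mul]

theorem integrable_polar {f : E → ℝ} (hf : Integrable f) :
    Integrable (fun q : Metric.sphere (0 : E) 1 × ℝ =>
      q.2 ^ (Module.finrank ℝ E - 1) * f (q.2 • (q.1 : E)))
      ((volume : Measure E).toSphere.prod (volume.restrict (Ioi 0))) := by
  exact (integrable_powMeasure_prod_iff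
    (g := fun q : Metric.sphere (0 : E) 1 × ℝ => f (q.2 • (q.1 : E))) _).1
    (measurePreserving_polar.integrable_comp_of_integrable hf)

theorem integrableOn_sphereInt {f : E → ℝ} (hf : Integrable f) :
    IntegrableOn (sphereInt f) (Ioi 0) := by
  have := (integrable_polar hf).integral_prod_right
  refine this.congr (Eventually.of_forall fun s => ?_)
  simp only [sphereInt, integral_const_mul]

theorem integral_eq_integral_sphereInt {f : E → ℝ} (hf : Integrable f) :
    ∫ x, f x = ∫ s in Ioi (0 : ℝ), sphereInt f s := by
  have h1 : ∫ x, f x = ∫ q, f (q.2 • (q.1 : E))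
      ∂((volume : Measure E).toSphere.prod (powMeasure (Module.finrank ℝ E - 1))) := by
    have h0 := measurePreserving_polar (E := E)
    have h2 := integral_map (f := f) h0.aemeasurable (h0.map_eq.symm ▸ hf.1)
    rwa [h0.map_eq] at h2
  refine (h1.trans (integral_powMeasure_prod
    (fun q : Metric.sphere (0 : E) 1 × ℝ => f (q.2 • (q.1 : E))) _)).trans ?_
  rw [integral_prod_symm _ (integrable_polar hf)]
  simp only [sphereInt, integral_const_mul]

theorem ae_integrable_sphere {f : E → ℝ} (hf : Integrable f) :
    ∀ᵐ s ∂(volume.restrict (Ioi (0 : ℝ))),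
      Integrable (fun ω : Metric.sphere (0 : E) 1 => f (s • (ω : E)))
        (volume : Measure E).toSphere := by
  filter_upwards [(integrable_polar hf).prod_left_ae, ae_restrict_mem measurableSet_Ioi]
    with s hs (h0 : 0 < s)
  exact (integrable_const_mul_iff (isUnit_iff_ne_zero.2 (by positivity)) _).1 hs

theorem sphereInt_mul_norm (f : E → ℝ) (χ : ℝ → ℝ) {s : ℝ} (hs : 0 < s) :
    sphereInt (fun x => χ ‖x‖ * f x) s = χ s * sphereInt f s := by
  have : ∀ ω : Metric.sphere (0 : E) 1, ‖s • (ω : E)‖ = s := fun ω => by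
    rw [norm_smul, norm_eq_of_mem_sphere, mul_one, Real.norm_of_nonneg hs.le]
  simp only [sphereInt, this, integral_const_mul]
  ring

theorem integral_mul_norm {f : E → ℝ} (χ : ℝ → ℝ) (hf : Integrable fun x => χ ‖x‖ * f x) :
    ∫ x, χ ‖x‖ * f x = ∫ s in Ioi (0 : ℝ), χ s * sphereInt f s := by
  rw [integral_eq_integral_sphereInt hf]
  exact setIntegral_congr_fun measurableSet_Ioi fun s hs => sphereInt_mul_norm f χ hs

theorem setIntegral_ball_eq {f : E → ℝ} (hf : Integrable f) {r : ℝ} (hr : 0 ≤ r) :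
    ∫ x in Metric.ball 0 r, f x = ∫ s in (0 : ℝ)..r, sphereInt f s := by
  have h : (fun x : E => (Metric.ball 0 r).indicator f x) =
      fun x => (Iio r).indicator 1 ‖x‖ * f x := by
    funext x
    by_cases hx : ‖x‖ < r <;> simp [indicator, hx]
  rw [← integral_indicator measurableSet_ball, h, integral_mul_norm _ (by
    rw [← h]; exact hf.indicator measurableSet_ball), intervalIntegral.integral_of_le hr,
    integral_Ioc_eq_integral_Ioo,
    ← Ioi_inter_Iio, ← setIntegral_indicator measurableSet_Iio]
  refine integral_congr_ae (Eventually.of_forall fun s => ?_)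
  by_cases hs : s < r <;> simp [indicator, hs]

/-- Away from the origin the Jacobian weight is at least a^(n-1), so it can be divided out of the
polar formula. -/
theorem ray_integrable {g : E → ℝ} (hg : Integrable g) {a b : ℝ} (ha : 0 < a) :
    Integrable (fun q : Metric.sphere (0 : E) 1 × ℝ => g (q.2 • (q.1 : E)))
      ((volume : Measure E).toSphere.prod (volume.restrict (Ioc a b))) := by
  have h1 := integrable_polar hg
  have h2 : (volume : Measure E).toSphere.prod (volume.restrict (Ioc a b)) ≤
      (volume : Measure E).toSphere.prod (volume.restrict (Ioi 0)) :=
    Measure.prod_mono le_rfl (Measure.restrict_mono (fun s hs => ha.trans hs.1) le_rfl)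
  have h3 : ∀ᵐ q ∂((volume : Measure E).toSphere.prod (volume.restrict (Ioc a b))), a < q.2 := by
    have := (Measure.quasiMeasurePreserving_snd (μ := (volume : Measure E).toSphere)
      (ν := volume.restrict (Ioc a b))).ae (ae_restrict_mem measurableSet_Ioc)
    exact this.mono fun q hq => hq.1
  have h4 := (h1.mono_measure h2).bdd_mul (c := (a ^ (Module.finrank ℝ E - 1))⁻¹)
    (f := fun q => (q.2 ^ (Module.finrank ℝ E - 1))⁻¹)
    (by fun_prop) (by
      filter_upwards [h3] with q hq
      rw [norm_inv, norm_pow, Real.norm_of_nonneg (ha.le.trans hq.le)]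
      gcongr)
  refine h4.congr ?_
  filter_upwards [h3] with q hq
  have : q.2 ^ (Module.finrank ℝ E - 1) ≠ 0 := pow_ne_zero _ (ha.trans hq).ne'
  field_simp

/-- The fundamental theorem of calculus on almost every ray, followed by Fubini. Only the
integrability of the radial derivative is used; the functions on individual spheres need not be
integrable a priori. -/
theorem ray_identity {v g : E → ℝ} {R : ℝ} (hg : Integrable g)
    (hd : ∀ ω : Metric.sphere (0 : E) 1, ∀ s ∈ Ioo 0 R,
      HasDerivAt (fun s : ℝ => v (s • (ω : E))) (g (s • (ω : E))) s)
    {a b : ℝ} (ha : 0 < a) (hab : a ≤ b) (hb : b < R) :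
    Integrable (fun ω : Metric.sphere (0 : E) 1 => v (b • (ω : E)) - v (a • (ω : E)))
      (volume : Measure E).toSphere ∧
    IntervalIntegrable (fun s => ∫ ω : Metric.sphere (0 : E) 1, g (s • (ω : E))
      ∂(volume : Measure E).toSphere) volume a b ∧
    ∫ ω : Metric.sphere (0 : E) 1, (v (b • (ω : E)) - v (a • (ω : E)))
      ∂(volume : Measure E).toSphere =
      ∫ s in a..b, ∫ ω : Metric.sphere (0 : E) 1, g (s • (ω : E))
        ∂(volume : Measure E).toSphere := by
  have h1 := ray_integrable (a := a) (b := b) hg ha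
  have h2 : (fun ω : Metric.sphere (0 : E) 1 => v (b • (ω : E)) - v (a • (ω : E)))
      =ᵐ[(volume : Measure E).toSphere] fun ω => ∫ s in Ioc a b, g (s • (ω : E)) := by
    filter_upwards [h1.prod_right_ae] with ω hω
    rw [← intervalIntegral.integral_of_le hab]
    refine (intervalIntegral.integral_eq_sub_of_hasDerivAt (f := fun s : ℝ => v (s • (ω : E)))
      (fun s hs => hd ω s ?_) ((intervalIntegrable_iff_integrableOn_Ioc_of_le hab).2 hω)).symm
    rw [uIcc_of_le hab] at hs
    exact ⟨ha.trans_le hs.1, hs.2.trans_lt hb⟩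
  refine ⟨h1.integral_prod_left.congr h2.symm,
    (intervalIntegrable_iff_integrableOn_Ioc_of_le hab).2 h1.integral_prod_right, ?_⟩
  rw [integral_congr_ae h2, intervalIntegral.integral_of_le hab]
  exact integral_integral_swap h1

/-- By Fubini some sphere carries an integrable restriction of v, and `ray_identity` transports
integrability from it to every other sphere. -/
theorem ray_integrable_sphere {v g : E → ℝ} {R : ℝ} (hv : Integrable v) (hg : Integrable g)
    (hd : ∀ ω : Metric.sphere (0 : E) 1, ∀ s ∈ Ioo 0 R,
      HasDerivAt (fun s : ℝ => v (s • (ω : E))) (g (s • (ω : E))) s)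
    {s : ℝ} (hs : s ∈ Ioo 0 R) :
    Integrable (fun ω : Metric.sphere (0 : E) 1 => v (s • (ω : E)))
      (volume : Measure E).toSphere := by
  have hR : 0 < R := hs.1.trans hs.2
  have h1 : ∀ᵐ t ∂(volume.restrict (Ioo 0 R)),
      Integrable (fun ω : Metric.sphere (0 : E) 1 => v (t • (ω : E)))
        (volume : Measure E).toSphere :=
    ae_restrict_of_ae_restrict_of_subset Ioo_subset_Ioi_self (ae_integrable_sphere hv)
  have : NeZero (volume.restrict (Ioo 0 R)) := ⟨by simp [hR]⟩
  obtain ⟨t, ht1, ht2⟩ := (h1.and (ae_restrict_mem measurableSet_Ioo)).exists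
  rcases le_total s t with h | h
  · have := ht1.sub (ray_identity hg hd hs.1 h ht2.2).1
    simpa [Pi.sub_def] using this
  · have := ht1.add (ray_identity hg hd ht2.1 h hs.2).1
    simpa [Pi.add_def] using this

end Polar

/-! ### Radial cutoffs and the passage to almost every radius -/

section Radial

/-- `∫_s^∞ χ`. -/
def tailInt (χ : ℝ → ℝ) (s : ℝ) : ℝ := ∫ τ in Ioi s, χ τ

/-- Layer-cake formula: Fubini on the set {‖x‖ < τ}. It turns an integral against a radial cutoff
into an average of ball integrals weighted by χ. -/
theorem integral_mul_tailInt {E : Type*} [NormedAddCommGroup E] [MeasurableSpace E]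
    [OpensMeasurableSpace E] {μ : Measure E} [SFinite μ] {f : E → ℝ} (hf : Integrable f μ)
    {χ : ℝ → ℝ} (hχ : Integrable χ) :
    ∫ x, f x * tailInt χ ‖x‖ ∂μ = ∫ τ, χ τ * ∫ x in Metric.ball 0 τ, f x ∂μ := by
  have hS : MeasurableSet {q : E × ℝ | ‖q.1‖ < q.2} :=
    measurableSet_lt (measurable_norm.comp measurable_fst) measurable_snd
  have h1 : Integrable (fun q : E × ℝ => {q : E × ℝ | ‖q.1‖ < q.2}.indicator
      (fun q => f q.1 * χ q.2) q) (μ.prod volume) := (hf.mul_prod hχ).indicator hS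
  have h2 := integral_integral_swap (f := fun x τ => {q : E × ℝ | ‖q.1‖ < q.2}.indicator
      (fun q => f q.1 * χ q.2) (x, τ)) h1
  convert h2 using 1
  · refine integral_congr_ae (Eventually.of_forall fun x => ?_)
    simp only [tailInt]
    rw [← integral_const_mul, ← integral_indicator measurableSet_Ioi]
    rfl
  · refine integral_congr_ae (Eventually.of_forall fun τ => ?_)
    simp only
    rw [← integral_const_mul, ← integral_indicator measurableSet_ball]
    refine integral_congr_ae (Eventually.of_forall fun x => ?_)
    simp only [indicator, mem_ball_zero_iff, mem_ofPred_eq, mul_comm]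

/-- The fundamental lemma of the calculus of variations, with nonnegative test functions only. A
smooth g is split into its positive and negative parts, which are merely continuous; this is why the
cutoffs are taken continuous rather than smooth. -/
theorem ae_eq_zero_of_forall_cutoff {K : ℝ → ℝ} {R : ℝ} (hK : IntegrableOn K (Ioo 0 R))
    (h : ∀ χ : ℝ → ℝ, Continuous χ → HasCompactSupport χ → tsupport χ ⊆ Ioo 0 R →
      (∀ s, 0 ≤ χ s) → ∫ s in Ioo 0 R, χ s * K s = 0) :
    ∀ᵐ s ∂(volume.restrict (Ioo 0 R)), K s = 0 := by
  rw [ae_restrict_iff' measurableSet_Ioo]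
  refine isOpen_Ioo.ae_eq_zero_of_integral_contDiff_smul_eq_zero hK.locallyIntegrableOn ?_
  intro g hg hgc hgs
  have key : ∀ χ : ℝ → ℝ, Continuous χ → HasCompactSupport χ → tsupport χ ⊆ Ioo 0 R →
      (∀ s, 0 ≤ χ s) → Integrable (fun s => χ s * K s) ∧ ∫ s, χ s * K s = 0 := by
    intro χ h1 h2 h3 h4
    have h0 : Function.support (fun s => χ s * K s) ⊆ Ioo 0 R := fun s hs =>
      h3 (subset_tsupport _ (left_ne_zero_of_mul hs))
    constructor
    · rw [← integrableOn_iff_integrable_of_support_subset h0]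
      obtain ⟨C, hC⟩ := h2.exists_bound_of_continuous h1
      exact hK.bdd_mul h1.aestronglyMeasurable (Eventually.of_forall hC)
    · rw [← setIntegral_eq_integral_of_forall_compl_eq_zero (s := Ioo 0 R), h χ h1 h2 h3 h4]
      intro s hs
      by_contra hne
      exact hs (h0 hne)
  have hp := key (fun s => max (g s) 0) (hg.continuous.max continuous_const)
    (hgc.comp_left (g := fun t => max t 0) (by simp))
    ((closure_mono (fun s hs => by
      intro h0; simp [h0] at hs)).trans hgs) (fun s => le_max_right _ _)
  have hn := key (fun s => max (-g s) 0) (hg.continuous.neg.max continuous_const)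
    (hgc.comp_left (g := fun t => max (-t) 0) (by simp))
    ((closure_mono (fun s hs => by
      intro h0; simp [h0] at hs)).trans hgs) (fun s => le_max_right _ _)
  have : ∀ s, g s • K s = max (g s) 0 * K s - max (-g s) 0 * K s := by
    intro s
    rw [← sub_mul, smul_eq_mul]
    congr 1
    rcases le_total (g s) 0 with h | h
    · rw [max_eq_right h, max_eq_left (by linarith)]; ring
    · rw [max_eq_left h, max_eq_right (by linarith)]; ring
  simp_rw [this]
  rw [integral_sub hp.1 hn.1, hp.2, hn.2, sub_zero]

end Radial

/-! ### Continuity of translations and dilations in L² -/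

section L2

variable {E F : Type*} [NormedAddCommGroup E] [InnerProductSpace ℝ E] [FiniteDimensional ℝ E]
  [MeasurableSpace E] [BorelSpace E]
  [NormedAddCommGroup F] [InnerProductSpace ℝ F]

theorem abs_integral_inner_le {α : Type*} [MeasurableSpace α] {μ : Measure α} {a b : α → F}
    (ha : MemLp a 2 μ) (hb : MemLp b 2 μ) :
    |∫ x, inner ℝ (a x) (b x) ∂μ| ≤ (eLpNorm a 2 μ).toReal * (eLpNorm b 2 μ).toReal := by
  have h : ∫ x, inner ℝ (a x) (b x) ∂μ = inner ℝ (ha.toLp a) (hb.toLp b) := by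
    rw [L2.inner_def]
    refine integral_congr_ae ?_
    filter_upwards [ha.coeFn_toLp, hb.coeFn_toLp] with x h1 h2
    rw [h1, h2]
  rw [h, ← Lp.norm_toLp a ha, ← Lp.norm_toLp b hb]
  exact abs_real_inner_le_norm _ _

theorem integrable_inner_of_memLp {α : Type*} [MeasurableSpace α] {μ : Measure α} {a b : α → F}
    (ha : MemLp a 2 μ) (hb : MemLp b 2 μ) : Integrable (fun x => inner ℝ (a x) (b x)) μ := by
  refine (L2.integrable_inner (𝕜 := ℝ) (ha.toLp a) (hb.toLp b)).congr ?_
  filter_upwards [ha.coeFn_toLp, hb.coeFn_toLp] with x h1 h2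
  rw [h1, h2]

theorem tendsto_integral_inner_of_tendsto_eLpNorm {α ι : Type*} [MeasurableSpace α]
    {μ : Measure α} {l : Filter ι} {a G : α → F} {g : ι → α → F}
    (ha : MemLp a 2 μ) (hG : MemLp G 2 μ) (hg : ∀ᶠ t in l, MemLp (g t) 2 μ)
    (h : Tendsto (fun t => eLpNorm (g t - G) 2 μ) l (𝓝 0)) :
    Tendsto (fun t => ∫ x, inner ℝ (a x) (g t x) ∂μ) l (𝓝 (∫ x, inner ℝ (a x) (G x) ∂μ)) := by
  rw [tendsto_iff_dist_tendsto_zero]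
  have h1 : Tendsto (fun t => (eLpNorm a 2 μ).toReal * (eLpNorm (g t - G) 2 μ).toReal) l
      (𝓝 0) := by
    have := ((ENNReal.tendsto_toReal ENNReal.zero_ne_top).comp h).const_mul (eLpNorm a 2 μ).toReal
    simpa using this
  refine squeeze_zero' (Eventually.of_forall fun _ => dist_nonneg) ?_ h1
  filter_upwards [hg] with t ht
  rw [Real.dist_eq, ← integral_sub (integrable_inner_of_memLp ha ht)
    (integrable_inner_of_memLp ha hG)]
  simp_rw [← inner_sub_right]
  exact abs_integral_inner_le ha (ht.sub hG)

/-- Density of compactly supported continuous functions: for these, dominated convergence applies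
because supports stay in a fixed ball, and the uniform bound `hC` on composition carries the
conclusion to all of L². -/
theorem tendsto_eLpNorm_comp_sub {ι : Type*} {l : Filter ι} [l.IsCountablyGenerated]
    {Θ : ι → E → E}
    (hΘ : ∀ x, Tendsto (fun t => Θ t x) l (𝓝 x)) (hm : ∀ t, Continuous (Θ t)) {C : ℝ≥0}
    (hC : ∀ᶠ t in l, ∀ f : E → F, MemLp f 2 volume →
      MemLp (f ∘ Θ t) 2 volume ∧ eLpNorm (f ∘ Θ t) 2 volume ≤ C * eLpNorm f 2 volume)
    (hb : ∀ r : ℝ, ∃ r' : ℝ, ∀ᶠ t in l, ∀ x, ‖Θ t x‖ ≤ r → ‖x‖ ≤ r')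
    {G : E → F} (hG : MemLp G 2 volume) :
    Tendsto (fun t => eLpNorm (G ∘ Θ t - G) 2 volume) l (𝓝 0) := by
  rw [ENNReal.tendsto_nhds_zero]
  intro ε hε
  have hC2 : (C + 2 : ℝ≥0∞) ≠ 0 := by positivity
  -- Three errors are added up: the approximation error composed with Θ, which costs a factor C, the
  -- approximation error itself, and the convergence error for g.
  have hδ : ε / (C + 2) ≠ 0 := (ENNReal.div_pos hε.ne' (by finiteness)).ne'
  obtain ⟨g, hgs, hgG, hgc, hg2⟩ := hG.exists_hasCompactSupport_eLpNorm_sub_le (by simp) hδ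
  obtain ⟨B, hB⟩ := hgs.exists_bound_of_continuous hgc
  obtain ⟨r, hr⟩ := hgs.isCompact.isBounded.subset_closedBall 0
  obtain ⟨r', hr'⟩ := hb r
  have hsupp : ∀ y, g y ≠ 0 → ‖y‖ ≤ r := fun y hy => by
    simpa using hr (subset_tsupport _ hy)
  have hlim : Tendsto (fun t => eLpNorm (g ∘ Θ t - g) 2 volume) l (𝓝 0) := by
    simp_rw [eLpNorm_eq_lintegral_rpow_enorm_toReal (p := 2) two_ne_zero (by simp)]
    have : Tendsto (fun t => ∫⁻ x, ‖(g ∘ Θ t - g) x‖ₑ ^ (2 : ℝ≥0∞).toReal) l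
        (𝓝 (∫⁻ _ : E, 0)) := by
      refine tendsto_lintegral_filter_of_dominated_convergence
        ((Metric.closedBall (0 : E) (max r r')).indicator fun _ =>
          (ENNReal.ofReal (B + B)) ^ (2 : ℝ≥0∞).toReal) ?_ ?_ ?_ ?_
      · refine Eventually.of_forall fun t => ?_
        exact (((hgc.comp (hm t)).sub hgc).enorm.measurable.pow_const _)
      · filter_upwards [hr'] with t ht
        refine Eventually.of_forall fun x => ?_
        by_cases hx : x ∈ Metric.closedBall (0 : E) (max r r')
        · rw [indicator_of_mem hx]
          gcongr
          rw [← ofReal_norm]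
          exact ENNReal.ofReal_le_ofReal ((norm_sub_le _ _).trans (add_le_add (hB _) (hB _)))
        · rw [indicator_of_notMem hx]
          have hx' : max r r' < ‖x‖ := by simpa using hx
          have h1 : g x = 0 := by
            by_contra h
            exact absurd (hsupp x h) (not_le.2 ((le_max_left _ _).trans_lt hx'))
          have h2 : g (Θ t x) = 0 := by
            by_contra h
            exact absurd (ht x (hsupp _ h)) (not_le.2 ((le_max_right _ _).trans_lt hx'))
          simp [h1, h2]
      · rw [lintegral_indicator measurableSet_closedBall, setLIntegral_const]
        have : volume (Metric.closedBall (0 : E) (max r r')) ≠ ∞ := measure_closedBall_lt_top.ne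
        have h3 : ENNReal.ofReal (B + B) ^ (2 : ℝ≥0∞).toReal ≠ ∞ := by finiteness
        finiteness
      · refine Eventually.of_forall fun x => ?_
        have h1 : Tendsto (fun t => (g ∘ Θ t - g) x) l (𝓝 0) := by
          have := ((hgc.tendsto x).comp (hΘ x)).sub_const (g x)
          simpa using this
        have h2 := (h1.enorm).ennrpow_const ((2 : ℝ≥0∞).toReal)
        simpa using h2
    have h2 := this.ennrpow_const (1 / (2 : ℝ≥0∞).toReal)
    simpa using h2
  filter_upwards [hC, ENNReal.tendsto_nhds_zero.1 hlim _ (pos_iff_ne_zero.2 hδ)] with t ht1 ht2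
  have hGg := ht1 (G - g) (hG.sub hg2)
  have hG' := ht1 G hG
  have hg' := ht1 g hg2
  have e : G ∘ Θ t - G = (G - g) ∘ Θ t + ((g ∘ Θ t - g) + (g - G)) := by
    funext x; simp
  calc eLpNorm (G ∘ Θ t - G) 2 volume
      ≤ eLpNorm ((G - g) ∘ Θ t) 2 volume + eLpNorm ((g ∘ Θ t - g) + (g - G)) 2 volume := by
        rw [e]
        exact eLpNorm_add_le hGg.1.1 ((hg'.1.sub hg2).add (hg2.sub hG)).1 (by norm_num)
    _ ≤ C * (ε / (C + 2)) + (ε / (C + 2) + ε / (C + 2)) := by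
        gcongr
        · exact hGg.2.trans (by gcongr)
        · refine (eLpNorm_add_le (hg'.1.sub hg2).1 (hg2.sub hG).1 (by norm_num)).trans ?_
          gcongr
          rw [eLpNorm_sub_comm]
          exact hgG
    _ = (C + 2) * (ε / (C + 2)) := by ring
    _ ≤ ε := ENNReal.mul_div_le

theorem tendsto_eLpNorm_translate_sub {G : E → F} (hG : MemLp G 2 volume) (e : E) :
    Tendsto (fun t : ℝ => eLpNorm ((fun x => G (x + t • e)) - G) 2 volume) (𝓝 0) (𝓝 0) := by
  refine tendsto_eLpNorm_comp_sub (Θ := fun (t : ℝ) x => x + t • e) (C := 1) ?_ ?_ ?_ ?_ hG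
  · intro x
    have : Continuous fun t : ℝ => x + t • e := by fun_prop
    simpa using this.tendsto 0
  · intro t; fun_prop
  · refine Eventually.of_forall fun t f hf => ?_
    have h := measurePreserving_add_right (volume : Measure E) (t • e)
    exact ⟨hf.comp_measurePreserving h, by
      rw [eLpNorm_comp_measurePreserving hf.1 h]; simp⟩
  · intro r
    refine ⟨r + ‖e‖, ?_⟩
    have : ∀ᶠ t : ℝ in 𝓝 0, t ∈ Metric.ball (0 : ℝ) 1 := Metric.ball_mem_nhds _ one_pos
    filter_upwards [this] with t ht x hx
    have h1 : ‖t • e‖ ≤ ‖e‖ := by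
      rw [norm_smul]
      have : ‖t‖ ≤ 1 := by simpa using (mem_ball_zero_iff.1 ht).le
      nlinarith [norm_nonneg e]
    calc ‖x‖ = ‖(x + t • e) - t • e‖ := by simp
      _ ≤ r + ‖e‖ := (norm_sub_le _ _).trans (add_le_add hx h1)

theorem memLp_comp_smul {f : E → F} (hf : MemLp f 2 volume) {c : ℝ} (hc : 1 / 2 ≤ c) :
    MemLp (fun x => f (c • x)) 2 volume ∧
      eLpNorm (fun x => f (c • x)) 2 volume ≤
        ((2 : ℝ≥0) ^ Module.finrank ℝ E : ℝ≥0) * eLpNorm f 2 volume := by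
  have hc0 : c ≠ 0 := by positivity
  have hmap := Measure.map_addHaar_smul (volume : Measure E) hc0
  have hem : MeasurableEmbedding (fun x : E => c • x) :=
    (Homeomorph.smulOfNeZero c hc0).measurableEmbedding
  have h1 : eLpNorm (fun x => f (c • x)) 2 volume =
      eLpNorm f 2 (Measure.map (fun x : E => c • x) volume) :=
    (hem.eLpNorm_map_measure (g := f)).symm
  have hle : eLpNorm f 2 (Measure.map (fun x : E => c • x) volume) ≤
      ((2 : ℝ≥0) ^ Module.finrank ℝ E : ℝ≥0) * eLpNorm f 2 volume := by
    rw [hmap, eLpNorm_smul_measure_of_ne_top (by simp)]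
    rw [smul_eq_mul]
    refine mul_le_mul_left ?_ _
    have h2 : |(c ^ Module.finrank ℝ E)⁻¹| ≤ 2 ^ Module.finrank ℝ E := by
      rw [abs_of_nonneg (by positivity), ← inv_pow]
      gcongr
      rw [inv_le_comm₀ (by positivity) (by positivity)]
      linarith
    have h3 : (1 : ℝ) ≤ 2 ^ Module.finrank ℝ E := one_le_pow₀ (by norm_num)
    calc ENNReal.ofReal |(c ^ Module.finrank ℝ E)⁻¹| ^ (1 / (2 : ℝ≥0∞)).toReal
        ≤ ENNReal.ofReal (2 ^ Module.finrank ℝ E) ^ (1 / (2 : ℝ≥0∞)).toReal := by gcongr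
      _ ≤ ENNReal.ofReal (2 ^ Module.finrank ℝ E) ^ (1 : ℝ) := by
        refine ENNReal.rpow_le_rpow_of_exponent_le (by simpa using ENNReal.ofReal_le_ofReal h3) ?_
        norm_num
      _ = _ := by
        rw [ENNReal.rpow_one, ENNReal.ofReal_pow (by norm_num)]
        simp
  refine ⟨⟨?_, ?_⟩, h1 ▸ hle⟩
  · refine hf.1.comp_quasiMeasurePreserving ⟨by fun_prop, ?_⟩
    rw [hmap]
    exact Measure.smul_absolutelyContinuous
  · rw [h1]
    exact hle.trans_lt (by have := hf.2; finiteness)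

theorem tendsto_eLpNorm_dilate_sub {G : E → F} (hG : MemLp G 2 volume) :
    Tendsto (fun t : ℝ => eLpNorm ((fun x => G (t • x)) - G) 2 volume) (𝓝 1) (𝓝 0) := by
  have hhalf : ∀ᶠ t : ℝ in 𝓝 1, 1 / 2 < t := lt_mem_nhds (by norm_num)
  refine tendsto_eLpNorm_comp_sub (Θ := fun (t : ℝ) x => t • x)
    (C := (2 : ℝ≥0) ^ Module.finrank ℝ E) ?_ ?_ ?_ ?_ hG
  · intro x
    have : Continuous fun t : ℝ => t • x := by fun_prop
    simpa using this.tendsto 1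
  · intro t; fun_prop
  · filter_upwards [hhalf] with t ht f hf
    exact memLp_comp_smul hf ht.le
  · intro r
    refine ⟨2 * r, ?_⟩
    filter_upwards [hhalf] with t ht x hx
    rw [norm_smul, Real.norm_of_nonneg (by linarith)] at hx
    nlinarith [norm_nonneg x]

end L2

/-! ### Coordinates (x', t) and half balls -/

section Geometry

variable {d : ℕ}

@[simp] theorem pt_last (x' : Tangential d) (t : ℝ) : pt x' t (Fin.last d) = t := by
  simp [pt]

@[simp] theorem pt_castSucc (x' : Tangential d) (t : ℝ) (i : Fin d) :
    pt x' t (Fin.castSucc i) = x' i := by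
  simp [pt]

/-- The unit vector `e_n`. -/
def vert (d : ℕ) : Space d := pt 0 1

theorem space_ext {x y : Space d} (h : ∀ i : Fin d, x (Fin.castSucc i) = y (Fin.castSucc i))
    (hl : x (Fin.last d) = y (Fin.last d)) : x = y := by
  ext i
  exact Fin.lastCases hl h i

theorem vert_last : vert d (Fin.last d) = 1 := by simp [vert]

theorem pt_add_vert (x' : Tangential d) (t s : ℝ) : pt x' t + s • vert d = pt x' (t + s) := by
  refine space_ext (fun i => ?_) ?_ <;> simp [vert]

theorem pt_sub_pt (x' y' : Tangential d) (t s : ℝ) : pt x' t - pt y' s = pt (x' - y') (t - s) := by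
  refine space_ext (fun i => ?_) ?_ <;> simp

theorem smul_pt (c : ℝ) (x' : Tangential d) (t : ℝ) : c • pt x' t = pt (c • x') (c * t) := by
  refine space_ext (fun i => ?_) ?_ <;> simp

theorem norm_pt_sq (x' : Tangential d) (t : ℝ) : ‖pt x' t‖ ^ 2 = ‖x'‖ ^ 2 + t ^ 2 := by
  rw [EuclideanSpace.norm_sq_eq, EuclideanSpace.norm_sq_eq, Fin.sum_univ_castSucc]
  simp

theorem norm_pt_zero (x' : Tangential d) : ‖pt x' 0‖ = ‖x'‖ := by
  have := norm_pt_sq x' 0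
  rw [zero_pow two_ne_zero, add_zero] at this
  exact (pow_left_inj₀ (norm_nonneg _) (norm_nonneg _) two_ne_zero).1 this

theorem norm_vert : ‖vert d‖ = 1 := by
  have := norm_pt_sq (0 : Tangential d) 1
  rw [norm_zero] at this
  have h : ‖vert d‖ ^ 2 = 1 ^ 2 := by rw [vert, this]; norm_num
  exact (pow_left_inj₀ (norm_nonneg _) zero_le_one two_ne_zero).1 h

theorem continuous_pt : Continuous fun q : Tangential d × ℝ => pt q.1 q.2 := by
  refine (PiLp.continuous_toLp 2 _).comp (continuous_pi fun i => ?_)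
  refine Fin.lastCases ?_ (fun j => ?_) i
  · simpa using continuous_snd
  · simp only [Fin.snoc_castSucc]
    fun_prop

@[fun_prop]
theorem continuous_pt_comp {X : Type*} [TopologicalSpace X] {f : X → Tangential d} {g : X → ℝ}
    (hf : Continuous f) (hg : Continuous g) : Continuous fun x => pt (f x) (g x) :=
  continuous_pt.comp (hf.prodMk hg)

theorem exists_eq_pt (x : Space d) : ∃ x' : Tangential d, x = pt x' (x (Fin.last d)) :=
  ⟨WithLp.toLp 2 fun i => x (Fin.castSucc i), space_ext (fun i => by simp) (by simp)⟩

theorem continuous_last : Continuous fun x : Space d => x (Fin.last d) := by fun_prop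

theorem isOpen_halfBall (r : ℝ) : IsOpen (halfBall d r) :=
  Metric.isOpen_ball.inter (isOpen_lt continuous_const continuous_last)

theorem measurableSet_halfBall (r : ℝ) : MeasurableSet (halfBall d r) :=
  (isOpen_halfBall r).measurableSet

theorem halfBall_mono {r s : ℝ} (h : r ≤ s) : halfBall d r ⊆ halfBall d s := fun _ hx =>
  ⟨Metric.ball_subset_ball h hx.1, hx.2⟩

theorem mem_halfBall {r : ℝ} {x : Space d} :
    x ∈ halfBall d r ↔ ‖x‖ < r ∧ 0 < x (Fin.last d) := by
  simp [halfBall]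

theorem add_vert_last (x : Space d) (t : ℝ) :
    (x + t • vert d) (Fin.last d) = x (Fin.last d) + t := by
  simp [vert_last]

theorem norm_add_vert_le (x : Space d) {t : ℝ} (ht : 0 ≤ t) : ‖x + t • vert d‖ ≤ ‖x‖ + t := by
  refine (norm_add_le _ _).trans ?_
  rw [norm_smul, norm_vert, mul_one, Real.norm_of_nonneg ht]

theorem measurePreserving_pt :
    MeasurePreserving (fun q : Tangential d × ℝ => pt q.1 q.2) (volume.prod volume) volume := by
  have h1 := (volume_preserving_piFinSuccAbove (fun _ : Fin (d + 1) => ℝ) (Fin.last d)).symm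
  have h2 := (PiLp.volume_preserving_ofLp (Fin d)).prod (MeasurePreserving.id (volume : Measure ℝ))
  have h3 := (Measure.measurePreserving_swap (μ := (volume : Measure (Fin d → ℝ)))
    (ν := (volume : Measure ℝ)))
  have h4 := ((PiLp.volume_preserving_toLp (Fin (d + 1))).comp (h1.comp (h3.comp h2)))
  convert! h4 using 1
  funext q
  refine space_ext (fun i => ?_) ?_
  · simp [MeasurableEquiv.piFinSuccAbove_symm_apply, Fin.insertNthEquiv]
  · simp [MeasurableEquiv.piFinSuccAbove_symm_apply, Fin.insertNthEquiv]

end Geometry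

/-! ### Smoothing of C¹ test functions -/

section TestFunctions

/-- Mollification at a scale below the distance from the support to the complement of U and below
the moduli of uniform continuity of ξ and of its derivative. -/
theorem exists_smooth_approx {E : Type*} [NormedAddCommGroup E] [InnerProductSpace ℝ E]
    [FiniteDimensional ℝ E] [MeasurableSpace E] [BorelSpace E] {ξ : E → ℝ}
    (hξ : ContDiff ℝ 1 ξ) (hc : HasCompactSupport ξ) {U : Set E} (hU : IsOpen U)
    (hs : tsupport ξ ⊆ U) {ε : ℝ} (hε : 0 < ε) :
    ∃ ζ : E → ℝ, ContDiff ℝ (⊤ : ℕ∞) ζ ∧ HasCompactSupport ζ ∧ tsupport ζ ⊆ U ∧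
      (∀ x, |ζ x - ξ x| ≤ ε) ∧ ∀ x, ‖fderiv ℝ ζ x - fderiv ℝ ξ x‖ ≤ ε := by
  obtain ⟨δ, hδ, hδU⟩ := hc.isCompact.exists_cthickening_subset_open hU hs
  have hu1 := hc.uniformContinuous_of_continuous hξ.continuous
  have hu2 := (hc.fderiv ℝ).uniformContinuous_of_continuous (hξ.continuous_fderiv one_ne_zero)
  obtain ⟨δ1, hδ1, h1⟩ := Metric.uniformContinuous_iff.1 hu1 ε hε
  obtain ⟨δ2, hδ2, h2⟩ := Metric.uniformContinuous_iff.1 hu2 ε hε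
  set r := min δ (min δ1 δ2) with hr
  have hr0 : 0 < r := lt_min hδ (lt_min hδ1 hδ2)
  let φ : ContDiffBump (0 : E) := ⟨r / 2, r, by positivity, by linarith⟩
  have hφ : φ.rOut = r := rfl
  set L := ContinuousLinearMap.lsmul ℝ ℝ (E := ℝ) with hL
  set ζ := convolution (φ.normed volume) ξ L volume with hζ
  have hφc : HasCompactSupport (φ.normed volume) := φ.hasCompactSupport_normed
  have hφi : LocallyIntegrable (φ.normed volume) volume :=
    φ.continuous_normed.locallyIntegrable
  have hζc : HasCompactSupport ζ := hφc.convolution L hc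
  have hsub : tsupport ζ ⊆ U := by
    refine Subset.trans ?_ hδU
    refine closure_minimal ?_ Metric.isClosed_cthickening
    intro x hx
    obtain ⟨y, hy, z, hz, rfl⟩ := support_convolution_subset L hx
    rw [φ.support_normed_eq] at hy
    refine Metric.mem_cthickening_of_dist_le (y + z) z δ _ (subset_tsupport _ hz) ?_
    rw [dist_eq_norm, add_sub_cancel_right]
    exact (mem_ball_zero_iff.1 hy).le.trans (min_le_left _ _)
  refine ⟨ζ, hφc.contDiff_convolution_left L φ.contDiff_normed
    hξ.continuous.locallyIntegrable, hζc, hsub, fun x => ?_, fun x => ?_⟩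
  · rw [← Real.dist_eq]
    refine φ.dist_normed_convolution_le hξ.continuous.aestronglyMeasurable fun y hy => ?_
    exact (h1 (hy.trans_le ((min_le_right _ _).trans (min_le_left _ _)))).le
  · have hd := (hc.hasFDerivAt_convolution_right L hφi hξ x).fderiv
    have hLL : L.precompR E = ContinuousLinearMap.lsmul ℝ ℝ (E := E →L[ℝ] ℝ) := by
      ext a T
      simp [hL, ContinuousLinearMap.precompR]
    rw [hd, hLL, ← dist_eq_norm]
    refine φ.dist_normed_convolution_le
      (hξ.continuous_fderiv one_ne_zero).aestronglyMeasurable fun y hy => ?_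
    exact (h2 (hy.trans_le ((min_le_right _ _).trans (min_le_right _ _)))).le

end TestFunctions

/-! ### Enlarging the class of test functions: C¹ functions -/

section Weak

variable {d : ℕ} {p kp km : ℝ} {u : Space d → ℝ}

theorem isFiniteMeasure_restrict_halfBall (r : ℝ) :
    IsFiniteMeasure ((volume : Measure (Space d)).restrict (halfBall d r)) := by
  refine isFiniteMeasure_restrict.2 (ne_of_lt ?_)
  exact (measure_mono inter_subset_left).trans_lt
    (measure_ball_lt_top (x := (0 : Space d)) (r := r))

theorem continuous_flux (hp : 2 ≤ p) : Continuous (flux p kp km) := by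
  unfold flux
  have h : 0 ≤ p - 1 := by linarith
  fun_prop (disch := assumption)

theorem continuous_potential (hp : 2 ≤ p) : Continuous (potential p kp km) := by
  unfold potential
  have h : 0 ≤ p := by linarith
  fun_prop (disch := assumption)

theorem abs_flux_le (hp : 2 ≤ p) (hkp : 0 ≤ kp) (hkm : 0 ≤ km) (s : ℝ) :
    |flux p kp km s| ≤ (kp + km) * (1 + |s| ^ p) := by
  have h1 : ∀ t : ℝ, 0 ≤ t → t ≤ |s| → t ^ (p - 1) ≤ 1 + |s| ^ p := by
    intro t ht hts
    rcases le_total t 1 with h | h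
    · exact (Real.rpow_le_one ht h (by linarith)).trans
        (le_add_of_nonneg_right (by positivity))
    · calc t ^ (p - 1) ≤ t ^ p := Real.rpow_le_rpow_of_exponent_le h (by linarith)
        _ ≤ |s| ^ p := Real.rpow_le_rpow ht hts (by linarith)
        _ ≤ _ := by linarith
  have h2 := h1 (max s 0) (le_max_right _ _) (max_le (le_abs_self s) (abs_nonneg s))
  have h3 := h1 (max (-s) 0) (le_max_right _ _) (max_le (neg_le_abs s) (abs_nonneg s))
  have h4 : 0 ≤ (max s 0) ^ (p - 1) := by positivity
  have h5 : 0 ≤ (max (-s) 0) ^ (p - 1) := by positivity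
  unfold flux
  rw [abs_le]
  constructor <;> nlinarith [mul_le_mul_of_nonneg_left h2 hkp, mul_le_mul_of_nonneg_left h3 hkm,
    mul_nonneg hkp h4, mul_nonneg hkm h5]

theorem potential_nonneg (hkp : 0 ≤ kp) (hkm : 0 ≤ km) (s : ℝ) : 0 ≤ potential p kp km s := by
  unfold potential; positivity

theorem potential_le (hp : 2 ≤ p) (hkp : 0 ≤ kp) (hkm : 0 ≤ km) (s : ℝ) :
    potential p kp km s ≤ (kp + km) * |s| ^ p := by
  have h2 : (max s 0) ^ p ≤ |s| ^ p := Real.rpow_le_rpow (le_max_right _ _)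
    (max_le (le_abs_self s) (abs_nonneg s)) (by linarith)
  have h3 : (max (-s) 0) ^ p ≤ |s| ^ p := Real.rpow_le_rpow (le_max_right _ _)
    (max_le (neg_le_abs s) (abs_nonneg s)) (by linarith)
  unfold potential
  nlinarith [mul_le_mul_of_nonneg_left h2 hkp, mul_le_mul_of_nonneg_left h3 hkm]

namespace IsSolution

variable (hu : IsSolution p kp km u)
include hu

theorem contDiffOn : ContDiffOn ℝ 2 u (halfBall d 1) :=
  fun x hx => (hu.harmonic x hx).1.contDiffWithinAt

theorem contDiffAt {x : Space d} (hx : x ∈ halfBall d 1) : ContDiffAt ℝ 2 u x :=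
  (hu.harmonic x hx).1

theorem continuousOn_gradient : ContinuousOn (fun x => gradient u x) (halfBall d 1) := by
  have h : ContinuousOn (fderiv ℝ u) (halfBall d 1) :=
    (hu.contDiffOn.fderiv_of_isOpen (m := 1) (isOpen_halfBall 1) (by norm_num)).continuousOn
  exact (LinearIsometryEquiv.continuous _).comp_continuousOn h

theorem integrable_rpow_trace (hp : 2 ≤ p) :
    IntegrableOn (fun x' : Tangential d => |u (pt x' 0)| ^ p) (Metric.ball 0 1) := by
  have := hu.memLp_trace.integrable_norm_rpow (by simp; linarith) (by simp)
  rwa [ENNReal.toReal_ofReal (by linarith)] at this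

theorem integrable_flux (hp : 2 ≤ p) (hkp : 0 ≤ kp) (hkm : 0 ≤ km) :
    IntegrableOn (fun x' : Tangential d => flux p kp km (u (pt x' 0))) (Metric.ball 0 1) := by
  have h1 : IntegrableOn (fun x' : Tangential d => (kp + km) * (1 + |u (pt x' 0)| ^ p))
      (Metric.ball 0 1) :=
    ((integrableOn_const measure_ball_lt_top.ne).add (hu.integrable_rpow_trace hp)).const_mul _
  refine h1.mono' ((continuous_flux hp).comp_aestronglyMeasurable hu.memLp_trace.1)
    (Eventually.of_forall fun x' => abs_flux_le hp hkp hkm _)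

theorem integrable_potential (hp : 2 ≤ p) (hkp : 0 ≤ kp) (hkm : 0 ≤ km) :
    IntegrableOn (fun x' : Tangential d => potential p kp km (u (pt x' 0))) (Metric.ball 0 1) := by
  have h1 : IntegrableOn (fun x' : Tangential d => (kp + km) * |u (pt x' 0)| ^ p)
      (Metric.ball 0 1) := (hu.integrable_rpow_trace hp).const_mul _
  refine h1.mono' ((continuous_potential hp).comp_aestronglyMeasurable hu.memLp_trace.1)
    (Eventually.of_forall fun x' => ?_)
  rw [Real.norm_of_nonneg (potential_nonneg hkp hkm _)]
  exact potential_le hp hkp hkm _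

theorem integrable_norm_gradient : IntegrableOn (fun x => ‖gradient u x‖) (halfBall d 1) := by
  have : IsFiniteMeasure (volume.restrict (halfBall d 1)) :=
    isFiniteMeasure_restrict_halfBall 1
  exact (hu.memLp_gradient.integrable (by norm_num)).norm

theorem integrable_norm_gradient_sq :
    IntegrableOn (fun x => ‖gradient u x‖ ^ 2) (halfBall d 1) := hu.memLp_gradient.norm.integrable_sq

theorem integrable_fderiv_gradient {ξ : Space d → ℝ}
    (hξ : ContDiff ℝ 1 ξ) (hc : HasCompactSupport ξ) :
    IntegrableOn (fun x => fderiv ℝ ξ x (gradient u x)) (halfBall d 1) := by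
  have hcf := hξ.continuous_fderiv one_ne_zero
  obtain ⟨C, hC⟩ := (hc.fderiv ℝ).exists_bound_of_continuous hcf
  refine (hu.integrable_norm_gradient.const_mul C).mono' ?_ (Eventually.of_forall fun x => ?_)
  · exact (isBoundedBilinearMap_apply (𝕜 := ℝ) (E := Space d) (F := ℝ)).continuous
      |>.comp_aestronglyMeasurable (hcf.aestronglyMeasurable.prodMk hu.memLp_gradient.1)
  · exact ((fderiv ℝ ξ x).le_opNorm _).trans (by gcongr; exact hC x)

/-- Both sides are continuous under C¹ convergence with uniform bounds, because ∇u and the flux are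
integrable. -/
theorem weak_of_contDiff_one (hp : 2 ≤ p) (hkp : 0 ≤ kp) (hkm : 0 ≤ km) {ξ : Space d → ℝ}
    (hξ : ContDiff ℝ 1 ξ) (hc : HasCompactSupport ξ) (hs : tsupport ξ ⊆ Metric.ball 0 1) :
    ∫ x in halfBall d 1, fderiv ℝ ξ x (gradient u x) =
      -flatIntegral (fun x => flux p kp km (u x) * ξ x) 1 := by
  set A := ∫ x in halfBall d 1, ‖gradient u x‖ with hA
  set B := ∫ x' in Metric.ball (0 : Tangential d) 1, |flux p kp km (u (pt x' 0))| with hB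
  have hfl := hu.integrable_flux hp hkp hkm
  have hflm : ∀ ζ : Space d → ℝ, Continuous ζ → HasCompactSupport ζ →
      IntegrableOn (fun x' : Tangential d => flux p kp km (u (pt x' 0)) * ζ (pt x' 0))
        (Metric.ball 0 1) := by
    intro ζ hζ hζc
    obtain ⟨C, hC⟩ := hζc.exists_bound_of_continuous hζ
    exact hfl.mul_bdd (c := C) (Continuous.aestronglyMeasurable (by fun_prop))
      (Eventually.of_forall fun x' => hC _)
  have key : ∀ ε > 0, |(∫ x in halfBall d 1, fderiv ℝ ξ x (gradient u x)) +
      flatIntegral (fun x => flux p kp km (u x) * ξ x) 1| ≤ ε * (A + B) := by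
    intro ε hε
    obtain ⟨ζ, hζ, hζc, hζs, h1, h2⟩ := exists_smooth_approx hξ hc Metric.isOpen_ball hs hε
    have hw := hu.weak ζ hζ hζc hζs
    have hζ1 : ContDiff ℝ 1 ζ := hζ.of_le (by exact_mod_cast le_top)
    simp_rw [inner_gradient_right] at hw
    simp only [conj_trivial] at hw
    have e1 : (∫ x in halfBall d 1, fderiv ℝ ξ x (gradient u x)) =
        (∫ x in halfBall d 1, fderiv ℝ ζ x (gradient u x)) -
        ∫ x in halfBall d 1, (fderiv ℝ ζ x - fderiv ℝ ξ x) (gradient u x) := by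
      rw [← integral_sub (hu.integrable_fderiv_gradient hζ1 hζc)]
      · simp
      · exact (hu.integrable_fderiv_gradient hζ1 hζc).sub (hu.integrable_fderiv_gradient hξ hc)
    have e2 : flatIntegral (fun x => flux p kp km (u x) * ξ x) 1 =
        flatIntegral (fun x => flux p kp km (u x) * ζ x) 1 -
        ∫ x' in Metric.ball (0 : Tangential d) 1,
          flux p kp km (u (pt x' 0)) * (ζ (pt x' 0) - ξ (pt x' 0)) := by
      unfold flatIntegral
      rw [← integral_sub (hflm ζ hζ.continuous hζc)]
      · refine integral_congr_ae (Eventually.of_forall fun x' => ?_)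
        simp only; ring
      · have := (hflm ζ hζ.continuous hζc).sub (hflm ξ hξ.continuous hc)
        refine this.congr (Eventually.of_forall fun x' => ?_)
        simp only [Pi.sub_apply]; ring
    have b1 : |∫ x in halfBall d 1, (fderiv ℝ ζ x - fderiv ℝ ξ x) (gradient u x)| ≤ ε * A := by
      rw [hA, ← integral_const_mul, ← Real.norm_eq_abs]
      refine norm_integral_le_of_norm_le (hu.integrable_norm_gradient.const_mul ε)
        (Eventually.of_forall fun x => ?_)
      exact ((fderiv ℝ ζ x - fderiv ℝ ξ x).le_opNorm _).trans (by gcongr; exact h2 x)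
    have b2 : |∫ x' in Metric.ball (0 : Tangential d) 1,
        flux p kp km (u (pt x' 0)) * (ζ (pt x' 0) - ξ (pt x' 0))| ≤ ε * B := by
      rw [hB, ← integral_const_mul, ← Real.norm_eq_abs]
      refine norm_integral_le_of_norm_le (hfl.abs.const_mul ε)
        (Eventually.of_forall fun x' => ?_)
      rw [norm_mul, mul_comm]
      exact mul_le_mul_of_nonneg_right (h1 _) (norm_nonneg _)
    rw [e1, e2, hw]
    rw [abs_le] at *
    constructor <;> linarith [b1.1, b1.2, b2.1, b2.2]
  have hlim : Tendsto (fun ε : ℝ => ε * (A + B)) (𝓝[>] 0) (𝓝 0) := by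
    have : Tendsto (fun ε : ℝ => ε * (A + B)) (𝓝 0) (𝓝 (0 * (A + B))) :=
      tendsto_id.mul_const _
    rw [zero_mul] at this
    exact this.mono_left nhdsWithin_le_nhds
  have h0 := ge_of_tendsto hlim (eventually_nhdsWithin_of_forall fun ε hε => key ε hε)
  have := abs_nonpos_iff.1 h0
  linarith

/-- The equation sees ξ only on the closed upper half space, so ξ may be cut off below it in the
vertical variable. -/
theorem weak_of_contDiffOn (hp : 2 ≤ p) (hkp : 0 ≤ kp) (hkm : 0 ≤ km) {ξ : Space d → ℝ}
    {ε ρ : ℝ} (hε : 0 < ε) (hρ : ρ < 1)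
    (hξ : ContDiffOn ℝ 1 ξ {x | -ε < x (Fin.last d)}) (h0 : ∀ x, ρ ≤ ‖x‖ → ξ x = 0) :
    ∫ x in halfBall d 1, fderiv ℝ ξ x (gradient u x) =
      -flatIntegral (fun x => flux p kp km (u x) * ξ x) 1 := by
  -- θ equals 1 for x_n ≥ -ε/3 and 0 for x_n ≤ -2ε/3, so the product with ξ is C¹ everywhere and
  -- agrees with ξ near the closed half space.
  set θ : Space d → ℝ := fun x =>
    Real.smoothTransition ((x (Fin.last d) + 2 * ε / 3) / (ε / 3)) with hθ
  have hθc : ContDiff ℝ 1 θ := by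
    have h1 : ContDiff ℝ 1 fun x : Space d => (x (Fin.last d) + 2 * ε / 3) / (ε / 3) := by
      fun_prop
    exact (Real.smoothTransition.contDiff (n := 1)).comp h1
  have hθ1 : ∀ x : Space d, -(ε / 3) ≤ x (Fin.last d) → θ x = 1 := by
    intro x hx
    refine Real.smoothTransition.one_of_one_le ?_
    rw [le_div_iff₀ (by positivity)]
    linarith
  have hθ0 : ∀ x : Space d, x (Fin.last d) ≤ -(2 * ε / 3) → θ x = 0 := by
    intro x hx
    refine Real.smoothTransition.zero_of_nonpos ?_
    exact div_nonpos_of_nonpos_of_nonneg (by linarith) (by positivity)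
  have hopen : IsOpen {x : Space d | -ε < x (Fin.last d)} :=
    isOpen_lt continuous_const continuous_last
  have hopen' : IsOpen {x : Space d | x (Fin.last d) < -(2 * ε / 3)} :=
    isOpen_lt continuous_last continuous_const
  have hζ : ContDiff ℝ 1 fun x => θ x * ξ x := by
    rw [contDiff_iff_contDiffAt]
    intro x
    by_cases hx : -ε < x (Fin.last d)
    · exact hθc.contDiffAt.mul (hξ.contDiffAt (hopen.mem_nhds hx))
    · have hx' : x ∈ {x : Space d | x (Fin.last d) < -(2 * ε / 3)} := by
        simp only [mem_ofPred_eq]; linarith [not_lt.1 hx]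
      refine (contDiffAt_const (c := (0 : ℝ))).congr_of_eventuallyEq ?_
      filter_upwards [hopen'.mem_nhds hx'] with y hy
      rw [hθ0 y (le_of_lt hy), zero_mul]
  have hsub : tsupport (fun x => θ x * ξ x) ⊆ Metric.closedBall 0 ρ := by
    refine closure_minimal (fun x hx => ?_) Metric.isClosed_closedBall
    rw [mem_closedBall_zero_iff]
    by_contra h
    exact hx (by simp [h0 x (not_le.1 h).le])
  have hcs : HasCompactSupport fun x => θ x * ξ x :=
    HasCompactSupport.of_support_subset_isCompact (isCompact_closedBall 0 ρ)
      ((subset_tsupport _).trans hsub)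
  have := hu.weak_of_contDiff_one hp hkp hkm hζ hcs
    (hsub.trans (Metric.closedBall_subset_ball hρ))
  have e1 : ∫ x in halfBall d 1, fderiv ℝ ξ x (gradient u x) =
      ∫ x in halfBall d 1, fderiv ℝ (fun x => θ x * ξ x) x (gradient u x) := by
    refine setIntegral_congr_fun (measurableSet_halfBall 1) fun x hx => ?_
    have : ξ =ᶠ[𝓝 x] fun x => θ x * ξ x := by
      filter_upwards [(isOpen_halfBall 1).mem_nhds hx] with y hy
      rw [hθ1 y (by linarith [hy.2]), one_mul]
    simp only [this.fderiv_eq]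
  rw [e1, this]
  unfold flatIntegral
  congr 1
  refine integral_congr_ae (Eventually.of_forall fun x' => ?_)
  simp only [hθ1 (pt x' 0) (by simp; positivity), one_mul]

end IsSolution

end Weak

/-! ### Enlarging the class of test functions: products of cutoffs with bounded W^{1,2} functions -/

section Weak

variable {d : ℕ} {p kp km : ℝ} {u : Space d → ℝ}

theorem measurable_indicator_of_continuousOn {α β : Type*} [TopologicalSpace α]
    [MeasurableSpace α] [OpensMeasurableSpace α] [TopologicalSpace β] [MeasurableSpace β]
    [BorelSpace β] [Zero β] {s : Set α} {f : α → β} (hs : MeasurableSet s)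
    (hf : ContinuousOn f s) : Measurable (s.indicator f) := by
  classical
  rw [← piecewise_eq_indicator]
  exact hf.measurable_piecewise continuousOn_const hs

/-- Bounded `W^{1,2}` functions on the half ball which are `C^1` inside and have vertical limits
almost everywhere on the flat part of the boundary. -/
structure IsAdmissible (w : Space d → ℝ) (ρ K : ℝ) : Prop where
  contDiffOn : ContDiffOn ℝ 1 w (halfBall d ρ)
  bound : ∀ x ∈ halfBall d ρ, |w x| ≤ K
  memLp_gradient : MemLp (fun x => gradient w x) 2 (volume.restrict (halfBall d ρ))
  trace : ∀ᵐ x' ∂(volume.restrict (Metric.ball (0 : Tangential d) ρ)),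
    Tendsto (fun t : ℝ => w (pt x' t)) (𝓝[>] 0) (𝓝 (w (pt x' 0)))

theorem add_vert_mem_halfBall {x : Space d} {ρ ρ' t : ℝ} (hx : ‖x‖ ≤ ρ)
    (hl : -t < x (Fin.last d)) (ht0 : 0 ≤ t) (ht : t < ρ' - ρ) : x + t • vert d ∈ halfBall d ρ' := by
  rw [mem_halfBall, add_vert_last]
  exact ⟨(norm_add_vert_le x ht0).trans_lt (by linarith), by linarith⟩

theorem fderiv_eq_zero_of_norm_gt {η : Space d → ℝ} {ρ : ℝ} (h0 : ∀ x, ρ ≤ ‖x‖ → η x = 0)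
    {x : Space d} (hx : ρ < ‖x‖) : fderiv ℝ η x = 0 := by
  have : η =ᶠ[𝓝 x] fun _ => 0 := by
    filter_upwards [(isOpen_lt continuous_const continuous_norm).mem_nhds hx] with y hy
    exact h0 y (le_of_lt hy)
  rw [this.fderiv_eq]
  simp

theorem hasCompactSupport_of_norm {η : Space d → ℝ} {ρ : ℝ} (h0 : ∀ x, ρ ≤ ‖x‖ → η x = 0) :
    HasCompactSupport η := by
  refine HasCompactSupport.of_support_subset_isCompact (isCompact_closedBall 0 ρ) fun x hx => ?_
  rw [mem_closedBall_zero_iff]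
  by_contra h
  exact hx (h0 x (not_le.1 h).le)

namespace IsSolution

variable (hu : IsSolution p kp km u)
include hu

/-- The product η w need not be C¹ up to the flat boundary, but η(x) w(x + t e_n) is C¹ on {x_n >
-t} and can be tested with. As t ↓ 0 the gradient term converges by continuity of translations in
L², and the other two by dominated convergence, with the vertical limits of w giving its boundary
values. -/
theorem weak_admissible (hp : 2 ≤ p) (hkp : 0 ≤ kp) (hkm : 0 ≤ km) {w η : Space d → ℝ}
    {ρ ρ' K : ℝ} (hρ : ρ < ρ') (hρ1 : ρ' ≤ 1) (hK : 0 ≤ K) (hw : IsAdmissible w ρ' K)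
    (hη : ContDiff ℝ 1 η) (h0 : ∀ x, ρ ≤ ‖x‖ → η x = 0) :
    IntegrableOn (fun x => w x * fderiv ℝ η x (gradient u x)) (halfBall d 1) ∧
    IntegrableOn (fun x => η x * inner ℝ (gradient u x) (gradient w x)) (halfBall d 1) ∧
    IntegrableOn (fun x' : Tangential d => flux p kp km (u (pt x' 0)) *
      (η (pt x' 0) * w (pt x' 0))) (Metric.ball 0 1) ∧
    (∫ x in halfBall d 1, w x * fderiv ℝ η x (gradient u x)) +
      (∫ x in halfBall d 1, η x * inner ℝ (gradient u x) (gradient w x)) =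
      -flatIntegral (fun x => flux p kp km (u x) * (η x * w x)) 1 := by
  have hηc : HasCompactSupport η := hasCompactSupport_of_norm h0
  have hfd0 : ∀ x, ρ < ‖x‖ → fderiv ℝ η x = 0 := fun x hx => fderiv_eq_zero_of_norm_gt h0 hx
  obtain ⟨Cη, hCη⟩ := hηc.exists_bound_of_continuous hη.continuous
  set W : Space d → ℝ := (halfBall d ρ').indicator w with hW
  set G : Space d → Space d := (halfBall d ρ').indicator (fun x => gradient w x) with hG
  have hWm : Measurable W :=
    measurable_indicator_of_continuousOn (measurableSet_halfBall ρ') hw.contDiffOn.continuousOn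
  have hWK : ∀ x, |W x| ≤ K := by
    intro x
    by_cases hx : x ∈ halfBall d ρ'
    · rw [hW, indicator_of_mem hx]; exact hw.bound x hx
    · rw [hW, indicator_of_notMem hx]; simpa using hK
  have hG2 : MemLp G 2 volume := (memLp_indicator_iff_restrict (measurableSet_halfBall ρ')).2
    hw.memLp_gradient
  have hGt : ∀ t : ℝ, MemLp (fun x => G (x + t • vert d)) 2 volume := fun t =>
    hG2.comp_measurePreserving (measurePreserving_add_right volume (t • vert d))
  set a : Space d → Space d := (halfBall d 1).indicator (fun x => η x • gradient u x) with ha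
  have ha2 : MemLp a 2 volume := by
    refine (memLp_indicator_iff_restrict (measurableSet_halfBall 1)).2 ?_
    refine hu.memLp_gradient.of_le_mul (c := Cη)
      (hη.continuous.aestronglyMeasurable.smul hu.memLp_gradient.1) (Eventually.of_forall fun x => ?_)
    rw [norm_smul]
    gcongr
    exact hCη x
  have hlast : ∀ x ∈ halfBall d 1, ∀ t : ℝ, 0 ≤ t → -t < x (Fin.last d) := fun x hx t ht => by
    linarith [hx.2]
  have hV := hu.integrable_fderiv_gradient hη hηc
  have hAint : ∀ t : ℝ, IntegrableOn (fun x => W (x + t • vert d) * fderiv ℝ η x (gradient u x))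
      (halfBall d 1) := fun t =>
    hV.bdd_mul (c := K) (hWm.comp (by fun_prop)).aestronglyMeasurable
      (Eventually.of_forall fun x => hWK _)
  have hfl := hu.integrable_flux hp hkp hkm
  have hCint : ∀ t : ℝ, IntegrableOn (fun x' : Tangential d => flux p kp km (u (pt x' 0)) *
      (η (pt x' 0) * W (pt x' t))) (Metric.ball 0 1) := fun t => by
    refine hfl.mul_bdd (c := Cη * K) ?_ (Eventually.of_forall fun x' => ?_)
    · refine (Continuous.aestronglyMeasurable (hη.continuous.comp (by fun_prop))).mul ?_
      exact (hWm.comp (by fun_prop)).aestronglyMeasurable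
    · rw [norm_mul]
      exact mul_le_mul (hCη _) (hWK _) (norm_nonneg _) ((norm_nonneg _).trans (hCη 0))
  have hBeq : ∀ t : ℝ, ∫ x, inner ℝ (a x) (G (x + t • vert d)) =
      ∫ x in halfBall d 1, η x * inner ℝ (gradient u x) (G (x + t • vert d)) := fun t => by
    rw [← integral_indicator (measurableSet_halfBall 1)]
    refine integral_congr_ae (Eventually.of_forall fun x => ?_)
    by_cases hx : x ∈ halfBall d 1 <;> simp [ha, hx, inner_smul_left]
  have hBint : ∀ t : ℝ, IntegrableOn
      (fun x => η x * inner ℝ (gradient u x) (G (x + t • vert d))) (halfBall d 1) := fun t => by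
    have := (integrable_inner_of_memLp ha2 (hGt t)).integrableOn (s := halfBall d 1)
    refine this.congr_fun (fun x hx => ?_) (measurableSet_halfBall 1)
    simp [ha, hx, inner_smul_left]
  -- The gap ρ' - ρ keeps the shifted points inside the half ball of radius ρ', where w is
  -- controlled, as long as x lies in the support of η.
  have hid : ∀ t ∈ Ioo 0 (ρ' - ρ),
      (∫ x in halfBall d 1, W (x + t • vert d) * fderiv ℝ η x (gradient u x)) +
      (∫ x, inner ℝ (a x) (G (x + t • vert d))) =
      -∫ x' in Metric.ball (0 : Tangential d) 1, flux p kp km (u (pt x' 0)) *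
      (η (pt x' 0) * W (pt x' t)) := by
    rintro t ⟨ht0, ht⟩
    have hWw : ∀ x, ‖x‖ ≤ ρ → -t < x (Fin.last d) →
        (fun y => W (y + t • vert d)) =ᶠ[𝓝 x] fun y => w (y + t • vert d) := by
      intro x hx hl
      have h1 := (isOpen_halfBall ρ').mem_nhds (add_vert_mem_halfBall hx hl ht0.le ht)
      have h2 : Tendsto (fun y : Space d => y + t • vert d) (𝓝 x) (𝓝 (x + t • vert d)) :=
        Continuous.tendsto (by fun_prop) x
      filter_upwards [h2.eventually h1] with y hy
      exact indicator_of_mem (s := halfBall d ρ') hy w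
    have hzero : ∀ x, ρ < ‖x‖ → (fun y => η y * W (y + t • vert d)) =ᶠ[𝓝 x] fun _ => 0 := by
      intro x hx
      filter_upwards [(isOpen_lt continuous_const continuous_norm).mem_nhds hx] with y hy
      rw [h0 y (le_of_lt hy), zero_mul]
    have hwd : ∀ x, ‖x‖ ≤ ρ → -t < x (Fin.last d) → ContDiffAt ℝ 1 w (x + t • vert d) :=
      fun x hx hl => hw.contDiffOn.contDiffAt ((isOpen_halfBall ρ').mem_nhds
        (add_vert_mem_halfBall hx hl ht0.le ht))
    have hweak := hu.weak_of_contDiffOn hp hkp hkm (ξ := fun y => η y * W (y + t • vert d))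
      (ε := t) (ρ := ρ) ht0 (hρ.trans_le hρ1) (by
        intro x hx
        refine ContDiffAt.contDiffWithinAt ?_
        rcases le_or_gt ‖x‖ ρ with h | h
        · refine hη.contDiffAt.mul (ContDiffAt.congr_of_eventuallyEq ?_ (hWw x h hx))
          exact (hwd x h hx).comp x (by fun_prop)
        · exact contDiffAt_const.congr_of_eventuallyEq (hzero x h)) (fun x hx => by
        simp only [h0 x hx, zero_mul])
    rw [hBeq, ← integral_add (hAint t) (hBint t)]
    refine Eq.trans (setIntegral_congr_fun (measurableSet_halfBall 1) fun x hx => ?_) (hweak.trans ?_)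
    · rcases le_or_gt ‖x‖ ρ with h | h
      · have hl := hlast x hx t ht0.le
        have hmem := add_vert_mem_halfBall h hl ht0.le ht
        have hd1 : HasFDerivAt (fun y => W (y + t • vert d)) (fderiv ℝ w (x + t • vert d)) x := by
          refine HasFDerivAt.congr_of_eventuallyEq ?_ (hWw x h hl)
          have := ((hwd x h hl).differentiableAt one_ne_zero).hasFDerivAt
          exact (hasFDerivAt_comp_add_right (t • vert d)).2 this
        have hd2 := (hη.differentiable one_ne_zero x).hasFDerivAt
        rw [HasFDerivAt.fderiv (f := fun y => η y * W (y + t • vert d)) (hd2.mul hd1), hG, indicator_of_mem hmem, inner_gradient_right]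
        simp [add_comm]
      · rw [(hzero x h).fderiv_eq, hfd0 x h, h0 x h.le]
        simp
    · unfold flatIntegral
      simp only [pt_add_vert, zero_add]
  have hlim1 : Tendsto (fun t : ℝ => ∫ x in halfBall d 1,
      W (x + t • vert d) * fderiv ℝ η x (gradient u x)) (𝓝[>] 0)
      (𝓝 (∫ x in halfBall d 1, W x * fderiv ℝ η x (gradient u x))) := by
    refine tendsto_integral_filter_of_dominated_convergence
      (fun x => K * ‖fderiv ℝ η x (gradient u x)‖) (Eventually.of_forall fun t => (hAint t).1)
      (Eventually.of_forall fun t => Eventually.of_forall fun x => ?_) (hV.norm.const_mul K)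
      ((ae_restrict_iff' (measurableSet_halfBall 1)).2 (Eventually.of_forall fun x hx => ?_))
    · rw [norm_mul]
      exact mul_le_mul_of_nonneg_right (hWK _) (norm_nonneg _)
    · rcases le_or_gt ‖x‖ ρ with h | h
      · refine Tendsto.mul_const _ ?_
        have hx' : x ∈ halfBall d ρ' := mem_halfBall.2 ⟨h.trans_lt hρ, hx.2⟩
        have h1 : ContinuousAt W x := by
          refine (hw.contDiffOn.continuousOn.continuousAt
            ((isOpen_halfBall ρ').mem_nhds hx')).congr ?_
          filter_upwards [(isOpen_halfBall ρ').mem_nhds hx'] with y hy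
          simp [hW, hy]
        have h2 : Tendsto (fun t : ℝ => x + t • vert d) (𝓝[>] 0) (𝓝 x) := by
          have : Continuous fun t : ℝ => x + t • vert d := by fun_prop
          have := this.tendsto 0
          simp only [zero_smul, add_zero] at this
          exact this.mono_left nhdsWithin_le_nhds
        exact h1.tendsto.comp h2
      · simp [hfd0 x h]
  have hlim2 : Tendsto (fun t : ℝ => ∫ x, inner ℝ (a x) (G (x + t • vert d))) (𝓝[>] 0)
      (𝓝 (∫ x, inner ℝ (a x) (G x))) :=
    tendsto_integral_inner_of_tendsto_eLpNorm ha2 hG2 (Eventually.of_forall hGt)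
      ((tendsto_eLpNorm_translate_sub hG2 (vert d)).mono_left nhdsWithin_le_nhds)
  have htr : ∀ᵐ x' ∂(volume.restrict (Metric.ball (0 : Tangential d) 1)),
      Tendsto (fun t : ℝ => η (pt x' 0) * W (pt x' t)) (𝓝[>] 0)
        (𝓝 (η (pt x' 0) * w (pt x' 0))) := by
    refine ae_restrict_of_ae ?_
    filter_upwards [(ae_restrict_iff' measurableSet_ball).1 hw.trace] with x' hx'
    rcases le_or_gt ρ ‖x'‖ with h | h
    · rw [h0 (pt x' 0) (by rwa [norm_pt_zero])]
      simp
    · refine Tendsto.const_mul _ ?_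
      refine (hx' (mem_ball_zero_iff.2 (h.trans hρ))).congr' ?_
      have h1 : Tendsto (fun t : ℝ => ‖pt x' t‖) (𝓝[>] 0) (𝓝 ‖x'‖) := by
        have : Continuous fun t : ℝ => ‖pt x' t‖ := by fun_prop
        have := this.tendsto 0
        rw [norm_pt_zero] at this
        exact this.mono_left nhdsWithin_le_nhds
      filter_upwards [h1.eventually_lt_const (h.trans hρ), self_mem_nhdsWithin] with t ht ht0
      have : pt x' t ∈ halfBall d ρ' := mem_halfBall.2 ⟨ht, by simpa using ht0⟩
      simp [hW, this]
  have hdom : ∀ t : ℝ, ∀ᵐ x' ∂(volume.restrict (Metric.ball (0 : Tangential d) 1)),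
      ‖flux p kp km (u (pt x' 0)) * (η (pt x' 0) * W (pt x' t))‖ ≤
        ‖flux p kp km (u (pt x' 0))‖ * (Cη * K) := fun t => Eventually.of_forall fun x' => by
    rw [norm_mul, norm_mul]
    gcongr
    · exact (norm_nonneg _).trans (hCη 0)
    · exact hCη _
    · exact hWK _
  have hlim3 : Tendsto (fun t : ℝ => ∫ x' in Metric.ball (0 : Tangential d) 1,
      flux p kp km (u (pt x' 0)) * (η (pt x' 0) * W (pt x' t))) (𝓝[>] 0)
      (𝓝 (∫ x' in Metric.ball (0 : Tangential d) 1,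
        flux p kp km (u (pt x' 0)) * (η (pt x' 0) * w (pt x' 0)))) :=
    tendsto_integral_filter_of_dominated_convergence
      (fun x' => ‖flux p kp km (u (pt x' 0))‖ * (Cη * K))
      (Eventually.of_forall fun t => (hCint t).1) (Eventually.of_forall hdom)
      (hfl.norm.mul_const _) (htr.mono fun x' hx' => hx'.const_mul _)
  have hWw1 : ∀ x ∈ halfBall d 1, w x * fderiv ℝ η x (gradient u x) =
      W x * fderiv ℝ η x (gradient u x) := by
    intro x hx
    rcases le_or_gt ‖x‖ ρ with h | h
    · rw [hW, indicator_of_mem (mem_halfBall.2 ⟨h.trans_lt hρ, hx.2⟩)]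
    · simp [hfd0 x h]
  have hGw1 : ∀ x ∈ halfBall d 1, η x * inner ℝ (gradient u x) (gradient w x) =
      η x * inner ℝ (gradient u x) (G x) := by
    intro x hx
    rcases le_or_gt ‖x‖ ρ with h | h
    · rw [hG, indicator_of_mem (mem_halfBall.2 ⟨h.trans_lt hρ, hx.2⟩)]
    · simp [h0 x h.le]
  refine ⟨?_, ?_, ?_, ?_⟩
  · have := hAint 0
    simp only [zero_smul, add_zero] at this
    exact this.congr_fun (fun x hx => (hWw1 x hx).symm) (measurableSet_halfBall 1)
  · have := hBint 0
    simp only [zero_smul, add_zero] at this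
    exact this.congr_fun (fun x hx => (hGw1 x hx).symm) (measurableSet_halfBall 1)
  -- Nothing is assumed about the measurability of w on the flat boundary; it is inherited from the
  -- vertical limits.
  · have hmeas : AEStronglyMeasurable (fun x' : Tangential d => η (pt x' 0) * w (pt x' 0))
        (volume.restrict (Metric.ball 0 1)) :=
      aestronglyMeasurable_of_tendsto_ae (𝓝[>] (0 : ℝ)) (fun t =>
        ((Continuous.aestronglyMeasurable (hη.continuous.comp (by fun_prop))).mul
          (hWm.comp (by fun_prop)).aestronglyMeasurable)) htr
    refine hfl.mul_bdd (c := Cη * K) hmeas ?_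
    filter_upwards [htr] with x' hx'
    refine le_of_tendsto hx'.norm (Eventually.of_forall fun t => ?_)
    rw [norm_mul]
    exact mul_le_mul (hCη _) (hWK _) (norm_nonneg _) ((norm_nonneg _).trans (hCη 0))
  · have e1 : ∀ᶠ t : ℝ in 𝓝[>] 0, t ∈ Ioo 0 (ρ' - ρ) :=
      Ioo_mem_nhdsGT (by linarith)
    have h4 := tendsto_nhds_unique ((hlim1.add hlim2).congr' (e1.mono hid)) hlim3.neg
    rw [setIntegral_congr_fun (measurableSet_halfBall 1) hWw1,
      setIntegral_congr_fun (measurableSet_halfBall 1) hGw1]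
    have := hBeq 0
    simp only [zero_smul, add_zero] at this
    rw [← this]
    exact h4

end IsSolution

end Weak

/-! ### Derivatives of radial cutoffs and ball integrals -/

section Cutoff

/-- Nonnegative continuous functions with compact support in `(0, R)`. -/
structure IsCutoff (χ : ℝ → ℝ) (R : ℝ) : Prop where
  continuous : Continuous χ
  compact : HasCompactSupport χ
  support : tsupport χ ⊆ Ioo 0 R
  nonneg : ∀ s, 0 ≤ χ s

namespace IsCutoff

variable {χ : ℝ → ℝ} {R : ℝ} (h : IsCutoff χ R)
include h

theorem integrable : Integrable χ := h.continuous.integrable_of_hasCompactSupport h.compact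

theorem tailInt_add (a b : ℝ) : (∫ τ in a..b, χ τ) + tailInt χ b = tailInt χ a :=
  intervalIntegral.integral_interval_add_Ioi h.integrable.integrableOn h.integrable.integrableOn

theorem hasDerivAt_tailInt (s : ℝ) : HasDerivAt (tailInt χ) (-χ s) s := by
  have h1 : tailInt χ = fun b => tailInt χ 0 - ∫ τ in (0 : ℝ)..b, χ τ := by
    funext b; linarith [h.tailInt_add 0 b]
  rw [h1]
  exact (intervalIntegral.integral_hasDerivAt_right (h.continuous.intervalIntegrable _ _)
    (h.continuous.stronglyMeasurableAtFilter _ _) h.continuous.continuousAt).const_sub _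

theorem tailInt_nonneg (s : ℝ) : 0 ≤ tailInt χ s :=
  setIntegral_nonneg measurableSet_Ioi fun τ _ => h.nonneg τ

theorem continuous_tailInt : Continuous (tailInt χ) :=
  continuous_iff_continuousAt.2 fun s => (h.hasDerivAt_tailInt s).continuousAt

theorem tailInt_le (s : ℝ) : tailInt χ s ≤ ∫ τ, χ τ :=
  setIntegral_le_integral h.integrable (Eventually.of_forall h.nonneg)

theorem exists_zero_of_ge : ∃ R₀, R₀ < R ∧ ∀ s, R₀ ≤ s → χ s = 0 ∧ tailInt χ s = 0 := by
  have key : ∃ R₀, R₀ < R ∧ ∀ s, R₀ ≤ s → χ s = 0 := by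
    rcases (tsupport χ).eq_empty_or_nonempty with he | hne
    · refine ⟨R - 1, by linarith, fun s _ => ?_⟩
      exact image_eq_zero_of_notMem_tsupport (by simp [he])
    · obtain ⟨m, hm, hmax⟩ := h.compact.isCompact.exists_isMaxOn hne continuousOn_id
      have hmR := (h.support hm).2
      refine ⟨(m + R) / 2, by linarith, fun s hs => ?_⟩
      refine image_eq_zero_of_notMem_tsupport fun hsm => ?_
      have : s ≤ m := hmax hsm
      linarith
  obtain ⟨R₀, h1, h2⟩ := key
  refine ⟨R₀, h1, fun s hs => ⟨h2 s hs, ?_⟩⟩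
  refine setIntegral_eq_zero_of_forall_eq_zero fun τ hτ => h2 τ (hs.trans (le_of_lt hτ))

theorem eventually_zero : ∀ᶠ s in 𝓝 (0 : ℝ), χ s = 0 := by
  have : (tsupport χ)ᶜ ∈ 𝓝 (0 : ℝ) :=
    (isClosed_tsupport χ).isOpen_compl.mem_nhds fun h0 => lt_irrefl _ (h.support h0).1
  filter_upwards [this] with s hs
  exact image_eq_zero_of_notMem_tsupport hs

theorem continuous_div : Continuous fun s => χ s / s := by
  rw [continuous_iff_continuousAt]
  intro s
  by_cases hs : s = 0
  · subst hs
    refine (continuousAt_const (y := (0 : ℝ))).congr ?_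
    filter_upwards [h.eventually_zero] with t ht
    simp [ht]
  · exact h.continuous.continuousAt.div continuousAt_id hs

theorem setIntegral_eq (K : ℝ → ℝ) :
    ∫ s in Ioi (0 : ℝ), χ s * K s = ∫ s in Ioo 0 R, χ s * K s := by
  refine setIntegral_eq_of_subset_of_forall_sdiff_eq_zero measurableSet_Ioi Ioo_subset_Ioi_self ?_
  intro s hs
  have : s ∉ tsupport χ := fun h1 => hs.2 (h.support h1)
  rw [image_eq_zero_of_notMem_tsupport this, zero_mul]

end IsCutoff

variable {E : Type*} [NormedAddCommGroup E] [InnerProductSpace ℝ E]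

/-- Since χ vanishes near 0, the cutoff is constant near y. The singularity of the norm therefore
does no harm, and the formula holds at y with the convention that division by zero gives zero. -/
theorem hasFDerivAt_tailInt_norm {χ : ℝ → ℝ} {R : ℝ} (h : IsCutoff χ R) (y x : E) :
    HasFDerivAt (fun x => tailInt χ ‖x - y‖)
      (-(χ ‖x - y‖ / ‖x - y‖) • innerSL ℝ (x - y)) x := by
  by_cases hx : x = y
  · subst hx
    simp only [sub_self, norm_zero, div_zero, neg_zero, zero_smul]
    refine (hasFDerivAt_const (tailInt χ 0) x).congr_of_eventuallyEq ?_
    obtain ⟨δ, hδ, hδ0⟩ := Metric.eventually_nhds_iff_ball.1 h.eventually_zero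
    filter_upwards [Metric.ball_mem_nhds x hδ] with z hz
    have hz' : ‖z - x‖ < δ := by rwa [mem_ball_iff_norm] at hz
    have := h.tailInt_add 0 ‖z - x‖
    rw [intervalIntegral.integral_congr (g := fun _ => 0) (fun τ hτ => hδ0 τ ?_)] at this
    · simpa using this
    · rw [uIcc_of_le (norm_nonneg _)] at hτ
      rw [mem_ball_zero_iff, Real.norm_of_nonneg hτ.1]
      exact hτ.2.trans_lt hz'
  · have hne : x - y ≠ 0 := sub_ne_zero.2 hx
    have h1 : HasFDerivAt (fun x : E => x - y) (ContinuousLinearMap.id ℝ E) x :=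
      (hasFDerivAt_id x).sub_const y
    have h2 := (hasStrictFDerivAt_norm_sq (x - y)).hasFDerivAt.sqrt (by positivity)
    have h3 : HasFDerivAt (fun z : E => ‖z‖) (‖x - y‖⁻¹ • innerSL ℝ (x - y)) (x - y) := by
      convert! h2 using 1
      · funext z; simp
      · rw [Real.sqrt_sq (norm_nonneg _), ← Nat.cast_smul_eq_nsmul ℝ, smul_smul]
        congr 1
        push_cast
        field_simp
    have h4 := (h.hasDerivAt_tailInt ‖x - y‖).comp_hasFDerivAt x (h3.comp x h1)
    convert! h4 using 1
    rw [ContinuousLinearMap.comp_id, smul_smul, div_eq_mul_inv]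
    ring_nf

theorem fderiv_tailInt_norm {χ : ℝ → ℝ} {R : ℝ} (h : IsCutoff χ R) (y x v : E) :
    fderiv ℝ (fun x => tailInt χ ‖x - y‖) x v =
      -(χ ‖x - y‖ * (inner ℝ (x - y) v / ‖x - y‖)) := by
  rw [(hasFDerivAt_tailInt_norm h y x).fderiv]
  simp only [_root_.smul_apply, innerSL_apply_apply, smul_eq_mul]
  ring

theorem contDiff_tailInt_norm {χ : ℝ → ℝ} {R : ℝ} (h : IsCutoff χ R) (y : E) :
    ContDiff ℝ 1 fun x : E => tailInt χ ‖x - y‖ := by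
  rw [contDiff_one_iff_hasFDerivAt]
  refine ⟨_, ?_, hasFDerivAt_tailInt_norm h y⟩
  have h1 : Continuous fun x : E => χ ‖x - y‖ / ‖x - y‖ :=
    h.continuous_div.comp (continuous_id.sub continuous_const).norm
  exact h1.neg.smul ((innerSL ℝ).continuous.comp (continuous_id.sub continuous_const))

theorem integrableOn_ballIntegral {E : Type*} [NormedAddCommGroup E] [MeasurableSpace E]
    [OpensMeasurableSpace E] {μ : Measure E} [SFinite μ] {f : E → ℝ} (hf : Integrable f μ)
    (R : ℝ) : IntegrableOn (fun τ => ∫ x in Metric.ball 0 τ, f x ∂μ) (Ioo 0 R) := by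
  have hS : MeasurableSet {q : E × ℝ | ‖q.1‖ < q.2} :=
    measurableSet_lt (measurable_norm.comp measurable_fst) measurable_snd
  have h0 : Integrable (fun _ : ℝ => (1 : ℝ)) (volume.restrict (Ioo 0 R)) :=
    integrableOn_const (by simp)
  have h1 : Integrable (fun q : E × ℝ => {q : E × ℝ | ‖q.1‖ < q.2}.indicator
      (fun q => f q.1 * 1) q) (μ.prod (volume.restrict (Ioo 0 R))) := (hf.mul_prod h0).indicator hS
  refine h1.integral_prod_right.congr (Eventually.of_forall fun τ => ?_)
  simp only
  rw [← integral_indicator measurableSet_ball]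
  refine integral_congr_ae (Eventually.of_forall fun x => ?_)
  simp only [indicator, mem_ball_zero_iff, mem_ofPred_eq, mul_one]

/-- The device that replaces the divergence theorem on balls: an identity tested with all radial
cutoffs becomes, through `integral_mul_tailInt`, an identity at almost every radius. Two measures
are allowed because bulk and flat terms live on spaces of different dimension. -/
theorem ae_eq_ballIntegral {E₁ E₂ : Type*} [NormedAddCommGroup E₁] [MeasurableSpace E₁]
    [OpensMeasurableSpace E₁] {μ₁ : Measure E₁} [SFinite μ₁] {f : E₁ → ℝ} (hf : Integrable f μ₁)
    [NormedAddCommGroup E₂] [MeasurableSpace E₂]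
    [OpensMeasurableSpace E₂] {μ₂ : Measure E₂} [SFinite μ₂] {g : E₂ → ℝ} (hg : Integrable g μ₂)
    {K : ℝ → ℝ} {R : ℝ} (hK : IntegrableOn K (Ioo 0 R))
    (h : ∀ χ : ℝ → ℝ, IsCutoff χ R → ∫ s in Ioo 0 R, χ s * K s =
      (∫ x, f x * tailInt χ ‖x‖ ∂μ₁) + ∫ x, g x * tailInt χ ‖x‖ ∂μ₂) :
    ∀ᵐ s ∂(volume.restrict (Ioo 0 R)), K s =
      (∫ x in Metric.ball 0 s, f x ∂μ₁) + ∫ x in Metric.ball 0 s, g x ∂μ₂ := by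
  have hQ1 := integrableOn_ballIntegral hf R
  have hQ2 := integrableOn_ballIntegral hg R
  have := ae_eq_zero_of_forall_cutoff (K := fun s => K s -
    ((∫ x in Metric.ball 0 s, f x ∂μ₁) + ∫ x in Metric.ball 0 s, g x ∂μ₂))
    (hK.sub (hQ1.add hQ2)) (by
      intro χ h1 h2 h3 h4
      have hχ : IsCutoff χ R := ⟨h1, h2, h3, h4⟩
      obtain ⟨C, hC⟩ := h2.exists_bound_of_continuous h1
      have hb : ∀ {k : ℝ → ℝ}, IntegrableOn k (Ioo 0 R) →
          IntegrableOn (fun s => χ s * k s) (Ioo 0 R) := fun hk =>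
        hk.bdd_mul h1.aestronglyMeasurable (Eventually.of_forall hC)
      have hfull : ∀ k : ℝ → ℝ, ∫ s, χ s * k s = ∫ s in Ioo 0 R, χ s * k s := by
        intro k
        refine (setIntegral_eq_integral_of_forall_compl_eq_zero fun s hs => ?_).symm
        rw [image_eq_zero_of_notMem_tsupport fun h => hs (h3 h), zero_mul]
      have e := h χ hχ
      rw [integral_mul_tailInt hf hχ.integrable, integral_mul_tailInt hg hχ.integrable,
        hfull, hfull, ← integral_add (hb hQ1) (hb hQ2)] at e
      simp_rw [mul_sub]
      have h5 := hb (hQ1.add hQ2)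
      simp only [Pi.add_apply] at h5
      rw [integral_sub (hb hK) h5, e, sub_eq_zero]
      refine integral_congr_ae (Eventually.of_forall fun s => ?_)
      simp only [mul_add])
  filter_upwards [this] with s hs
  exact sub_eq_zero.1 hs

end Cutoff

/-! ### The equation tested with ψ(u) times a radial cutoff -/

section RadialWeak

variable {d : ℕ} {p kp km : ℝ} {u : Space d → ℝ}

namespace IsSolution

variable (hu : IsSolution p kp km u)
include hu

theorem hasFDerivAt {x : Space d} (hx : x ∈ halfBall d 1) : HasFDerivAt u (fderiv ℝ u x) x :=
  ((hu.contDiffAt hx).differentiableAt two_ne_zero).hasFDerivAt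

theorem gradient_comp {ψ : ℝ → ℝ} (hψ : ContDiff ℝ 1 ψ) {x : Space d} (hx : x ∈ halfBall d 1) :
    gradient (fun x => ψ (u x)) x = deriv ψ (u x) • gradient u x := by
  have h := ((hψ.differentiable one_ne_zero (u x)).hasDerivAt).comp_hasFDerivAt x (hu.hasFDerivAt hx)
  have h' : fderiv ℝ (fun x => ψ (u x)) x = deriv ψ (u x) • fderiv ℝ u x := h.fderiv
  unfold gradient
  rw [h', map_smul]

/-- The bounds are imposed on ψ(u) and ψ'(u) rather than on u, so that a ψ with bounded values and
derivative can be used before u is known to be bounded. -/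
theorem isAdmissible_comp {ψ : ℝ → ℝ} (hψ : ContDiff ℝ 1 ψ) {ρ K : ℝ} (hρ : ρ ≤ 1)
    (hb : ∀ x ∈ halfBall d ρ, |ψ (u x)| ≤ K ∧ |deriv ψ (u x)| ≤ K) :
    IsAdmissible (fun x => ψ (u x)) ρ K where
  contDiffOn := hψ.comp_contDiffOn ((hu.contDiffOn.of_le (by norm_num)).mono (halfBall_mono hρ))
  bound x hx := (hb x hx).1
  memLp_gradient := by
    have h1 := hu.memLp_gradient.mono_measure (Measure.restrict_mono (halfBall_mono hρ) le_rfl)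
    have h2 : MemLp (fun x => deriv ψ (u x) • gradient u x) 2
        (volume.restrict (halfBall d ρ)) := by
      have hm : AEStronglyMeasurable (fun x => deriv ψ (u x)) (volume.restrict (halfBall d ρ)) :=
        ((hψ.continuous_deriv le_rfl).comp_continuousOn
          (hu.contDiffOn.continuousOn.mono (halfBall_mono hρ))).aestronglyMeasurable
          (measurableSet_halfBall ρ)
      refine h1.of_le_mul (c := K) (hm.smul h1.1) ?_
      · filter_upwards [ae_restrict_mem (measurableSet_halfBall ρ)] with x hx
        rw [norm_smul]
        exact mul_le_mul_of_nonneg_right (hb x hx).2 (norm_nonneg _)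
    refine h2.congr_norm ?_ ?_
    · refine h2.1.congr ?_
      filter_upwards [ae_restrict_mem (measurableSet_halfBall ρ)] with x hx
      rw [hu.gradient_comp hψ (halfBall_mono hρ hx)]
    · filter_upwards [ae_restrict_mem (measurableSet_halfBall ρ)] with x hx
      rw [hu.gradient_comp hψ (halfBall_mono hρ hx)]
  trace := by
    have := ae_restrict_of_ae_restrict_of_subset (Metric.ball_subset_ball hρ) hu.trace
    filter_upwards [this] with x' hx'
    exact (hψ.continuous.tendsto _).comp hx'

end IsSolution

/-- The density `ψ(u) ∂u/∂r` (radial derivative about `y`) on the half ball of radius `ρ`,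
in coordinates centred at `y`. -/
def radialDensity (u : Space d → ℝ) (ψ : ℝ → ℝ) (ρ : ℝ) (y z : Space d) : ℝ :=
  (halfBall d ρ).indicator (fun x => ψ (u x) * (inner ℝ (x - y) (gradient u x) / ‖x - y‖)) (y + z)

/-- The density `ψ(u) |∇u|²` on the half ball of radius `ρ`, in coordinates centred at `y`. -/
def energyDensity (u : Space d → ℝ) (ψ : ℝ → ℝ) (ρ : ℝ) (y z : Space d) : ℝ :=
  (halfBall d ρ).indicator (fun x => ψ (u x) * ‖gradient u x‖ ^ 2) (y + z)

namespace IsSolution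

variable (hu : IsSolution p kp km u)
include hu

theorem integrable_radialDensity {ψ : ℝ → ℝ} (hψ : Continuous ψ) {ρ K : ℝ} (hρ : ρ ≤ 1)
    (hb : ∀ x ∈ halfBall d ρ, |ψ (u x)| ≤ K) (y : Space d) :
    Integrable (radialDensity u ψ ρ y) := by
  have h1 : IntegrableOn (fun x => ψ (u x) * (inner ℝ (x - y) (gradient u x) / ‖x - y‖))
      (halfBall d ρ) := by
    have h0 := hu.integrable_norm_gradient.mono_set (halfBall_mono hρ)
    refine (h0.const_mul K).mono' ?_ ?_
    · refine AEStronglyMeasurable.mul (((hψ.comp_continuousOn (hu.contDiffOn.continuousOn.mono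
        (halfBall_mono hρ)))).aestronglyMeasurable (measurableSet_halfBall ρ)) ?_
      have h2 := (hu.memLp_gradient.mono_measure
        (Measure.restrict_mono (halfBall_mono hρ) le_rfl)).1
      refine AEMeasurable.aestronglyMeasurable (AEMeasurable.div ?_ (by fun_prop))
      exact ((Continuous.aestronglyMeasurable (by fun_prop)).inner h2).aemeasurable
    · filter_upwards [ae_restrict_mem (measurableSet_halfBall ρ)] with x hx
      rw [norm_mul]
      refine mul_le_mul (hb x hx) ?_ (norm_nonneg _) ((abs_nonneg _).trans (hb x hx))
      rw [norm_div, norm_norm]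
      refine div_le_of_le_mul₀ (norm_nonneg _) (norm_nonneg _) ?_
      rw [mul_comm]
      exact norm_inner_le_norm _ _
  exact ((integrable_indicator_iff (measurableSet_halfBall ρ)).2 h1).comp_add_left y

theorem integrable_energyDensity {ψ : ℝ → ℝ} (hψ : Continuous ψ) {ρ K : ℝ} (hρ : ρ ≤ 1)
    (hb : ∀ x ∈ halfBall d ρ, |ψ (u x)| ≤ K) (y : Space d) :
    Integrable (energyDensity u ψ ρ y) := by
  have h1 : IntegrableOn (fun x => ψ (u x) * ‖gradient u x‖ ^ 2) (halfBall d ρ) := by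
    refine (hu.integrable_norm_gradient_sq.mono_set (halfBall_mono hρ)).bdd_mul (c := K)
      (((hψ.comp_continuousOn (hu.contDiffOn.continuousOn.mono
        (halfBall_mono hρ)))).aestronglyMeasurable (measurableSet_halfBall ρ)) ?_
    filter_upwards [ae_restrict_mem (measurableSet_halfBall ρ)] with x hx using hb x hx
  exact ((integrable_indicator_iff (measurableSet_halfBall ρ)).2 h1).comp_add_left y

/-- This is `weak_admissible` with w = ψ(u) and η = ∫_{|x-y|}^∞ χ. The gradient of η is -χ times the
radial unit vector, so the term with ∇η becomes an average over radii of sphere integrals of ψ(u)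
u_r. -/
theorem radial_weak (hp : 2 ≤ p) (hkp : 0 ≤ kp) (hkm : 0 ≤ km) {ψ : ℝ → ℝ}
    (hψ : ContDiff ℝ 1 ψ) {ρ K : ℝ} (hρ : ρ ≤ 1) (hK : 0 ≤ K)
    (hb : ∀ x ∈ halfBall d ρ, |ψ (u x)| ≤ K ∧ |deriv ψ (u x)| ≤ K) {y : Space d} {R : ℝ}
    (hyR : ‖y‖ + R ≤ ρ) {χ : ℝ → ℝ} (hχ : IsCutoff χ R) :
    IntegrableOn (fun x' : Tangential d => flux p kp km (u (pt x' 0)) * ψ (u (pt x' 0)) *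
      tailInt χ ‖pt x' 0 - y‖) (Metric.ball 0 1) ∧
    ∫ s in Ioo 0 R, χ s * sphereInt (radialDensity u ψ ρ y) s =
      (∫ z, energyDensity u (deriv ψ) ρ y z * tailInt χ ‖z‖) +
      ∫ x' in Metric.ball (0 : Tangential d) 1, flux p kp km (u (pt x' 0)) * ψ (u (pt x' 0)) *
        tailInt χ ‖pt x' 0 - y‖ := by
  obtain ⟨R₀, hR₀, hz⟩ := hχ.exists_zero_of_ge
  obtain ⟨C, hC⟩ := hχ.compact.exists_bound_of_continuous hχ.continuous
  -- The cutoff vanishes already beyond R₀ < R, which leaves the room between the support of η and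
  -- the sphere of radius ρ that `weak_admissible` demands.
  have hdist : ∀ x : Space d, ‖y‖ + R₀ ≤ ‖x‖ → R₀ ≤ ‖x - y‖ := fun x hx => by
    linarith [norm_sub_norm_le x y]
  obtain ⟨i1, i2, i3, e⟩ := hu.weak_admissible hp hkp hkm (w := fun x => ψ (u x))
    (η := fun x => tailInt χ ‖x - y‖) (ρ := ‖y‖ + R₀) (ρ' := ρ) (K := K) (by linarith) hρ hK
    (hu.isAdmissible_comp hψ hρ hb) (contDiff_tailInt_norm hχ y)
    (fun x hx => (hz _ (hdist x hx)).2)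
  have hG := hu.integrable_radialDensity hψ.continuous hρ (fun x hx => (hb x hx).1) y
  have hout : ∀ x ∈ halfBall d 1, x ∉ halfBall d ρ → R₀ ≤ ‖x - y‖ := by
    intro x hx hxρ
    refine hdist x ?_
    by_contra h
    exact hxρ (mem_halfBall.2 ⟨by linarith, hx.2⟩)
  have e1 : ∫ s in Ioo 0 R, χ s * sphereInt (radialDensity u ψ ρ y) s =
      -∫ x in halfBall d 1, ψ (u x) * fderiv ℝ (fun x => tailInt χ ‖x - y‖) x (gradient u x) := by
    rw [← hχ.setIntegral_eq, ← integral_mul_norm χ (hG.bdd_mul (c := C)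
      (hχ.continuous.comp continuous_norm).aestronglyMeasurable (Eventually.of_forall fun z => hC _)),
      ← integral_neg, ← integral_indicator (measurableSet_halfBall 1)]
    symm
    rw [← integral_add_left_eq_self _ y]
    symm
    refine integral_congr_ae (Eventually.of_forall fun z => ?_)
    simp only [radialDensity]
    by_cases hx : y + z ∈ halfBall d ρ
    · rw [indicator_of_mem hx, indicator_of_mem (halfBall_mono hρ hx), fderiv_tailInt_norm hχ]
      simp only [add_sub_cancel_left]
      ring
    · rw [indicator_of_notMem hx]
      by_cases hx1 : y + z ∈ halfBall d 1
      · rw [indicator_of_mem hx1, fderiv_tailInt_norm hχ, (hz _ (hout _ hx1 hx)).1]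
        simp
      · rw [indicator_of_notMem hx1]; simp
  have e2 : ∫ z, energyDensity u (deriv ψ) ρ y z * tailInt χ ‖z‖ =
      ∫ x in halfBall d 1, tailInt χ ‖x - y‖ *
        inner ℝ (gradient u x) (gradient (fun x => ψ (u x)) x) := by
    rw [← integral_indicator (measurableSet_halfBall 1)]
    symm
    rw [← integral_add_left_eq_self _ y]
    symm
    refine integral_congr_ae (Eventually.of_forall fun z => ?_)
    simp only [energyDensity]
    by_cases hx : y + z ∈ halfBall d ρ
    · rw [indicator_of_mem hx, indicator_of_mem (halfBall_mono hρ hx),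
        hu.gradient_comp hψ (halfBall_mono hρ hx), inner_smul_right, real_inner_self_eq_norm_sq]
      simp only [add_sub_cancel_left]
      ring
    · rw [indicator_of_notMem hx]
      by_cases hx1 : y + z ∈ halfBall d 1
      · rw [indicator_of_mem hx1, (hz _ (hout _ hx1 hx)).2]
        simp
      · rw [indicator_of_notMem hx1]; simp
  have e3 : ∀ x' : Tangential d, flux p kp km (u (pt x' 0)) * ψ (u (pt x' 0)) *
        tailInt χ ‖pt x' 0 - y‖ = flux p kp km (u (pt x' 0)) *
        (tailInt χ ‖pt x' 0 - y‖ * ψ (u (pt x' 0))) := fun x' => by ring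
  simp_rw [e3]
  refine ⟨i3, ?_⟩
  unfold flatIntegral at e
  linarith

end IsSolution

end RadialWeak

/-! ### Sub-mean-value inequalities up to the flat boundary, and local boundedness -/

section MeanValue

variable {d : ℕ} {p kp km : ℝ} {u : Space d → ℝ}

/-- Data for testing the equation with `Ψ'(u)`, `Ψ` convex with minimum at `0`. -/
structure IsConvexTest (u : Space d → ℝ) (Ψ ψ : ℝ → ℝ) (ρ K : ℝ) : Prop where
  contDiff : ContDiff ℝ 1 ψ
  hasDerivAt : ∀ s, HasDerivAt Ψ (ψ s) s
  bound : ∀ x ∈ halfBall d ρ, |ψ (u x)| ≤ K ∧ |deriv ψ (u x)| ≤ K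
  deriv_nonneg : ∀ s, 0 ≤ deriv ψ s
  mul_nonneg : ∀ s, 0 ≤ s * ψ s
  nonneg : ∀ s, 0 ≤ Ψ s
  integrable : IntegrableOn (fun x => Ψ (u x)) (halfBall d ρ)

/-- The flux has the sign of its argument. This is what makes the boundary term help rather than
hurt in the sub-mean-value property. -/
theorem flux_mul_nonneg (hp : 2 ≤ p) (hkp : 0 ≤ kp) (hkm : 0 ≤ km) {s t : ℝ} (h : 0 ≤ s * t) :
    0 ≤ flux p kp km s * t := by
  have h1 : p - 1 ≠ 0 := by linarith
  unfold flux
  rcases lt_trichotomy s 0 with hs | hs | hs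
  · have ht : t ≤ 0 := by nlinarith
    rw [max_eq_right hs.le, Real.zero_rpow h1, max_eq_left (by linarith)]
    have : 0 ≤ km * (-s) ^ (p - 1) := mul_nonneg hkm (Real.rpow_nonneg (by linarith) _)
    nlinarith
  · subst hs
    simp [Real.zero_rpow h1]
  · have ht : 0 ≤ t := by nlinarith
    rw [max_eq_right (by linarith : -s ≤ 0), Real.zero_rpow h1, max_eq_left hs.le]
    have : 0 ≤ kp * s ^ (p - 1) := mul_nonneg hkp (Real.rpow_nonneg hs.le _)
    nlinarith

/-- Every ray from `y` of length `R` stays inside or outside the half ball of radius `ρ`. -/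
def RayRegular (y : Space d) (R ρ : ℝ) : Prop :=
  ∀ ω : Metric.sphere (0 : Space d) 1,
    (∀ s ∈ Ioo 0 R, y + s • (ω : Space d) ∈ halfBall d ρ) ∨
    ∀ s ∈ Ioo 0 R, y + s • (ω : Space d) ∉ halfBall d ρ

theorem norm_smul_sphere (ω : Metric.sphere (0 : Space d) 1) {s : ℝ} (hs : 0 ≤ s) :
    ‖s • (ω : Space d)‖ = s := by
  rw [norm_smul, norm_eq_of_mem_sphere, mul_one, Real.norm_of_nonneg hs]

theorem norm_add_smul_sphere_lt {y : Space d} {R ρ s : ℝ} (hyR : ‖y‖ + R ≤ ρ) (hs : s ∈ Ioo 0 R)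
    (ω : Metric.sphere (0 : Space d) 1) : ‖y + s • (ω : Space d)‖ < ρ := by
  have := norm_add_le y (s • (ω : Space d))
  rw [norm_smul_sphere ω hs.1.le] at this
  linarith [hs.2]

theorem rayRegular_of_flat {y : Space d} {R ρ : ℝ} (hy : y (Fin.last d) = 0) (hyR : ‖y‖ + R ≤ ρ) :
    RayRegular y R ρ := by
  intro ω
  have hl : ∀ s : ℝ, (y + s • (ω : Space d)) (Fin.last d) = s * (ω : Space d) (Fin.last d) := by
    intro s; simp [hy]
  rcases lt_or_ge 0 ((ω : Space d) (Fin.last d)) with h | h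
  · refine Or.inl fun s hs => mem_halfBall.2 ⟨norm_add_smul_sphere_lt hyR hs ω, ?_⟩
    rw [hl]; exact mul_pos hs.1 h
  · refine Or.inr fun s hs hmem => ?_
    have := hmem.2
    rw [hl] at this
    nlinarith [hs.1]

theorem rayRegular_of_interior {y : Space d} {R ρ : ℝ} (hy : R ≤ y (Fin.last d))
    (hyR : ‖y‖ + R ≤ ρ) : RayRegular y R ρ := by
  intro ω
  refine Or.inl fun s hs => mem_halfBall.2 ⟨norm_add_smul_sphere_lt hyR hs ω, ?_⟩
  have h1 : |(s • (ω : Space d)) (Fin.last d)| ≤ s :=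
    (PiLp.norm_apply_le (s • (ω : Space d)) _).trans (norm_smul_sphere ω hs.1.le).le
  have h2 : (y + s • (ω : Space d)) (Fin.last d) =
      y (Fin.last d) + (s • (ω : Space d)) (Fin.last d) := by simp
  rw [h2]
  linarith [(abs_le.1 h1).1, hs.2]

/-- `v` on the half ball of radius `ρ`, extended by zero, in coordinates centred at `y`. -/
def valueDensity (v : Space d → ℝ) (ρ : ℝ) (y z : Space d) : ℝ := (halfBall d ρ).indicator v (y + z)

theorem setIntegral_valueDensity (v : Space d → ℝ) (ρ : ℝ) (y : Space d) (r : ℝ) :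
    ∫ z in Metric.ball 0 r, valueDensity v ρ y z =
      ∫ x in Metric.ball y r, (halfBall d ρ).indicator v x := by
  rw [← integral_indicator measurableSet_ball, ← integral_indicator measurableSet_ball,
    ← integral_add_left_eq_self ((Metric.ball y r).indicator ((halfBall d ρ).indicator v)) y]
  refine integral_congr_ae (Eventually.of_forall fun z => ?_)
  simp only [indicator, mem_ball_iff_norm, add_sub_cancel_left, sub_zero, valueDensity]

theorem IsConvexTest.integrable_valueDensity {Ψ ψ : ℝ → ℝ} {ρ K : ℝ}
    (h : IsConvexTest u Ψ ψ ρ K) (y : Space d) :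
    Integrable (valueDensity (fun x => Ψ (u x)) ρ y) :=
  ((integrable_indicator_iff (measurableSet_halfBall ρ)).2 h.integrable).comp_add_left y

namespace IsSolution

variable (hu : IsSolution p kp km u)
include hu

/-- By `RayRegular` no ray crosses the boundary of the half ball within (0, R), so the extension by
zero creates no jump along rays. -/
theorem hasDerivAt_ray {Ψ ψ : ℝ → ℝ} (hΨ : ∀ s, HasDerivAt Ψ (ψ s) s) {ρ R : ℝ}
    (hρ : ρ ≤ 1) {y : Space d} (hy : RayRegular y R ρ)
    (ω : Metric.sphere (0 : Space d) 1) {s : ℝ} (hs : s ∈ Ioo 0 R) :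
    HasDerivAt (fun s : ℝ => valueDensity (fun x => Ψ (u x)) ρ y (s • (ω : Space d)))
      (radialDensity u ψ ρ y (s • (ω : Space d))) s := by
  rcases hy ω with h | h
  · have hmem := h s hs
    have h1 : HasDerivAt (fun s : ℝ => y + s • (ω : Space d)) (ω : Space d) s := by
      simpa using ((hasDerivAt_id s).smul_const (ω : Space d)).const_add y
    have h2 := (hu.hasFDerivAt (halfBall_mono hρ hmem)).comp_hasDerivAt s h1
    have h3 := (hΨ (u (y + s • (ω : Space d)))).comp s h2
    have h4 : radialDensity u ψ ρ y (s • (ω : Space d)) =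
        ψ (u (y + s • (ω : Space d))) * fderiv ℝ u (y + s • (ω : Space d)) ω := by
      unfold radialDensity
      rw [indicator_of_mem hmem, add_sub_cancel_left, norm_smul_sphere ω hs.1.le,
        inner_smul_left, real_inner_comm, inner_gradient_left, conj_trivial,
        mul_div_cancel_left₀ _ hs.1.ne']
    rw [h4]
    refine h3.congr_of_eventuallyEq ?_
    filter_upwards [isOpen_Ioo.mem_nhds hs] with τ hτ
    simp [valueDensity, h τ hτ]
  · have h4 : radialDensity u ψ ρ y (s • (ω : Space d)) = 0 := by
      unfold radialDensity
      rw [indicator_of_notMem (h s hs)]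
    rw [h4]
    refine (hasDerivAt_const s (0 : ℝ)).congr_of_eventuallyEq ?_
    filter_upwards [isOpen_Ioo.mem_nhds hs] with τ hτ
    simp [valueDensity, h τ hτ]

/-- `radial_weak` localised to almost every radius, for centres on the flat boundary: there the
distance from the centre to a flat point is the tangential distance, so the flat term is also a ball
integral. -/
theorem sphereInt_radialDensity_flat (hp : 2 ≤ p) (hkp : 0 ≤ kp) (hkm : 0 ≤ km)
    {ψ : ℝ → ℝ} (hψ : ContDiff ℝ 1 ψ) {ρ K : ℝ} (hρ : ρ ≤ 1) (hK : 0 ≤ K)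
    (hb : ∀ x ∈ halfBall d ρ, |ψ (u x)| ≤ K ∧ |deriv ψ (u x)| ≤ K) {y' : Tangential d} {R : ℝ}
    (hyR : ‖y'‖ + R ≤ ρ)
    (hi : IntegrableOn (fun x' : Tangential d => flux p kp km (u (pt x' 0)) * ψ (u (pt x' 0)))
      (Metric.ball 0 ρ)) :
    ∀ᵐ s ∂(volume.restrict (Ioo 0 R)), sphereInt (radialDensity u ψ ρ (pt y' 0)) s =
      (∫ z in Metric.ball 0 s, energyDensity u (deriv ψ) ρ (pt y' 0) z) +
      ∫ z' in Metric.ball (0 : Tangential d) s, (Metric.ball 0 ρ).indicator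
        (fun x' : Tangential d => flux p kp km (u (pt x' 0)) * ψ (u (pt x' 0))) (y' + z') := by
  have hG := hu.integrable_radialDensity hψ.continuous hρ (fun x hx => (hb x hx).1) (pt y' 0)
  have hE := hu.integrable_energyDensity (hψ.continuous_deriv le_rfl) hρ
    (fun x hx => (hb x hx).2) (pt y' 0)
  have hF : Integrable (fun z' : Tangential d => (Metric.ball 0 ρ).indicator
      (fun x' : Tangential d => flux p kp km (u (pt x' 0)) * ψ (u (pt x' 0))) (y' + z')) :=
    ((integrable_indicator_iff measurableSet_ball).2 hi).comp_add_left y'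
  refine ae_eq_ballIntegral hE hF
    ((integrableOn_sphereInt hG).mono_set Ioo_subset_Ioi_self) fun χ hχ => ?_
  rw [(hu.radial_weak hp hkp hkm hψ hρ hK hb (y := pt y' 0) (by rwa [norm_pt_zero]) hχ).2]
  congr 1
  obtain ⟨R₀, hR₀, hz⟩ := hχ.exists_zero_of_ge
  rw [← integral_indicator measurableSet_ball, ← integral_add_left_eq_self _ y']
  refine integral_congr_ae (Eventually.of_forall fun z' => ?_)
  simp only
  have e1 : ‖pt (y' + z') 0 - pt y' 0‖ = ‖z'‖ := by
    rw [pt_sub_pt, add_sub_cancel_left, sub_zero, norm_pt_zero]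
  by_cases hx : y' + z' ∈ Metric.ball (0 : Tangential d) ρ
  · rw [indicator_of_mem hx, indicator_of_mem (Metric.ball_subset_ball hρ hx), e1]
  · rw [indicator_of_notMem hx]
    have : tailInt χ ‖z'‖ = 0 := by
      refine (hz _ ?_).2
      rw [mem_ball_zero_iff, not_lt] at hx
      linarith [norm_add_le y' z']
    by_cases hx1 : y' + z' ∈ Metric.ball (0 : Tangential d) 1
    · rw [indicator_of_mem hx1, e1, this]; simp
    · rw [indicator_of_notMem hx1]; simp

theorem integrableOn_flux_mul (hp : 2 ≤ p) (hkp : 0 ≤ kp) (hkm : 0 ≤ km)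
    {ψ : ℝ → ℝ} (hψ : Continuous ψ) {ρ K : ℝ} (hρ : ρ ≤ 1)
    (hb : ∀ x ∈ halfBall d ρ, |ψ (u x)| ≤ K) :
    IntegrableOn (fun x' : Tangential d => flux p kp km (u (pt x' 0)) * ψ (u (pt x' 0)))
      (Metric.ball 0 ρ) := by
  refine ((hu.integrable_flux hp hkp hkm).mono_set (Metric.ball_subset_ball hρ)).mul_bdd (c := K)
    ((hψ.comp_aestronglyMeasurable hu.memLp_trace.1).mono_measure
      (Measure.restrict_mono (Metric.ball_subset_ball hρ) le_rfl)) ?_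
  filter_upwards [ae_restrict_of_ae_restrict_of_subset (Metric.ball_subset_ball hρ) hu.trace,
    ae_restrict_mem measurableSet_ball] with x' hx' hmem
  refine le_of_tendsto ((hψ.tendsto _).comp hx').norm ?_
  have h1 : Tendsto (fun t : ℝ => ‖pt x' t‖) (𝓝[>] 0) (𝓝 ‖x'‖) := by
    have : Continuous fun t : ℝ => ‖pt x' t‖ := by fun_prop
    have := this.tendsto 0
    rw [norm_pt_zero] at this
    exact this.mono_left nhdsWithin_le_nhds
  filter_upwards [h1.eventually_lt_const (mem_ball_zero_iff.1 hmem), self_mem_nhdsWithin]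
    with t ht ht0
  exact hb _ (mem_halfBall.2 ⟨ht, by simpa using ht0⟩)

/-- Both the energy term ψ'(u)|∇u|² and the boundary term flux(u) ψ(u) are nonnegative. The two
admitted positions of the centre are those for which rays behave well: on the flat boundary, or at
height at least R. -/
theorem sphereInt_radialDensity_nonneg (hp : 2 ≤ p) (hkp : 0 ≤ kp) (hkm : 0 ≤ km)
    {Ψ ψ : ℝ → ℝ} {ρ K : ℝ} (hρ : ρ ≤ 1) (hK : 0 ≤ K) (h : IsConvexTest u Ψ ψ ρ K)
    {y : Space d} {R : ℝ} (hR : 0 < R)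
    (hyR : ‖y‖ + R ≤ ρ) (hy : y (Fin.last d) = 0 ∨ R ≤ y (Fin.last d)) :
    ∀ᵐ s ∂(volume.restrict (Ioo 0 R)), 0 ≤ sphereInt (radialDensity u ψ ρ y) s := by
  have hE0 : ∀ z, 0 ≤ energyDensity u (deriv ψ) ρ y z := fun z =>
    indicator_nonneg (fun x _ => mul_nonneg (h.deriv_nonneg _) (sq_nonneg _)) _
  have hfl0 : ∀ s, 0 ≤ flux p kp km s * ψ s := fun s => flux_mul_nonneg hp hkp hkm (h.mul_nonneg s)
  rcases hy with hy | hy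
  · obtain ⟨y', hy'⟩ := exists_eq_pt y
    rw [hy] at hy'
    subst hy'
    rw [norm_pt_zero] at hyR
    filter_upwards [hu.sphereInt_radialDensity_flat hp hkp hkm h.contDiff hρ hK h.bound hyR
      (hu.integrableOn_flux_mul hp hkp hkm h.contDiff.continuous hρ fun x hx => (h.bound x hx).1)]
      with s hs
    rw [hs]
    exact add_nonneg (integral_nonneg hE0)
      (integral_nonneg fun z => indicator_nonneg (fun x _ => hfl0 _) _)
  · have hG := hu.integrable_radialDensity h.contDiff.continuous hρ
      (fun x hx => (h.bound x hx).1) y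
    have hE := hu.integrable_energyDensity (h.contDiff.continuous_deriv le_rfl) hρ
      (fun x hx => (h.bound x hx).2) y
    -- For an interior centre the flat term is zero: flat points are at distance at least y_n ≥ R
    -- from y, beyond the support of the cutoff.
    have := ae_eq_ballIntegral (g := fun _ : Tangential d => (0 : ℝ)) hE
      (integrable_zero (Tangential d) ℝ volume)
      ((integrableOn_sphereInt hG).mono_set Ioo_subset_Ioi_self) (fun χ hχ => by
        rw [(hu.radial_weak hp hkp hkm h.contDiff hρ hK h.bound hyR hχ).2]
        congr 1
        obtain ⟨R₀, hR₀, hz⟩ := hχ.exists_zero_of_ge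
        simp only [zero_mul, integral_zero]
        refine integral_eq_zero_of_ae (Eventually.of_forall fun x' => ?_)
        have h1 : ‖(pt x' 0 - y) (Fin.last d)‖ ≤ ‖pt x' 0 - y‖ :=
          PiLp.norm_apply_le (pt x' 0 - y) _
        have h2 : (pt x' 0 - y) (Fin.last d) = -y (Fin.last d) := by simp
        rw [h2, norm_neg, Real.norm_eq_abs, abs_of_pos (hR.trans_le hy)] at h1
        simp only [(hz _ (hR₀.le.trans (hy.trans h1))).2, mul_zero, Pi.zero_apply])
    filter_upwards [this] with s hs
    rw [hs]
    simpa using integral_nonneg hE0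

/-- Means of `Ψ(u)` over (half) spheres are nondecreasing. -/
theorem mean_mono (hp : 2 ≤ p) (hkp : 0 ≤ kp) (hkm : 0 ≤ km)
    {Ψ ψ : ℝ → ℝ} {ρ K : ℝ} (hρ : ρ ≤ 1) (hK : 0 ≤ K) (h : IsConvexTest u Ψ ψ ρ K)
    {y : Space d} {R : ℝ} (hR : 0 < R)
    (hyR : ‖y‖ + R ≤ ρ) (hy : y (Fin.last d) = 0 ∨ R ≤ y (Fin.last d)) {a b : ℝ} (ha : 0 < a)
    (hab : a ≤ b) (hb : b < R) :
    ∫ ω : Metric.sphere (0 : Space d) 1, valueDensity (fun x => Ψ (u x)) ρ y (a • (ω : Space d))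
      ∂(volume : Measure (Space d)).toSphere ≤
    ∫ ω : Metric.sphere (0 : Space d) 1, valueDensity (fun x => Ψ (u x)) ρ y (b • (ω : Space d))
      ∂(volume : Measure (Space d)).toSphere := by
  have hreg : RayRegular y R ρ := hy.elim (fun h => rayRegular_of_flat h hyR)
    (fun h => rayRegular_of_interior h hyR)
  have hv := h.integrable_valueDensity y
  have hg := hu.integrable_radialDensity h.contDiff.continuous hρ (fun x hx => (h.bound x hx).1) y
  have hd := fun ω s hs => hu.hasDerivAt_ray h.hasDerivAt hρ hreg ω (s := s) hs
  have h1 := ray_integrable_sphere hv hg hd (s := a) ⟨ha, hab.trans_lt hb⟩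
  have h2 := ray_integrable_sphere hv hg hd (s := b) ⟨ha.trans_le hab, hb⟩
  obtain ⟨-, -, e⟩ := ray_identity hg hd ha hab hb
  rw [integral_sub h2 h1] at e
  -- The increment of the mean is the integral over radii of the mean of the radial derivative,
  -- which is nonnegative.
  have h3 : 0 ≤ ∫ s in a..b, ∫ ω : Metric.sphere (0 : Space d) 1,
      radialDensity u ψ ρ y (s • (ω : Space d)) ∂(volume : Measure (Space d)).toSphere := by
    refine intervalIntegral.integral_nonneg_of_ae_restrict hab ?_
    have hsub : Icc a b ⊆ Ioo 0 R := fun s hs => ⟨ha.trans_le hs.1, hs.2.trans_lt hb⟩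
    have := ae_restrict_of_ae_restrict_of_subset hsub
      (hu.sphereInt_radialDensity_nonneg hp hkp hkm hρ hK h hR hyR hy)
    filter_upwards [this, ae_restrict_mem measurableSet_Icc] with s hs hmem
    have hs0 : 0 < s := ha.trans_le hmem.1
    exact nonneg_of_mul_nonneg_right hs (by positivity)
  linarith

/-- Monotone spherical means give monotone ball averages: rescale the radial variable of the smaller
ball by b/a and compare sphere by sphere. -/
theorem ballAverage_mono (hp : 2 ≤ p) (hkp : 0 ≤ kp) (hkm : 0 ≤ km)
    {Ψ ψ : ℝ → ℝ} {ρ K : ℝ} (hρ : ρ ≤ 1) (hK : 0 ≤ K) (h : IsConvexTest u Ψ ψ ρ K)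
    {y : Space d} {R : ℝ}
    (hyR : ‖y‖ + R ≤ ρ) (hy : y (Fin.last d) = 0 ∨ R ≤ y (Fin.last d)) {a b : ℝ} (ha : 0 < a)
    (hab : a ≤ b) (hb : b < R) :
    ∫ z in Metric.ball 0 a, valueDensity (fun x => Ψ (u x)) ρ y z ≤
      (a / b) ^ (d + 1) * ∫ z in Metric.ball 0 b, valueDensity (fun x => Ψ (u x)) ρ y z := by
  have hv := h.integrable_valueDensity y
  have hb0 : 0 < b := ha.trans_le hab
  have hc0 : 0 < a / b := by positivity
  set f := valueDensity (fun x => Ψ (u x)) ρ y with hf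
  have hii : ∀ r : ℝ, 0 ≤ r → IntervalIntegrable (sphereInt f) volume 0 r := fun r hr =>
    (intervalIntegrable_iff_integrableOn_Ioc_of_le hr).2
      ((integrableOn_sphereInt hv).mono_set Ioc_subset_Ioi_self)
  rw [setIntegral_ball_eq hv ha.le, setIntegral_ball_eq hv hb0.le]
  have e1 : ∫ s in (0 : ℝ)..a, sphereInt f s =
      (a / b) * ∫ s in (0 : ℝ)..b, sphereInt f (a / b * s) := by
    rw [intervalIntegral.integral_comp_mul_left (fun s => sphereInt f s) hc0.ne', smul_eq_mul,
      mul_zero, div_mul_cancel₀ _ hb0.ne', ← mul_assoc, mul_inv_cancel₀ hc0.ne', one_mul]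
  rw [e1, pow_succ', mul_assoc]
  refine mul_le_mul_of_nonneg_left ?_ hc0.le
  rw [← intervalIntegral.integral_const_mul]
  refine intervalIntegral.integral_mono_on_of_le_Ioo hb0.le ?_ ((hii b hb0.le).const_mul _) ?_
  · have := (hii a ha.le).comp_mul_left (c := a / b)
    simpa [div_div_cancel₀ ha.ne'] using this
  · intro s hs
    unfold sphereInt
    have hfr : Module.finrank ℝ (Space d) - 1 = d := by simp
    rw [hfr, mul_pow, mul_assoc]
    have hs' : a / b * s ≤ s := by
      have : a / b ≤ 1 := (div_le_one hb0).2 hab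
      nlinarith [hs.1]
    have := hu.mean_mono hp hkp hkm hρ hK h (hb0.trans hb) hyR hy (mul_pos hc0 hs.1) hs'
      (hs.2.trans hb)
    exact mul_le_mul_of_nonneg_left (mul_le_mul_of_nonneg_left this (pow_nonneg hs.1.le _))
      (by positivity)

/-- Sub-mean-value inequality at interior points. -/
theorem le_ballAverage (hp : 2 ≤ p) (hkp : 0 ≤ kp) (hkm : 0 ≤ km)
    {Ψ ψ : ℝ → ℝ} {ρ K : ℝ} (hρ : ρ ≤ 1) (hK : 0 ≤ K) (h : IsConvexTest u Ψ ψ ρ K)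
    {x : Space d} {R r : ℝ} (hxR : ‖x‖ + R ≤ ρ) (hx : R ≤ x (Fin.last d)) (hr : 0 < r)
    (hrR : r < R) :
    Ψ (u x) * (volume.real (Metric.ball (0 : Space d) 1) * r ^ (d + 1)) ≤
      ∫ z in Metric.ball x r, (halfBall d ρ).indicator (fun x => Ψ (u x)) z := by
  set ω₀ := volume.real (Metric.ball (0 : Space d) 1) with hω₀
  have hω : 0 < ω₀ := ENNReal.toReal_pos (Metric.measure_ball_pos _ _ one_pos).ne'
    measure_ball_lt_top.ne
  have hvol : ∀ ε : ℝ, 0 < ε → volume.real (Metric.ball x ε) = ε ^ (d + 1) * ω₀ := by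
    intro ε hε
    rw [Measure.real, Measure.addHaar_ball_of_pos volume x hε, ENNReal.toReal_mul,
      ENNReal.toReal_ofReal (by positivity), finrank_euclideanSpace_fin]
    rfl
  have hR : 0 < R := hr.trans hrR
  have hmem : x ∈ halfBall d ρ := mem_halfBall.2 ⟨by linarith, by linarith⟩
  have hcont : ContinuousAt (fun x => Ψ (u x)) x :=
    (h.hasDerivAt _).continuousAt.comp (f := u) (hu.contDiffAt (halfBall_mono hρ hmem)).continuousAt
  refine le_of_forall_sub_le fun ε hε => ?_
  -- By continuity Ψ(u) exceeds c on a small ball about x, so its average there is at least c, and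
  -- averages increase with the radius.
  have hgoal : ∀ c < Ψ (u x), c * (ω₀ * r ^ (d + 1)) ≤
      ∫ z in Metric.ball x r, (halfBall d ρ).indicator (fun x => Ψ (u x)) z := by
    intro c hc
    have hev : ∀ᶠ z in 𝓝 x, z ∈ halfBall d ρ ∧ c < Ψ (u z) :=
      Eventually.and ((isOpen_halfBall ρ).mem_nhds hmem) (hcont.eventually (lt_mem_nhds hc))
    obtain ⟨η, hη, hball⟩ := Metric.eventually_nhds_iff_ball.1 hev
    set e := min η r with he
    have he0 : 0 < e := lt_min hη hr
    have h1 := hu.ballAverage_mono hp hkp hkm hρ hK h hxR (Or.inr hx) he0 (min_le_right η r) hrR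
    rw [setIntegral_valueDensity, setIntegral_valueDensity] at h1
    have hi : IntegrableOn ((halfBall d ρ).indicator fun x => Ψ (u x)) (Metric.ball x e) :=
      ((integrable_indicator_iff (measurableSet_halfBall ρ)).2 h.integrable).integrableOn
    have h2 : c * (e ^ (d + 1) * ω₀) ≤
        ∫ z in Metric.ball x e, (halfBall d ρ).indicator (fun x => Ψ (u x)) z := by
      rw [← hvol e he0]
      have h3 : ∫ _ in Metric.ball x e, c = c * volume.real (Metric.ball x e) := by
        simp [mul_comm]
      rw [← h3]
      refine setIntegral_mono_on (integrableOn_const measure_ball_lt_top.ne) hi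
        measurableSet_ball fun z hz => ?_
      obtain ⟨hz1, hz2⟩ := hball z (Metric.ball_subset_ball (min_le_left _ _) hz)
      rw [indicator_of_mem hz1]
      exact hz2.le
    have h4 := h2.trans h1
    rw [div_pow, div_mul_eq_mul_div, le_div_iff₀ (by positivity)] at h4
    have h5 : 0 < e ^ (d + 1) := by positivity
    refine le_of_mul_le_mul_left ?_ h5
    linarith
  have h6 := hgoal (Ψ (u x) - ε / (ω₀ * r ^ (d + 1))) (by
    have : 0 < ε / (ω₀ * r ^ (d + 1)) := by positivity
    linarith)
  rw [sub_mul, div_mul_cancel₀ _ (by positivity)] at h6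
  exact h6

/-- Points at height at least δ/4 have room for an interior ball. A point at lower height t is
treated in two stages: from the ball of radius t/2 about it to the ball of radius 2t about its foot
on the flat boundary, then to radius δ/2 about the foot. -/
theorem local_bound (hp : 2 ≤ p) (hkp : 0 ≤ kp) (hkm : 0 ≤ km)
    {Ψ ψ : ℝ → ℝ} {ρ K : ℝ} (hρ : ρ ≤ 1) (hK : 0 ≤ K) (h : IsConvexTest u Ψ ψ ρ K)
    {ρ₀ : ℝ} (hρ₀ : ρ₀ < ρ) {x : Space d} (hx : x ∈ halfBall d ρ₀) :
    Ψ (u x) * volume.real (Metric.ball (0 : Space d) 1) * (ρ - ρ₀) ^ (d + 1) ≤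
      8 ^ (d + 1) * ∫ z in halfBall d ρ, Ψ (u z) := by
  set δ := ρ - ρ₀ with hδ
  have hδ0 : 0 < δ := by linarith
  obtain ⟨hx1, hx2⟩ := mem_halfBall.1 hx
  set t := x (Fin.last d) with ht
  have hF : Integrable ((halfBall d ρ).indicator fun x => Ψ (u x)) :=
    (integrable_indicator_iff (measurableSet_halfBall ρ)).2 h.integrable
  have hF0 : ∀ z, 0 ≤ (halfBall d ρ).indicator (fun x => Ψ (u x)) z := fun z =>
    indicator_nonneg (fun x _ => h.nonneg _) _
  have hle : ∀ (y : Space d) (r : ℝ), ∫ z in Metric.ball y r,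
      (halfBall d ρ).indicator (fun x => Ψ (u x)) z ≤ ∫ z in halfBall d ρ, Ψ (u z) := by
    intro y r
    rw [← integral_indicator (measurableSet_halfBall ρ)]
    exact setIntegral_le_integral hF (Eventually.of_forall hF0)
  rcases le_or_gt (δ / 4) t with htδ | htδ
  · have h1 := hu.le_ballAverage hp hkp hkm hρ hK h (x := x) (R := δ / 4) (r := δ / 8)
      (by linarith) htδ (by positivity) (by linarith)
    have h2 := h1.trans (hle x (δ / 8))
    rw [div_pow, mul_div_assoc', mul_div_assoc', div_le_iff₀ (by positivity)] at h2
    linarith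
  · have h1 := hu.le_ballAverage hp hkp hkm hρ hK h (x := x) (R := t) (r := t / 2)
      (by linarith) le_rfl (by linarith) (by linarith)
    obtain ⟨y', hy'⟩ := exists_eq_pt x
    rw [← ht] at hy'
    set y := pt y' 0 with hy
    have hyx : x - y = pt 0 t := by
      rw [hy]; nth_rewrite 1 [hy']; rw [pt_sub_pt]; simp
    have hxy : ‖x - y‖ ^ 2 = t ^ 2 := by rw [hyx, norm_pt_sq]; simp
    have hxy' : ‖x - y‖ = t := (pow_left_inj₀ (norm_nonneg _) hx2.le two_ne_zero).1 hxy
    have hyn : ‖y‖ ≤ ‖x‖ := by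
      refine le_of_sq_le_sq ?_ (norm_nonneg _)
      rw [hy, hy', norm_pt_sq, norm_pt_sq]
      nlinarith
    have hsub : Metric.ball x (t / 2) ⊆ Metric.ball y (2 * t) := by
      refine Metric.ball_subset_ball' ?_
      rw [dist_eq_norm, hxy']
      linarith
    have h2 : ∫ z in Metric.ball x (t / 2), (halfBall d ρ).indicator (fun x => Ψ (u x)) z ≤
        ∫ z in Metric.ball y (2 * t), (halfBall d ρ).indicator (fun x => Ψ (u x)) z :=
      setIntegral_mono_set hF.integrableOn (Eventually.of_forall hF0) hsub.eventuallyLE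
    have h3 := hu.ballAverage_mono hp hkp hkm hρ hK h (y := y) (R := δ) (a := 2 * t) (b := δ / 2)
      (by linarith) (Or.inl (by simp [hy])) (by linarith) (by linarith) (by linarith)
    rw [setIntegral_valueDensity, setIntegral_valueDensity] at h3
    have h4 : Ψ (u x) * (volume.real (Metric.ball (0 : Space d) 1) * (t / 2) ^ (d + 1)) ≤
        (2 * t / (δ / 2)) ^ (d + 1) * ∫ z in halfBall d ρ, Ψ (u z) :=
      (h1.trans (h2.trans h3)).trans (mul_le_mul_of_nonneg_left (hle y _) (by positivity))
    -- The factor (t/2)^(d+1) is the one on the left-hand side; after cancellation the bound no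
    -- longer depends on the height t.
    have e1 : (2 * t / (δ / 2)) ^ (d + 1) = (t / 2) ^ (d + 1) * (8 ^ (d + 1) / δ ^ (d + 1)) := by
      rw [← div_pow, ← mul_pow]
      congr 1
      field_simp
      ring
    rw [e1] at h4
    have h5 : 0 < (t / 2) ^ (d + 1) := by positivity
    have h6 : Ψ (u x) * volume.real (Metric.ball (0 : Space d) 1) ≤
        8 ^ (d + 1) / δ ^ (d + 1) * ∫ z in halfBall d ρ, Ψ (u z) := by
      refine le_of_mul_le_mul_left ?_ h5
      linarith
    rw [div_mul_eq_mul_div, le_div_iff₀ (by positivity)] at h6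
    exact h6

/-- Local boundedness up to the flat part of the boundary. -/
theorem exists_bound (hp : 2 ≤ p) (hkp : 0 ≤ kp) (hkm : 0 ≤ km) {ρ : ℝ} (hρ : ρ < 1) :
    ∃ K, 0 ≤ K ∧ ∀ x ∈ halfBall d ρ, |u x| ≤ K := by
  have hpos : ∀ s : ℝ, 0 < 1 + s ^ 2 := fun s => by positivity
  have hsq : ∀ s : ℝ, √(1 + s ^ 2) ^ 2 = 1 + s ^ 2 := fun s => Real.sq_sqrt (hpos s).le
  have hsp : ∀ s : ℝ, 0 < √(1 + s ^ 2) := fun s => Real.sqrt_pos.2 (hpos s)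
  have h1le : ∀ s : ℝ, 1 ≤ √(1 + s ^ 2) := fun s => Real.one_le_sqrt.2 (by nlinarith)
  have habs : ∀ s : ℝ, |s| ≤ √(1 + s ^ 2) := fun s => by
    rw [← Real.sqrt_sq_eq_abs]; exact Real.sqrt_le_sqrt (by linarith)
  have hΨ : ∀ s : ℝ, HasDerivAt (fun s => √(1 + s ^ 2)) (s / √(1 + s ^ 2)) s := fun s => by
    have h := (((hasDerivAt_id s).pow 2).const_add 1).sqrt (by simpa using (hpos s).ne')
    convert! h using 1
    simp only [id, Nat.cast_ofNat, Pi.pow_apply]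
    have := (hsp s).ne'
    field_simp
    ring
  have hψd : ∀ s : ℝ, HasDerivAt (fun s => s / √(1 + s ^ 2)) ((√(1 + s ^ 2) ^ 3)⁻¹) s := fun s => by
    have h := (hasDerivAt_id s).div (hΨ s) (hsp s).ne'
    convert! h using 1
    simp only [id]
    have := (hsp s).ne'
    field_simp
    linarith [hsq s]
  have hψc : ContDiff ℝ 1 fun s : ℝ => s / √(1 + s ^ 2) := by
    refine contDiff_id.div (ContDiff.sqrt (by fun_prop) fun s => (hpos s).ne') fun s => (hsp s).ne'
  have hfin := isFiniteMeasure_restrict_halfBall (d := d) 1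
  have hL1 : IntegrableOn (fun x => |u x|) (halfBall d 1) :=
    (hu.memLp.integrable (by norm_num)).abs
  -- √(1 + s²) is a smooth convex substitute for |s| whose first two derivatives are bounded by 1,
  -- so it can be tested with while u itself may still be unbounded.
  have htest : IsConvexTest u (fun s => √(1 + s ^ 2)) (fun s => s / √(1 + s ^ 2)) 1 1 :=
    { contDiff := hψc
      hasDerivAt := hΨ
      bound := fun x _ => by
        have h3 : 0 < (√(1 + u x ^ 2) ^ 3)⁻¹ := by have := hsp (u x); positivity
        constructor
        · rw [abs_div, abs_of_pos (hsp _), div_le_one (hsp _)]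
          exact habs _
        · rw [(hψd (u x)).deriv, abs_of_pos h3]
          exact inv_le_one_of_one_le₀ (one_le_pow₀ (h1le _))
      deriv_nonneg := fun s => by
        rw [(hψd s).deriv]; have := hsp s; positivity
      mul_nonneg := fun s => by
        rw [mul_div_assoc', ← pow_two]; positivity
      nonneg := fun s => (hsp s).le
      integrable := by
        refine ((integrable_const (1 : ℝ)).add hL1).mono' ?_ (Eventually.of_forall fun x => ?_)
        · have hc : Continuous fun s : ℝ => √(1 + s ^ 2) := by fun_prop
          exact hc.comp_aestronglyMeasurable hu.memLp.1
        · rw [Real.norm_of_nonneg (hsp _).le, Pi.add_apply]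
          refine Real.sqrt_le_iff.2 ⟨by positivity, ?_⟩
          nlinarith [abs_nonneg (u x), sq_abs (u x)] }
  set ω₀ := volume.real (Metric.ball (0 : Space d) 1) with hω₀
  have hω : 0 < ω₀ := ENNReal.toReal_pos (Metric.measure_ball_pos _ _ one_pos).ne'
    measure_ball_lt_top.ne
  have hδ : 0 < 1 - ρ := by linarith
  refine ⟨8 ^ (d + 1) * (∫ z in halfBall d 1, √(1 + u z ^ 2)) / (ω₀ * (1 - ρ) ^ (d + 1)),
    div_nonneg (mul_nonneg (by positivity) (integral_nonneg fun z => (hsp _).le)) (by positivity),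
    fun x hx => (habs _).trans ?_⟩
  rw [le_div_iff₀ (by positivity), ← mul_assoc]
  exact hu.local_bound hp hkp hkm le_rfl zero_le_one htest hρ hx

end IsSolution
end MeanValue

/-! ### The height function and its derivative -/

section Height

variable {d : ℕ} {p kp km : ℝ} {u : Space d → ℝ}

theorem nontrivial_tangential (hd : 1 ≤ d) : Nontrivial (Tangential d) := by
  have : Nonempty (Fin d) := ⟨⟨0, hd⟩⟩
  infer_instance

/-- `|∇u|²` on the half ball, extended by zero. -/
def bulkDensity (u : Space d → ℝ) : Space d → ℝ :=
  (halfBall d 1).indicator fun x => ‖gradient u x‖ ^ 2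

/-- `F(u)` on the flat part of the boundary, extended by zero. -/
def flatDensity (p kp km : ℝ) (u : Space d → ℝ) : Tangential d → ℝ :=
  (Metric.ball 0 1).indicator fun x' => potential p kp km (u (pt x' 0))

/-- `∫ u(s ω)²` over the upper half of the unit sphere. -/
def heightMean (u : Space d → ℝ) (s : ℝ) : ℝ :=
  ∫ ω in {ω : Metric.sphere (0 : Space d) 1 | 0 < (ω : Space d) (Fin.last d)},
    u (s • (ω : Space d)) ^ 2 ∂((volume : Measure (Space d)).toSphere)

theorem height_eq (u : Space d → ℝ) (s : ℝ) : height u s = s ^ d * heightMean u s := rfl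

theorem heightMean_nonneg (u : Space d → ℝ) (s : ℝ) : 0 ≤ heightMean u s :=
  integral_nonneg fun _ => sq_nonneg _

theorem measurableSet_upperSphere :
    MeasurableSet {ω : Metric.sphere (0 : Space d) 1 | 0 < (ω : Space d) (Fin.last d)} :=
  (isOpen_lt continuous_const (continuous_last.comp continuous_subtype_val)).measurableSet

theorem setIntegral_upperSphere (v : Space d → ℝ) {ρ s : ℝ} (hs : 0 < s) (hsρ : s < ρ) :
    ∫ ω in {ω : Metric.sphere (0 : Space d) 1 | 0 < (ω : Space d) (Fin.last d)},
      v (s • (ω : Space d)) ∂((volume : Measure (Space d)).toSphere) =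
    ∫ ω : Metric.sphere (0 : Space d) 1, (halfBall d ρ).indicator v (s • (ω : Space d))
      ∂((volume : Measure (Space d)).toSphere) := by
  rw [← integral_indicator measurableSet_upperSphere]
  refine integral_congr_ae (Eventually.of_forall fun ω => ?_)
  simp only [indicator, mem_ofPred_eq, mem_halfBall, norm_smul_sphere ω hs.le, hsρ, true_and]
  have : (s • (ω : Space d)) (Fin.last d) = s * (ω : Space d) (Fin.last d) := by simp
  rw [this]
  simp only [hs, mul_pos_iff_of_pos_left]

theorem heightMean_eq (u : Space d → ℝ) {ρ s : ℝ} (hs : 0 < s) (hsρ : s < ρ) :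
    heightMean u s = ∫ ω : Metric.sphere (0 : Space d) 1,
      valueDensity (fun x => u x ^ 2) ρ 0 (s • (ω : Space d))
      ∂((volume : Measure (Space d)).toSphere) := by
  simp only [valueDensity, zero_add]
  exact setIntegral_upperSphere (fun x => u x ^ 2) hs hsρ

theorem flux_mul_self (hp : 2 ≤ p) (s : ℝ) : flux p kp km s * s = potential p kp km s := by
  have h1 : p - 1 ≠ 0 := by linarith
  have h2 : p ≠ 0 := by linarith
  unfold flux potential
  rcases lt_trichotomy s 0 with hs | hs | hs
  · rw [max_eq_right hs.le, Real.zero_rpow h1, Real.zero_rpow h2,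
      max_eq_left (by linarith : (0 : ℝ) ≤ -s)]
    have : (-s) ^ p = (-s) ^ (p - 1) * (-s) := by
      rw [← Real.rpow_add_one (by linarith : -s ≠ 0)]; ring_nf
    rw [this]; ring
  · subst hs
    simp [Real.zero_rpow h2]
  · rw [max_eq_right (by linarith : -s ≤ 0), Real.zero_rpow h1, Real.zero_rpow h2,
      max_eq_left hs.le]
    have : s ^ p = s ^ (p - 1) * s := by
      rw [← Real.rpow_add_one hs.ne']; ring_nf
    rw [this]; ring

theorem dirichlet_eq_setIntegral (u : Space d → ℝ) {r : ℝ} (hr : r ≤ 1) :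
    dirichlet u r = ∫ x in Metric.ball 0 r, bulkDensity u x := by
  unfold dirichlet bulkDensity
  rw [setIntegral_indicator (measurableSet_halfBall 1)]
  congr 2
  ext x
  simp only [mem_halfBall, mem_inter_iff, mem_ball_zero_iff]
  constructor
  · exact fun h => ⟨h.1, h.1.trans_le hr, h.2⟩
  · exact fun h => ⟨h.1, h.2.2⟩

theorem penalty_eq_setIntegral (p kp km : ℝ) (u : Space d → ℝ) {r : ℝ} (hr : r ≤ 1) :
    penalty p kp km u r = ∫ x in Metric.ball 0 r, flatDensity p kp km u x := by
  unfold penalty flatIntegral flatDensity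
  rw [setIntegral_indicator measurableSet_ball,
    inter_eq_left.2 (Metric.ball_subset_ball hr)]

theorem dirichlet_nonneg (u : Space d → ℝ) (r : ℝ) : 0 ≤ dirichlet u r :=
  integral_nonneg fun _ => sq_nonneg _

theorem penalty_nonneg (hkp : 0 ≤ kp) (hkm : 0 ≤ km) (u : Space d → ℝ) (r : ℝ) :
    0 ≤ penalty p kp km u r :=
  integral_nonneg fun _ => potential_nonneg hkp hkm _

namespace IsSolution

variable (hu : IsSolution p kp km u)
include hu

theorem integrable_bulkDensity : Integrable (bulkDensity u) :=
  (integrable_indicator_iff (measurableSet_halfBall 1)).2 hu.integrable_norm_gradient_sq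

theorem integrable_flatDensity (hp : 2 ≤ p) (hkp : 0 ≤ kp) (hkm : 0 ≤ km) :
    Integrable (flatDensity p kp km u) :=
  (integrable_indicator_iff measurableSet_ball).2 (hu.integrable_potential hp hkp hkm)

theorem dirichlet_eq {r : ℝ} (hr0 : 0 ≤ r) (hr : r ≤ 1) :
    dirichlet u r = ∫ s in (0 : ℝ)..r, sphereInt (bulkDensity u) s := by
  rw [dirichlet_eq_setIntegral u hr, setIntegral_ball_eq hu.integrable_bulkDensity hr0]

theorem penalty_eq (hd : 1 ≤ d) (hp : 2 ≤ p) (hkp : 0 ≤ kp) (hkm : 0 ≤ km) {r : ℝ}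
    (hr0 : 0 ≤ r) (hr : r ≤ 1) :
    penalty p kp km u r = ∫ s in (0 : ℝ)..r, sphereInt (flatDensity p kp km u) s := by
  have := nontrivial_tangential hd
  rw [penalty_eq_setIntegral p kp km u hr,
    setIntegral_ball_eq (hu.integrable_flatDensity hp hkp hkm) hr0]

omit hu in
theorem continuousOn_primitive_sphereInt {E : Type*} [NormedAddCommGroup E]
    [InnerProductSpace ℝ E] [FiniteDimensional ℝ E] [MeasurableSpace E] [BorelSpace E]
    [Nontrivial E] {f : E → ℝ} (hf : Integrable f) :
    ContinuousOn (fun r => ∫ s in (0 : ℝ)..r, sphereInt f s) (Icc 0 1) := by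
  rw [← uIcc_of_le zero_le_one]
  refine intervalIntegral.continuousOn_primitive_interval ?_
  rw [uIcc_of_le zero_le_one]
  exact ((integrableOn_sphereInt hf).mono_set Ioc_subset_Ioi_self).congr_set_ae
    Ioc_ae_eq_Icc.symm

theorem continuousOn_dirichlet : ContinuousOn (dirichlet u) (Icc 0 1) :=
  (continuousOn_primitive_sphereInt hu.integrable_bulkDensity).congr
    fun _ hr => hu.dirichlet_eq hr.1 hr.2

theorem continuousOn_penalty (hd : 1 ≤ d) (hp : 2 ≤ p) (hkp : 0 ≤ kp) (hkm : 0 ≤ km) :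
    ContinuousOn (penalty p kp km u) (Icc 0 1) := by
  have := nontrivial_tangential hd
  exact (continuousOn_primitive_sphereInt (hu.integrable_flatDensity hp hkp hkm)).congr
    fun _ hr => hu.penalty_eq hd hp hkp hkm hr.1 hr.2

/-- The constant 2K + 2 dominates both |2u| ≤ 2K and the second derivative 2. Testing with squares
is possible only now that u is locally bounded. -/
theorem isConvexTest_sq {ρ K : ℝ} (hρ : ρ ≤ 1) (hb : ∀ x ∈ halfBall d ρ, |u x| ≤ K) :
    IsConvexTest u (fun s => s ^ 2) (fun s => 2 * s) ρ (2 * K + 2) where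
  contDiff := by fun_prop
  hasDerivAt s := by simpa using hasDerivAt_pow 2 s
  bound x hx := by
    have h := hb x hx
    have h2 : deriv (fun s : ℝ => 2 * s) (u x) = 2 := by
      simp
    rw [h2, abs_mul, abs_two]
    exact ⟨by linarith, by linarith [abs_nonneg (u x)]⟩
  deriv_nonneg s := by
    have h2 : deriv (fun s : ℝ => 2 * s) s = 2 := by
      simp
    rw [h2]; norm_num
  mul_nonneg s := by nlinarith [sq_nonneg s]
  nonneg s := sq_nonneg s
  integrable := (hu.memLp.integrable_sq).mono_measure
    (Measure.restrict_mono (halfBall_mono hρ) le_rfl)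

/-- Green's formula with u itself: ∫ 2 u u_r over the half sphere. The flat term is `penalty`
because the flux times u is the potential. -/
theorem ae_sphereInt_radial (hp : 2 ≤ p) (hkp : 0 ≤ kp) (hkm : 0 ≤ km) {ρ : ℝ} (hρ : ρ < 1) :
    ∀ᵐ s ∂(volume.restrict (Ioo 0 ρ)), sphereInt (radialDensity u (fun s => 2 * s) ρ 0) s =
      2 * (dirichlet u s + penalty p kp km u s) := by
  obtain ⟨K, hK, hb⟩ := hu.exists_bound hp hkp hkm hρ
  have h := hu.isConvexTest_sq hρ.le hb
  have key := hu.sphereInt_radialDensity_flat hp hkp hkm h.contDiff hρ.le (by positivity) h.bound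
    (y' := 0) (R := ρ) (by simp)
    (hu.integrableOn_flux_mul hp hkp hkm h.contDiff.continuous hρ.le fun x hx => (h.bound x hx).1)
  have hpt : pt (0 : Tangential d) 0 = 0 := by
    refine space_ext (fun i => ?_) ?_ <;> simp
  rw [hpt] at key
  filter_upwards [key, ae_restrict_mem measurableSet_Ioo] with s hs hmem
  rw [hs, mul_add, dirichlet_eq_setIntegral u (hmem.2.trans hρ).le,
    penalty_eq_setIntegral p kp km u (hmem.2.trans hρ).le, ← integral_const_mul,
    ← integral_const_mul]
  congr 1
  · refine setIntegral_congr_fun measurableSet_ball fun z hz => ?_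
    rw [mem_ball_zero_iff] at hz
    have h2 : deriv (fun s : ℝ => 2 * s) = fun _ => 2 := by
      funext t
      simp
    simp only [energyDensity, bulkDensity, zero_add, h2]
    have : z ∈ halfBall d ρ ↔ z ∈ halfBall d 1 := by
      simp [mem_halfBall, hz.trans hmem.2, (hz.trans hmem.2).trans hρ]
    by_cases hz1 : z ∈ halfBall d 1
    · rw [indicator_of_mem hz1, indicator_of_mem (this.2 hz1)]
    · rw [indicator_of_notMem hz1, indicator_of_notMem (fun h => hz1 (this.1 h)), mul_zero]
  · refine setIntegral_congr_fun measurableSet_ball fun z hz => ?_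
    rw [mem_ball_zero_iff] at hz
    have hz1 : z ∈ Metric.ball (0 : Tangential d) ρ := mem_ball_zero_iff.2 (hz.trans hmem.2)
    have hz2 : z ∈ Metric.ball (0 : Tangential d) 1 := Metric.ball_subset_ball hρ.le hz1
    simp only [flatDensity, zero_add, indicator_of_mem hz1, indicator_of_mem hz2]
    rw [← flux_mul_self hp]
    ring

/-- The derivative of the mean of `u²` in integrated form. -/
theorem heightMean_sub (hp : 2 ≤ p) (hkp : 0 ≤ kp) (hkm : 0 ≤ km) {a b : ℝ} (ha : 0 < a)
    (hab : a ≤ b) (hb1 : b < 1) :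
    heightMean u b - heightMean u a =
      ∫ s in a..b, 2 * (dirichlet u s + penalty p kp km u s) / s ^ d := by
  obtain ⟨ρ, hbρ, hρ⟩ := exists_between hb1
  obtain ⟨K, hK, hb⟩ := hu.exists_bound hp hkp hkm hρ
  have h := hu.isConvexTest_sq hρ.le hb
  have hy0 : ‖(0 : Space d)‖ + ρ ≤ ρ := by simp
  have hv := h.integrable_valueDensity 0
  have hg := hu.integrable_radialDensity h.contDiff.continuous hρ.le
    (fun x hx => (h.bound x hx).1) 0
  have hd := fun ω s hs => hu.hasDerivAt_ray h.hasDerivAt hρ.le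
    (rayRegular_of_flat (y := 0) (by simp) hy0) ω (s := s) hs
  have h1 := ray_integrable_sphere hv hg hd (s := a) ⟨ha, hab.trans_lt hbρ⟩
  have h2 := ray_integrable_sphere hv hg hd (s := b) ⟨ha.trans_le hab, hbρ⟩
  obtain ⟨-, -, e⟩ := ray_identity hg hd ha hab hbρ
  rw [integral_sub h2 h1] at e
  rw [heightMean_eq u ha (hab.trans_lt hbρ), heightMean_eq u (ha.trans_le hab) hbρ, e,
    intervalIntegral.integral_of_le hab, intervalIntegral.integral_of_le hab]
  refine integral_congr_ae ?_
  have hsub : Ioc a b ⊆ Ioo 0 ρ := fun s hs => ⟨ha.trans hs.1, hs.2.trans_lt hbρ⟩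
  filter_upwards [ae_restrict_of_ae_restrict_of_subset hsub
    (hu.ae_sphereInt_radial hp hkp hkm hρ), ae_restrict_mem measurableSet_Ioc] with s hs hmem
  have hs0 : s ^ d ≠ 0 := pow_ne_zero _ (ha.trans hmem.1).ne'
  have hfr : Module.finrank ℝ (Space d) - 1 = d := by simp
  rw [← hs, sphereInt, hfr, mul_div_cancel_left₀ _ hs0]

theorem heightMean_mono (hp : 2 ≤ p) (hkp : 0 ≤ kp) (hkm : 0 ≤ km) {a b : ℝ} (ha : 0 < a)
    (hab : a ≤ b) (hb1 : b < 1) : heightMean u a ≤ heightMean u b := by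
  have h := hu.heightMean_sub hp hkp hkm ha hab hb1
  have : 0 ≤ ∫ s in a..b, 2 * (dirichlet u s + penalty p kp km u s) / s ^ d :=
    intervalIntegral.integral_nonneg hab fun s hs =>
      div_nonneg (mul_nonneg zero_le_two (add_nonneg (dirichlet_nonneg _ _)
        (penalty_nonneg hkp hkm _ _))) (pow_nonneg (ha.le.trans hs.1) _)
  linarith

theorem continuousOn_heightMean_deriv (hd : 1 ≤ d) (hp : 2 ≤ p) (hkp : 0 ≤ kp) (hkm : 0 ≤ km) :
    ContinuousOn (fun s => 2 * (dirichlet u s + penalty p kp km u s) / s ^ d) (Ioo 0 1) :=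
  (((hu.continuousOn_dirichlet.add (hu.continuousOn_penalty hd hp hkp hkm)).mono
    Ioo_subset_Icc_self).const_smul (2 : ℝ)).div (by fun_prop)
    fun s hs => pow_ne_zero _ hs.1.ne'

/-- The integrand in `heightMean_sub` is continuous, since D and P are primitives in r of integrable
functions. The derivative thus exists at every radius and not only at almost every one. -/
theorem hasDerivAt_heightMean (hd : 1 ≤ d) (hp : 2 ≤ p) (hkp : 0 ≤ kp) (hkm : 0 ≤ km) {r : ℝ}
    (hr : r ∈ Ioo 0 1) :
    HasDerivAt (heightMean u) (2 * (dirichlet u r + penalty p kp km u r) / r ^ d) r := by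
  have hc := hu.continuousOn_heightMean_deriv hd hp hkp hkm
  set g := fun s => 2 * (dirichlet u s + penalty p kp km u s) / s ^ d with hg
  set a := r / 2 with ha
  have ha0 : 0 < a := by have := hr.1; positivity
  have har : a < r := by have := hr.1; linarith
  have h1 : HasDerivAt (fun b => heightMean u a + ∫ s in a..b, g s) (g r) r := by
    refine (intervalIntegral.integral_hasDerivAt_right ?_ ?_ ?_).const_add _
    · refine (hc.mono ?_).intervalIntegrable
      rw [uIcc_of_le har.le]
      exact fun s hs => ⟨ha0.trans_le hs.1, hs.2.trans_lt hr.2⟩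
    · exact hc.stronglyMeasurableAtFilter isOpen_Ioo r hr
    · exact hc.continuousAt (isOpen_Ioo.mem_nhds hr)
  refine h1.congr_of_eventuallyEq ?_
  filter_upwards [isOpen_Ioo.mem_nhds (show r ∈ Ioo a 1 from ⟨har, hr.2⟩)] with b hb
  have := hu.heightMean_sub hp hkp hkm ha0 hb.1.le hb.2
  simp only [hg]
  linarith

/-- Means over smaller half spheres are dominated by the mean at radius r; integrating s^d up to r
produces r^(d+1)/(d+1). -/
theorem integral_sq_le (hp : 2 ≤ p) (hkp : 0 ≤ kp) (hkm : 0 ≤ km) {r : ℝ} (hr0 : 0 < r)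
    (hr : r < 1) :
    ∫ x in halfBall d r, u x ^ 2 ≤ r / (d + 1) * height u r := by
  have hi : IntegrableOn (fun x => u x ^ 2) (halfBall d 1) := hu.memLp.integrable_sq
  set f : Space d → ℝ := (halfBall d 1).indicator fun x => u x ^ 2 with hf
  have hfi : Integrable f := (integrable_indicator_iff (measurableSet_halfBall 1)).2 hi
  have e1 : ∫ x in halfBall d r, u x ^ 2 = ∫ x in Metric.ball 0 r, f x := by
    rw [hf, setIntegral_indicator (measurableSet_halfBall 1)]
    congr 2
    ext x
    simp only [mem_halfBall, mem_inter_iff, mem_ball_zero_iff]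
    exact ⟨fun h => ⟨h.1, h.1.trans hr, h.2⟩, fun h => ⟨h.1, h.2.2⟩⟩
  rw [e1, setIntegral_ball_eq hfi hr0.le]
  have hfr : Module.finrank ℝ (Space d) - 1 = d := by simp
  have h1 : ∫ s in (0 : ℝ)..r, sphereInt f s ≤ ∫ s in (0 : ℝ)..r, s ^ d * heightMean u r := by
    refine intervalIntegral.integral_mono_on_of_le_Ioo hr0.le
      ((intervalIntegrable_iff_integrableOn_Ioc_of_le hr0.le).2
      ((integrableOn_sphereInt hfi).mono_set Ioc_subset_Ioi_self))
      (Continuous.intervalIntegrable (by fun_prop) _ _) fun s hs => ?_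
    rw [sphereInt, hfr, hf,
      ← setIntegral_upperSphere (fun x => u x ^ 2) hs.1 (hs.2.trans hr)]
    exact mul_le_mul_of_nonneg_left (hu.heightMean_mono hp hkp hkm hs.1 hs.2.le hr)
      (pow_nonneg hs.1.le _)
  refine h1.trans (le_of_eq ?_)
  rw [intervalIntegral.integral_mul_const, integral_pow, height_eq]
  simp
  ring

end IsSolution

end Height

/-! ### The trace inequality and the bound on the penalty -/

section Trace

/-- A set of full measure in (a, b) accumulates at a from the right. This upgrades an estimate at
almost every radius to every radius. -/
theorem frequently_of_ae_restrict {P : ℝ → Prop} {a b : ℝ} (hab : a < b)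
    (h : ∀ᵐ s ∂(volume.restrict (Ioo a b)), P s) : ∃ᶠ s in 𝓝[>] a, P s := by
  intro hcon
  have h0 : ∀ᶠ s in 𝓝[>] a, ¬P s := hcon
  obtain ⟨c, hc, hcs⟩ := mem_nhdsGT_iff_exists_Ioo_subset.1 h0
  have hc' : a < min b c := lt_min hab hc
  have h1 : ∀ᵐ s ∂(volume.restrict (Ioo a (min b c))), False := by
    filter_upwards [ae_restrict_of_ae_restrict_of_subset
      (Ioo_subset_Ioo_right (min_le_left b c)) h, ae_restrict_mem measurableSet_Ioo] with s hs hmem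
    exact hcs ⟨hmem.1, hmem.2.trans_le (min_le_right _ _)⟩ hs
  have h2 : volume.restrict (Ioo a (min b c)) = 0 := by
    rwa [eventually_false_iff_eq_bot, ae_eq_bot] at h1
  rw [Measure.restrict_eq_zero, Real.volume_Ioo] at h2
  exact absurd h2 (by simpa using hc')

variable {d : ℕ} {p kp km : ℝ} {u : Space d → ℝ}

/-- The density `2 u ∂u/∂x_n` on the half ball of radius `ρ`. -/
def vertDensity (u : Space d → ℝ) (ρ : ℝ) : Space d → ℝ :=
  (halfBall d ρ).indicator fun x => 2 * u x * inner ℝ (gradient u x) (vert d)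

/-- The density `u² x_n / |x|` on the half ball of radius `ρ`. -/
def slopeDensity (u : Space d → ℝ) (ρ : ℝ) : Space d → ℝ :=
  (halfBall d ρ).indicator fun x => u x ^ 2 * (inner ℝ x (vert d) / ‖x‖)

theorem potential_le_sq (hp : 2 ≤ p) (hkp : 0 ≤ kp) {s K : ℝ} (hs : |s| ≤ K) :
    potential p kp km s ≤ max kp km * K ^ (p - 2) * s ^ 2 := by
  have h2 : p ≠ 0 := by linarith
  have key : ∀ t : ℝ, 0 ≤ t → t ≤ K → t ^ p ≤ K ^ (p - 2) * t ^ 2 := by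
    intro t ht htK
    rcases ht.eq_or_lt with rfl | ht
    · simp [Real.zero_rpow h2]
    · have : t ^ p = t ^ (p - 2) * t ^ 2 := by
        rw [← Real.rpow_natCast, ← Real.rpow_add ht]; norm_num
      rw [this]
      gcongr
  have hK : 0 ≤ K := (abs_nonneg s).trans hs
  have hKp : 0 ≤ K ^ (p - 2) := Real.rpow_nonneg hK _
  have h3 := key _ (abs_nonneg s) hs
  rw [sq_abs] at h3
  have h4 : 0 ≤ |s| ^ p := Real.rpow_nonneg (abs_nonneg s) _
  unfold potential
  rcases le_total 0 s with h | h
  · rw [max_eq_right (by linarith : -s ≤ 0), Real.zero_rpow h2, max_eq_left h, mul_zero, zero_add, mul_assoc]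
    rw [abs_of_nonneg h] at h3 h4
    exact mul_le_mul (le_max_left _ _) h3 h4 (le_max_of_le_left hkp)
  · rw [max_eq_right h, Real.zero_rpow h2, max_eq_left (by linarith : (0 : ℝ) ≤ -s),
      ← abs_of_nonpos h, mul_zero, add_zero, mul_assoc]
    exact mul_le_mul (le_max_right _ _) h3 h4 (le_max_of_le_left hkp)

namespace IsSolution

variable (hu : IsSolution p kp km u)
include hu

theorem integrable_vertDensity {ρ K : ℝ} (hρ : ρ ≤ 1) (hb : ∀ x ∈ halfBall d ρ, |u x| ≤ K) :
    Integrable (vertDensity u ρ) := by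
  refine (integrable_indicator_iff (measurableSet_halfBall ρ)).2 ?_
  have h0 := hu.integrable_norm_gradient.mono_set (halfBall_mono hρ)
  have hc := hu.contDiffOn.continuousOn.mono (halfBall_mono hρ)
  have hg := hu.continuousOn_gradient.mono (halfBall_mono hρ)
  refine (h0.const_mul (2 * K)).mono' (ContinuousOn.aestronglyMeasurable ?_
    (measurableSet_halfBall ρ)) ?_
  · exact (continuousOn_const.mul hc).mul (hg.inner continuousOn_const)
  · filter_upwards [ae_restrict_mem (measurableSet_halfBall ρ)] with x hx
    have h1 := norm_inner_le_norm (𝕜 := ℝ) (gradient u x) (vert d)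
    rw [norm_vert, mul_one] at h1
    rw [norm_mul, norm_mul, Real.norm_two]
    exact mul_le_mul (mul_le_mul_of_nonneg_left (hb x hx) zero_le_two) h1 (norm_nonneg _)
      (mul_nonneg zero_le_two ((abs_nonneg _).trans (hb x hx)))

theorem integrable_slopeDensity {ρ : ℝ} (hρ : ρ ≤ 1) : Integrable (slopeDensity u ρ) := by
  refine (integrable_indicator_iff (measurableSet_halfBall ρ)).2 ?_
  have h0 : IntegrableOn (fun x => u x ^ 2) (halfBall d ρ) :=
    IntegrableOn.mono_set (t := halfBall d 1) hu.memLp.integrable_sq (halfBall_mono hρ)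
  refine h0.mono' ?_ (Eventually.of_forall fun x => ?_)
  · refine h0.1.mul (Measurable.aestronglyMeasurable (by fun_prop))
  · have h1 := norm_inner_le_norm (𝕜 := ℝ) x (vert d)
    rw [norm_vert, mul_one] at h1
    rw [norm_mul, norm_div, norm_norm, Real.norm_of_nonneg (sq_nonneg _)]
    exact mul_le_of_le_one_right (sq_nonneg _) (div_le_one_of_le₀ h1 (norm_nonneg _))

theorem integrable_sq_trace (hp : 2 ≤ p) :
    IntegrableOn (fun x' : Tangential d => u (pt x' 0) ^ 2) (Metric.ball 0 1) := by
  have : IsFiniteMeasure (volume.restrict (Metric.ball (0 : Tangential d) 1)) :=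
    isFiniteMeasure_restrict.2 measure_ball_lt_top.ne
  refine (hu.memLp_trace.mono_exponent ?_).integrable_sq
  rw [← ENNReal.ofReal_ofNat]
  exact ENNReal.ofReal_le_ofReal hp

theorem hasDerivAt_vertical {ρ : ℝ} (hρ : ρ ≤ 1) {χ : ℝ → ℝ} (hχ : IsCutoff χ ρ)
    (x' : Tangential d) {t : ℝ} (ht : 0 < t) :
    HasDerivAt (fun t => u (pt x' t) ^ 2 * tailInt χ ‖pt x' t‖)
      (vertDensity u ρ (pt x' t) * tailInt χ ‖pt x' t‖ -
        χ ‖pt x' t‖ * slopeDensity u ρ (pt x' t)) t := by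
  obtain ⟨R₀, hR₀, hz⟩ := hχ.exists_zero_of_ge
  have hc : Continuous fun t => pt x' t := by fun_prop
  by_cases hx : pt x' t ∈ halfBall d ρ
  · have hl : HasDerivAt (fun t => pt x' t) (vert d) t := by
      have h1 : (fun t => pt x' t) = fun t => pt x' 0 + t • vert d := by
        funext s; rw [pt_add_vert, zero_add]
      rw [h1]
      simpa using ((hasDerivAt_id t).smul_const (vert d)).const_add (pt x' 0)
    have h1 := (hu.hasFDerivAt (halfBall_mono hρ hx)).comp_hasDerivAt t hl
    have h2 := hasFDerivAt_tailInt_norm hχ (0 : Space d) (pt x' t)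
    simp only [sub_zero] at h2
    have h3 := (h1.pow 2).mul (h2.comp_hasDerivAt t hl)
    refine h3.congr_deriv ?_
    simp only [vertDensity, slopeDensity, indicator_of_mem hx, Function.comp_apply,
      _root_.smul_apply, innerSL_apply_apply, smul_eq_mul, inner_gradient_left, Pi.pow_apply]
    push_cast
    ring
  · have hn : R₀ < ‖pt x' t‖ := by
      by_contra h
      exact hx (mem_halfBall.2 ⟨by linarith, by simpa using ht⟩)
    simp only [vertDensity, slopeDensity, indicator_of_notMem hx, zero_mul, mul_zero, sub_zero]
    refine (hasDerivAt_const t (0 : ℝ)).congr_of_eventuallyEq ?_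
    filter_upwards [(isOpen_lt continuous_const hc.norm).mem_nhds hn] with s hs
    rw [(hz _ (le_of_lt hs)).2, mul_zero]

/-- The divergence theorem for the field u² η e_n: integrate the vertical derivative of u² η along
almost every vertical line. The derivative of η contributes -χ times the slope x_n/|x|. -/
theorem vertical_identity {ρ K : ℝ} (hρ : ρ ≤ 1) (hb : ∀ x ∈ halfBall d ρ, |u x| ≤ K)
    {χ : ℝ → ℝ} (hχ : IsCutoff χ ρ) :
    ∫ s in Ioo 0 ρ, χ s * sphereInt (slopeDensity u ρ) s =
      (∫ x' : Tangential d, (Metric.ball 0 1).indicator (fun x' => u (pt x' 0) ^ 2) x' *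
        tailInt χ ‖x'‖) + ∫ x, vertDensity u ρ x * tailInt χ ‖x‖ := by
  obtain ⟨R₀, hR₀, hz⟩ := hχ.exists_zero_of_ge
  obtain ⟨C, hC⟩ := hχ.compact.exists_bound_of_continuous hχ.continuous
  have i1 : Integrable fun x => vertDensity u ρ x * tailInt χ ‖x‖ :=
    (hu.integrable_vertDensity hρ hb).mul_bdd (c := ∫ τ, χ τ)
      (hχ.continuous_tailInt.comp continuous_norm).aestronglyMeasurable
      (Eventually.of_forall fun x => by
        rw [Real.norm_of_nonneg (hχ.tailInt_nonneg _)]; exact hχ.tailInt_le _)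
  have i2 : Integrable fun x => χ ‖x‖ * slopeDensity u ρ x :=
    (hu.integrable_slopeDensity hρ).bdd_mul (c := C)
      (hχ.continuous.comp continuous_norm).aestronglyMeasurable (Eventually.of_forall fun z => hC _)
  have i3 := i1.sub i2
  have mp := measurePreserving_pt (d := d)
  set G : Space d → ℝ := fun x => vertDensity u ρ x * tailInt χ ‖x‖ - χ ‖x‖ * slopeDensity u ρ x
    with hG
  have i4 : Integrable (fun q : Tangential d × ℝ => G (pt q.1 q.2)) (volume.prod volume) :=
    mp.integrable_comp_of_integrable i3
  have e0 : ∫ x, G x = ∫ x' : Tangential d, ∫ t : ℝ, G (pt x' t) := by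
    have h2 := integral_map (f := G) mp.aemeasurable (mp.map_eq.symm ▸ i3.1)
    rw [mp.map_eq] at h2
    rw [h2]
    exact integral_prod _ i4
  have hsupp : ∀ x' : Tangential d, ∀ t : ℝ, t ∉ Ioo (0 : ℝ) 1 → G (pt x' t) = 0 := by
    intro x' t ht
    have : pt x' t ∉ halfBall d ρ := by
      intro h
      rw [mem_halfBall, pt_last] at h
      refine ht ⟨h.2, ?_⟩
      have := norm_pt_sq x' t
      nlinarith [sq_nonneg ‖x'‖, h.1, norm_nonneg (pt x' t)]
    simp [hG, vertDensity, slopeDensity, indicator_of_notMem this]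
  have e1 : ∀ᵐ x' : Tangential d, ∫ t : ℝ, G (pt x' t) =
      -((Metric.ball 0 1).indicator (fun x' => u (pt x' 0) ^ 2) x' * tailInt χ ‖x'‖) := by
    filter_upwards [i4.prod_right_ae, (ae_restrict_iff' measurableSet_ball).1 hu.trace]
      with x' hi htr
    by_cases hx' : x' ∈ Metric.ball (0 : Tangential d) 1
    · rw [indicator_of_mem hx']
      rw [← setIntegral_eq_integral_of_forall_compl_eq_zero (hsupp x'),
        ← integral_Ioc_eq_integral_Ioo, ← intervalIntegral.integral_of_le zero_le_one]
      have hc : Continuous fun t => tailInt χ ‖pt x' t‖ :=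
        hχ.continuous_tailInt.comp (by fun_prop)
      -- Only one-sided limits at the ends are available: at height 0 the trace, at height 1 the
      -- vanishing cutoff.
      rw [intervalIntegral.integral_eq_sub_of_hasDerivAt_of_tendsto zero_lt_one
        (f := fun t => u (pt x' t) ^ 2 * tailInt χ ‖pt x' t‖)
        (fa := u (pt x' 0) ^ 2 * tailInt χ ‖x'‖) (fb := 0)
        (fun t ht => hu.hasDerivAt_vertical hρ hχ x' ht.1) hi.intervalIntegrable]
      · simp
      · have h1 := ((htr hx').pow 2).mul ((hc.tendsto 0).mono_left nhdsWithin_le_nhds)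
        rwa [norm_pt_zero] at h1
      · refine tendsto_const_nhds.congr' ?_
        have h1 : max R₀ 0 < (1 : ℝ) := max_lt (by linarith) one_pos
        filter_upwards [Ioo_mem_nhdsLT h1] with t ht
        have h2 : R₀ ≤ ‖pt x' t‖ := by
          have h3 := norm_pt_sq x' t
          have h4 := ht.1
          have h5 := le_max_left R₀ 0
          have h6 := le_max_right R₀ 0
          have : t ≤ ‖pt x' t‖ := by
            refine le_of_sq_le_sq ?_ (norm_nonneg _)
            nlinarith [sq_nonneg ‖x'‖]
          linarith
        rw [(hz _ h2).2, mul_zero]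
    · rw [indicator_of_notMem hx', zero_mul, neg_zero]
      have : ∀ t, G (pt x' t) = 0 := fun t => by
        have : pt x' t ∉ halfBall d ρ := by
          intro h
          rw [mem_halfBall] at h
          refine hx' (mem_ball_zero_iff.2 ?_)
          have := norm_pt_sq x' t
          nlinarith [sq_nonneg t, h.1, norm_nonneg (pt x' t), norm_nonneg x']
        simp [hG, vertDensity, slopeDensity, indicator_of_notMem this]
      simp [this]
  rw [integral_congr_ae e1, integral_neg] at e0
  have e2 : ∫ x, G x = (∫ x, vertDensity u ρ x * tailInt χ ‖x‖) - ∫ x, χ ‖x‖ * slopeDensity u ρ x :=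
    integral_sub i1 i2
  rw [← hχ.setIntegral_eq, ← integral_mul_norm χ i2]
  linarith

/-- At almost every radius ∫_{Γ_s} u² equals ∫ u² x_n/|x| over the half sphere minus ∫ 2 u u_n over
the half ball. The former is at most H; Young's inequality and `integral_sq_le` bound the latter by
s D + H. -/
theorem ae_flat_sq_le (hp : 2 ≤ p) (hkp : 0 ≤ kp) (hkm : 0 ≤ km) {ρ : ℝ} (hρ : ρ < 1) :
    ∀ᵐ s ∂(volume.restrict (Ioo 0 ρ)), ∫ x' in Metric.ball (0 : Tangential d) s, u (pt x' 0) ^ 2 ≤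
      2 * (s * dirichlet u s + height u s) := by
  obtain ⟨K, hK, hb⟩ := hu.exists_bound hp hkp hkm hρ
  have i1 : Integrable ((Metric.ball (0 : Tangential d) 1).indicator fun x' => u (pt x' 0) ^ 2) :=
    (integrable_indicator_iff measurableSet_ball).2 (hu.integrable_sq_trace hp)
  have key := ae_eq_ballIntegral i1 (hu.integrable_vertDensity hρ.le hb)
    ((integrableOn_sphereInt (hu.integrable_slopeDensity hρ.le)).mono_set Ioo_subset_Ioi_self)
    fun χ hχ => hu.vertical_identity hρ.le hb hχ
  have h2 : IntegrableOn (fun x => u x ^ 2) (halfBall d 1) := hu.memLp.integrable_sq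
  have hsub : Ioo 0 ρ ⊆ Ioi 0 := Ioo_subset_Ioi_self
  have hsl := ae_restrict_of_ae_restrict_of_subset hsub
    (ae_integrable_sphere (hu.integrable_slopeDensity hρ.le))
  have hva := ae_restrict_of_ae_restrict_of_subset hsub
    (ae_integrable_sphere ((integrable_indicator_iff (measurableSet_halfBall ρ)).2
      (h2.mono_set (halfBall_mono hρ.le))))
  filter_upwards [key, hsl, hva, ae_restrict_mem measurableSet_Ioo] with s hs hs1 hs2 hmem
  have hsρ1 : s < 1 := hmem.2.trans hρ
  have e1 : ∫ x' in Metric.ball (0 : Tangential d) s,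
      (Metric.ball 0 1).indicator (fun x' => u (pt x' 0) ^ 2) x' =
      ∫ x' in Metric.ball (0 : Tangential d) s, u (pt x' 0) ^ 2 := by
    rw [setIntegral_indicator measurableSet_ball, inter_eq_left.2 (Metric.ball_subset_ball hsρ1.le)]
  have e2 : ∫ x in Metric.ball 0 s, vertDensity u ρ x =
      ∫ x in halfBall d s, 2 * u x * inner ℝ (gradient u x) (vert d) := by
    rw [vertDensity, setIntegral_indicator (measurableSet_halfBall ρ)]
    congr 2
    ext x
    simp only [mem_halfBall, mem_inter_iff, mem_ball_zero_iff]
    exact ⟨fun h => ⟨h.1, h.2.2⟩, fun h => ⟨h.1, h.1.trans hmem.2, h.2⟩⟩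
  have h3 : sphereInt (slopeDensity u ρ) s ≤ height u s := by
    have hfr : Module.finrank ℝ (Space d) - 1 = d := by simp
    rw [sphereInt, hfr, height_eq, heightMean, setIntegral_upperSphere (fun x => u x ^ 2) hmem.1 hmem.2]
    refine mul_le_mul_of_nonneg_left (integral_mono hs1 hs2 fun ω => ?_) (pow_nonneg hmem.1.le _)
    simp only [slopeDensity]
    refine indicator_le_indicator ?_
    refine mul_le_of_le_one_right (sq_nonneg _) ?_
    refine div_le_one_of_le₀ ?_ (norm_nonneg _)
    have h1 := real_inner_le_norm (s • (ω : Space d)) (vert d)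
    rwa [norm_vert, mul_one] at h1
  have j1 := h2.mono_set (halfBall_mono hsρ1.le)
  have j2 := hu.integrable_norm_gradient_sq.mono_set (halfBall_mono hsρ1.le)
  have h4 : -∫ x in halfBall d s, 2 * u x * inner ℝ (gradient u x) (vert d) ≤
      s⁻¹ * (∫ x in halfBall d s, u x ^ 2) + s * dirichlet u s := by
    rw [dirichlet, ← integral_const_mul, ← integral_const_mul,
      ← integral_add (j1.const_mul _) (j2.const_mul _), ← integral_neg]
    refine integral_mono_ae ?_ ((j1.const_mul _).add (j2.const_mul _)) ?_
    · have h0 := ((integrable_indicator_iff (measurableSet_halfBall ρ)).1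
        (hu.integrable_vertDensity hρ.le hb)).mono_set (halfBall_mono hmem.2.le)
      exact h0.neg
    · refine Eventually.of_forall fun x => ?_
      have h1 := abs_real_inner_le_norm (gradient u x) (vert d)
      rw [norm_vert, mul_one] at h1
      have hs0 : s ≠ 0 := hmem.1.ne'
      have hsq : (inner ℝ (gradient u x) (vert d)) ^ 2 ≤ ‖gradient u x‖ ^ 2 := by
        rw [← sq_abs]; gcongr
      -- Young's inequality weighted by s, so that both resulting terms scale like the height.
      have h2 : 0 ≤ s⁻¹ * (u x + s * inner ℝ (gradient u x) (vert d)) ^ 2 :=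
        mul_nonneg (inv_nonneg.2 hmem.1.le) (sq_nonneg _)
      have h3 : s⁻¹ * (u x + s * inner ℝ (gradient u x) (vert d)) ^ 2 = s⁻¹ * u x ^ 2 +
        2 * u x * inner ℝ (gradient u x) (vert d) + s * inner ℝ (gradient u x) (vert d) ^ 2 := by
        field_simp
        ring
      have h4 := mul_le_mul_of_nonneg_left hsq hmem.1.le
      beta_reduce
      linarith
  have h5 := hu.integral_sq_le hp hkp hkm hmem.1 hsρ1
  have h6 : s⁻¹ * (∫ x in halfBall d s, u x ^ 2) ≤ height u s := by
    have hh : 0 ≤ height u s := by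
      rw [height_eq]; exact mul_nonneg (pow_nonneg hmem.1.le _) (heightMean_nonneg u s)
    have : s⁻¹ * (∫ x in halfBall d s, u x ^ 2) ≤ s⁻¹ * (s / (d + 1) * height u s) :=
      mul_le_mul_of_nonneg_left h5 (inv_nonneg.2 hmem.1.le)
    refine this.trans ?_
    rw [← mul_assoc, ← mul_div_assoc, inv_mul_cancel₀ hmem.1.ne', one_div]
    exact mul_le_of_le_one_left hh (inv_le_one_of_one_le₀ (by linarith [(Nat.cast_nonneg d : (0:ℝ) ≤ d)]))
  have h7 : 0 ≤ s * dirichlet u s := mul_nonneg hmem.1.le (dirichlet_nonneg u s)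
  rw [e1, e2] at hs
  linarith

theorem continuousOn_height (hd : 1 ≤ d) (hp : 2 ≤ p) (hkp : 0 ≤ kp) (hkm : 0 ≤ km) :
    ContinuousOn (height u) (Ioo 0 1) := fun _ hs =>
  ((continuousAt_id.pow d).mul
    (hu.hasDerivAt_heightMean hd hp hkp hkm hs).continuousAt).continuousWithinAt

/-- Good radii s decrease to r; the left side only grows with the radius and the right side is
continuous. -/
theorem flat_sq_le (hd : 1 ≤ d) (hp : 2 ≤ p) (hkp : 0 ≤ kp) (hkm : 0 ≤ km) {r : ℝ} (hr0 : 0 < r)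
    (hr : r < 1) : ∫ x' in Metric.ball (0 : Tangential d) r, u (pt x' 0) ^ 2 ≤
      2 * (r * dirichlet u r + height u r) := by
  obtain ⟨ρ, hrρ, hρ⟩ := exists_between hr
  have hsub : Ioo r ρ ⊆ Ioo 0 ρ := Ioo_subset_Ioo_left hr0.le
  have hfr := frequently_of_ae_restrict hrρ (ae_restrict_of_ae_restrict_of_subset hsub
    (hu.ae_flat_sq_le hp hkp hkm hρ))
  have hc : ContinuousAt (fun s => 2 * (s * dirichlet u s + height u s)) r := by
    have h1 : ContinuousAt (dirichlet u) r :=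
      hu.continuousOn_dirichlet.continuousAt (Icc_mem_nhds hr0 hr)
    have h2 : ContinuousAt (height u) r :=
      (hu.continuousOn_height hd hp hkp hkm).continuousAt (Ioo_mem_nhds hr0 hr)
    exact continuousAt_const.mul ((continuousAt_id.mul h1).add h2)
  have hc' := hc.tendsto.mono_left (nhdsWithin_le_nhds (s := Ioi r))
  refine ge_of_tendsto_of_frequently hc' ?_
  refine (hfr.and_eventually (Ioo_mem_nhdsGT hr)).mono fun s hs => le_trans ?_ hs.1
  exact setIntegral_mono_set ((hu.integrable_sq_trace hp).mono_set
    (Metric.ball_subset_ball hs.2.2.le)) (Eventually.of_forall fun _ => sq_nonneg _)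
    (Metric.ball_subset_ball hs.2.1.le).eventuallyLE

/-- The values of the trace are bounded by any bound for `u`. -/
theorem ae_abs_trace_le {ρ K : ℝ} (hρ : ρ ≤ 1) (hb : ∀ x ∈ halfBall d ρ, |u x| ≤ K) :
    ∀ᵐ x' ∂(volume.restrict (Metric.ball (0 : Tangential d) ρ)), |u (pt x' 0)| ≤ K := by
  filter_upwards [ae_restrict_of_ae_restrict_of_subset (Metric.ball_subset_ball hρ) hu.trace,
    ae_restrict_mem measurableSet_ball] with x' htr hx'
  refine le_of_tendsto htr.abs ?_
  have hc : Continuous fun t : ℝ => ‖pt x' t‖ := by fun_prop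
  have h1 : ∀ᶠ t in 𝓝 (0 : ℝ), ‖pt x' t‖ < ρ := by
    refine hc.tendsto 0 (Iio_mem_nhds ?_)
    rw [norm_pt_zero]; simpa using hx'
  filter_upwards [nhdsWithin_le_nhds h1, self_mem_nhdsWithin] with t ht ht0
  exact hb _ (mem_halfBall.2 ⟨ht, by simpa using ht0⟩)

/-- Since p ≥ 2 and |u| ≤ K, the potential is at most max(k₊, k₋) K^(p-2) u²; the factor 2 is that
of the trace inequality. -/
theorem penaltyBound (hd : 1 ≤ d) (hp : 2 ≤ p) (hkp : 0 ≤ kp) (hkm : 0 ≤ km) {K : ℝ}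
    (hb : ∀ x ∈ halfBall d (1 / 2), |u x| ≤ K) :
    PenaltyBound p kp km u (2 * max kp km * K ^ (p - 2)) := by
  intro r hr0 hr
  have h1 := hu.flat_sq_le hd hp hkp hkm hr0 (hr.trans (by norm_num))
  have hsub : Metric.ball (0 : Tangential d) r ⊆ Metric.ball 0 (1 / 2) :=
    Metric.ball_subset_ball hr.le
  have hsub1 : Metric.ball (0 : Tangential d) r ⊆ Metric.ball 0 1 :=
    Metric.ball_subset_ball (by linarith)
  have hm : 0 ≤ max kp km := le_max_of_le_left hkp
  have h2 : ∀ᵐ x' ∂(volume.restrict (Metric.ball (0 : Tangential d) r)),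
      potential p kp km (u (pt x' 0)) ≤ max kp km * K ^ (p - 2) * u (pt x' 0) ^ 2 := by
    filter_upwards [ae_restrict_of_ae_restrict_of_subset hsub
      (hu.ae_abs_trace_le (by norm_num) hb)] with x' hx'
    exact potential_le_sq hp hkp hx'
  have h3 : penalty p kp km u r ≤
      max kp km * K ^ (p - 2) * ∫ x' in Metric.ball (0 : Tangential d) r, u (pt x' 0) ^ 2 := by
    rw [← integral_const_mul]
    exact integral_mono_ae ((hu.integrable_potential hp hkp hkm).mono_set hsub1)
      (((hu.integrable_sq_trace hp).mono_set hsub1).const_mul _) h2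
  rcases (halfBall d (1 / 2)).eq_empty_or_nonempty with he | ⟨x, hx⟩
  · exfalso
    have : (1 / 4 : ℝ) • vert d ∈ halfBall d (1 / 2) := by
      rw [mem_halfBall, norm_smul, norm_vert]
      norm_num [vert_last]
    rw [he] at this
    exact this
  · have hK : 0 ≤ K := (abs_nonneg _).trans (hb x hx)
    have := mul_le_mul_of_nonneg_left h1 (mul_nonneg hm (Real.rpow_nonneg hK (p - 2)))
    linarith

end IsSolution

end Trace

/-! ### Differentiating dilated integrals at t = 1 -/

section Dilation

/-- With the dilation moved onto the cutoff, f need only be integrable: all differentiation falls on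
`tailInt χ`. -/
theorem IsCutoff.hasDerivAt_integral_tailInt_div {E : Type*} [NormedAddCommGroup E]
    [MeasurableSpace E] [OpensMeasurableSpace E] {μ : Measure E} {f : E → ℝ}
    (hf : Integrable f μ) {χ : ℝ → ℝ} {R : ℝ} (hχ : IsCutoff χ R) :
    Integrable (fun y => f y * (χ ‖y‖ * ‖y‖)) μ ∧
    HasDerivAt (fun t : ℝ => ∫ y, f y * tailInt χ (‖y‖ / t) ∂μ)
      (∫ y, f y * (χ ‖y‖ * ‖y‖) ∂μ) 1 := by
  obtain ⟨R₀, hR₀, hz⟩ := hχ.exists_zero_of_ge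
  obtain ⟨C, hC⟩ := hχ.compact.exists_bound_of_continuous hχ.continuous
  have hC0 : 0 ≤ C := (norm_nonneg _).trans (hC 0)
  have hs : Ioo (1 / 2 : ℝ) 2 ∈ 𝓝 (1 : ℝ) := Ioo_mem_nhds (by norm_num) (by norm_num)
  -- The bound comes from ‖y‖/t² = (1/t)(‖y‖/t), where 1/t ≤ 2 and ‖y‖/t < R₀ wherever χ(‖y‖/t) is
  -- nonzero.
  have key := hasDerivAt_integral_of_dominated_loc_of_deriv_le (μ := μ) (x₀ := (1 : ℝ))
    (F := fun t y => f y * tailInt χ (‖y‖ / t))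
    (F' := fun t y => f y * (χ (‖y‖ / t) * (‖y‖ / t ^ 2)))
    (bound := fun y => ‖f y‖ * (C * (2 * |R₀|))) hs ?_ ?_ ?_ ?_ (hf.norm.mul_const _) ?_
  · simpa only [div_one, one_pow] using key
  · refine Eventually.of_forall fun t => hf.1.mul ?_
    exact (hχ.continuous_tailInt.measurable.comp (by fun_prop)).aestronglyMeasurable
  · refine hf.mul_bdd (c := ∫ τ, χ τ) ?_ (Eventually.of_forall fun y => ?_)
    · exact (hχ.continuous_tailInt.measurable.comp (by fun_prop)).aestronglyMeasurable
    · rw [Real.norm_of_nonneg (hχ.tailInt_nonneg _)]; exact hχ.tailInt_le _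
  · refine hf.1.mul ?_
    exact ((hχ.continuous.measurable.comp (by fun_prop)).mul (by fun_prop)).aestronglyMeasurable
  · refine Eventually.of_forall fun y t ht => ?_
    have ht0 : 0 < t := by linarith [ht.1]
    rw [norm_mul]
    refine mul_le_mul_of_nonneg_left ?_ (norm_nonneg _)
    by_cases h : R₀ ≤ ‖y‖ / t
    · rw [(hz _ h).1, zero_mul, norm_zero]; positivity
    · rw [norm_mul]
      refine mul_le_mul (hC _) ?_ (norm_nonneg _) hC0
      have h1 : ‖y‖ / t ≤ |R₀| := (not_le.1 h).le.trans (le_abs_self _)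
      have h2 : ‖y‖ / t ^ 2 = (1 / t) * (‖y‖ / t) := by field_simp
      rw [h2, Real.norm_of_nonneg (by positivity)]
      have h3 : 1 / t ≤ 2 := by
        rw [div_le_iff₀ ht0]; linarith [ht.1]
      gcongr
  · refine Eventually.of_forall fun y t ht => ?_
    have ht0 : t ≠ 0 := by have := ht.1; linarith
    have h1 : HasDerivAt (fun t : ℝ => ‖y‖ / t) (-(‖y‖ / t ^ 2)) t := by
      have := (hasDerivAt_inv ht0).const_mul ‖y‖
      simp only [← div_eq_mul_inv] at this
      refine this.congr_deriv ?_
      rw [mul_neg, ← div_eq_mul_inv]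
    refine (((hχ.hasDerivAt_tailInt _).comp t h1).const_mul (f y)).congr_deriv ?_
    ring

theorem integral_mul_tailInt_comp_smul {E : Type*} [NormedAddCommGroup E] [NormedSpace ℝ E]
    [MeasurableSpace E] [BorelSpace E] [FiniteDimensional ℝ E] (μ : Measure E)
    [μ.IsAddHaarMeasure] (f : E → ℝ) (χ : ℝ → ℝ) {t : ℝ} (ht : 0 < t) :
    ∫ x, f (t • x) * tailInt χ ‖x‖ ∂μ =
      (t ^ Module.finrank ℝ E)⁻¹ * ∫ y, f y * tailInt χ (‖y‖ / t) ∂μ := by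
  have h := Measure.integral_comp_smul μ (fun y => f y * tailInt χ (‖y‖ / t)) t
  rw [abs_of_nonneg (by positivity), smul_eq_mul] at h
  rw [← h]
  refine integral_congr_ae (Eventually.of_forall fun x => ?_)
  simp only [norm_smul, Real.norm_of_nonneg ht.le]
  rw [mul_div_cancel_left₀ _ ht.ne']

variable {E : Type*} [NormedAddCommGroup E] [InnerProductSpace ℝ E] [FiniteDimensional ℝ E]
  [MeasurableSpace E] [BorelSpace E]

/-- The integrand is dominated by |V|² + |G(t·)|², and the integral of the second term scales by a
power of t that is bounded on [1/2, 2]. -/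
theorem integrable_inner_dilate {V G : E → E} (hV : MemLp V 2) (hVm : Measurable V)
    (hG : MemLp G 2) (hGm : Measurable G) :
    Integrable (fun q : E × ℝ => inner ℝ (V q.1) (G (q.2 • q.1)))
      (volume.prod (volume.restrict (Ioc (1 / 2 : ℝ) 2))) := by
  have h0 : Integrable (fun _ : ℝ => (1 : ℝ)) (volume.restrict (Ioc (1 / 2 : ℝ) 2)) :=
    integrableOn_const (by simp)
  have h1 := (hV.norm.integrable_sq).mul_prod h0
  have hGm2 : Measurable fun q : E × ℝ => G (q.2 • q.1) := hGm.comp (by fun_prop)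
  have hGi : Integrable (fun x => ‖G x‖ ^ 2) := hG.norm.integrable_sq
  have h2 : Integrable (fun q : E × ℝ => ‖G (q.2 • q.1)‖ ^ 2)
      (volume.prod (volume.restrict (Ioc (1 / 2 : ℝ) 2))) := by
    rw [integrable_prod_iff' (hGm2.norm.pow_const 2).aestronglyMeasurable]
    have hmem : ∀ᵐ t ∂(volume.restrict (Ioc (1 / 2 : ℝ) 2)), t ∈ Ioc (1 / 2 : ℝ) 2 :=
      ae_restrict_mem measurableSet_Ioc
    constructor
    · filter_upwards [hmem] with t ht
      exact (integrable_comp_smul_iff volume (fun x => ‖G x‖ ^ 2)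
        (by linarith [ht.1] : t ≠ 0)).2 hGi
    · have h3 : ContinuousOn (fun t : ℝ => |(t ^ Module.finrank ℝ E)⁻¹| • ∫ x, ‖G x‖ ^ 2)
          (Icc (1 / 2) 2) := by
        refine ContinuousOn.smul (ContinuousOn.abs (ContinuousOn.inv₀
          (continuous_pow _).continuousOn ?_))
          continuousOn_const
        exact fun t ht => pow_ne_zero _ (by linarith [ht.1])
      refine ((h3.integrableOn_compact isCompact_Icc).mono_set Ioc_subset_Icc_self).congr
        (Eventually.of_forall fun t => ?_)
      simp only [norm_pow, norm_norm]
      exact (Measure.integral_comp_smul volume (fun x => ‖G x‖ ^ 2) t).symm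
  refine (h1.add h2).mono' ?_ (Eventually.of_forall fun q => ?_)
  · exact ((hVm.comp measurable_fst).inner hGm2).aestronglyMeasurable
  · simp only [Pi.add_apply, mul_one]
    refine (norm_inner_le_norm _ _).trans ?_
    nlinarith [sq_nonneg (‖V q.1‖ - ‖G (q.2 • q.1)‖), sq_nonneg ‖V q.1‖,
      sq_nonneg ‖G (q.2 • q.1)‖]

theorem integral_intervalIntegral_inner_dilate {V G : E → E} (hV : MemLp V 2)
    (hVm : Measurable V) (hG : MemLp G 2) (hGm : Measurable G) {t : ℝ} (ht : 1 / 2 ≤ t)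
    (ht2 : t ≤ 2) :
    ∫ x, (∫ τ in (1 : ℝ)..t, inner ℝ (V x) (G (τ • x))) =
      ∫ τ in (1 : ℝ)..t, ∫ x, inner ℝ (V x) (G (τ • x)) := by
  have h := integrable_inner_dilate hV hVm hG hGm
  have hsub : ∀ a b : ℝ, 1 / 2 ≤ a → b ≤ 2 →
      Integrable (Function.uncurry fun (x : E) (τ : ℝ) => inner ℝ (V x) (G (τ • x)))
      (volume.prod (volume.restrict (Ioc a b))) := fun a b ha hb =>
    h.mono_measure (Measure.prod_mono le_rfl (Measure.restrict_mono (Ioc_subset_Ioc ha hb) le_rfl))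
  have h1 := hsub 1 t (by norm_num) ht2
  have h2 := hsub t 1 ht (by norm_num)
  simp only [intervalIntegral]
  have i1 := h1.integral_prod_left
  have i2 := h2.integral_prod_left
  simp only [Function.uncurry_apply_pair] at i1 i2
  rw [integral_sub i1 i2, integral_integral_swap h1, integral_integral_swap h2]

/-- After exchanging the integrals this is the fundamental theorem of calculus at t = 1. The
continuity it needs is the continuity of dilations in L², so G is never differentiated. -/
theorem hasDerivAt_integral_inner_dilate {V G : E → E} (hV : MemLp V 2)
    (hVm : Measurable V) (hG : MemLp G 2) (hGm : Measurable G) :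
    HasDerivAt (fun t : ℝ => ∫ x, ∫ τ in (1 : ℝ)..t, inner ℝ (V x) (G (τ • x)))
      (∫ x, inner ℝ (V x) (G x)) 1 := by
  have hs : Ioc (1 / 2 : ℝ) 2 ∈ 𝓝 (1 : ℝ) := Ioc_mem_nhds (by norm_num) (by norm_num)
  have h1 : HasDerivAt (fun t : ℝ => ∫ τ in (1 : ℝ)..t, ∫ x, inner ℝ (V x) (G (τ • x)))
      (∫ x, inner ℝ (V x) (G ((1 : ℝ) • x))) 1 := by
    refine intervalIntegral.integral_hasDerivAt_right IntervalIntegrable.refl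
      ⟨_, hs, (integrable_inner_dilate hV hVm hG hGm).integral_prod_right.1⟩ ?_
    have := tendsto_integral_inner_of_tendsto_eLpNorm (l := 𝓝 (1 : ℝ)) hV hG
      (g := fun t x => G (t • x)) ?_ (tendsto_eLpNorm_dilate_sub hG)
    · simpa only [ContinuousAt, one_smul] using this
    · filter_upwards [hs] with t ht
      exact (memLp_comp_smul hG ht.1.le).1
  simp only [one_smul] at h1
  refine h1.congr_of_eventuallyEq ?_
  filter_upwards [hs] with t ht
  exact integral_intervalIntegral_inner_dilate hV hVm hG hGm ht.1.le ht.2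

end Dilation

/-! ### Convexity of the boundary potential -/

section Convexity

variable {p kp km : ℝ}

/-- The tangent line inequality for (s⁺)^p / p, obtained from Young's inequality with exponents
p/(p-1) and p. -/
theorem posPart_rpow_mul_sub_le (hp : 2 ≤ p) (a b : ℝ) :
    (max a 0) ^ (p - 1) * (b - a) ≤ (1 / p) * ((max b 0) ^ p - (max a 0) ^ p) := by
  have hp0 : 0 < p := by linarith
  have hp1 : 0 < p - 1 := by linarith
  have ha : 0 ≤ max a 0 := le_max_right _ _
  have hb : 0 ≤ max b 0 := le_max_right _ _
  have e1 : (max a 0) ^ (p - 1) * a = (max a 0) ^ p := by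
    rcases le_total a 0 with h | h
    · rw [max_eq_right h, Real.zero_rpow hp1.ne', Real.zero_rpow hp0.ne', zero_mul]
    · rw [max_eq_left h]
      rcases h.eq_or_lt with rfl | h
      · rw [Real.zero_rpow hp0.ne', mul_zero]
      · rw [← Real.rpow_add_one h.ne']; ring_nf
  have hq : (p / (p - 1)).HolderConjugate p := by
    have : p.HolderConjugate (p / (p - 1)) := Real.HolderConjugate.conjExponent (by linarith)
    exact this.symm
  have hy := Real.young_inequality_of_nonneg (Real.rpow_nonneg ha (p - 1)) hb hq
  have e2 : ((max a 0) ^ (p - 1)) ^ (p / (p - 1)) = (max a 0) ^ p := by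
    rw [← Real.rpow_mul ha]; congr 1; field_simp
  rw [e2] at hy
  have h3 : (max a 0) ^ (p - 1) * b ≤ (max a 0) ^ (p - 1) * max b 0 :=
    mul_le_mul_of_nonneg_left (le_max_left _ _) (Real.rpow_nonneg ha _)
  have e4 : (max a 0) ^ p / (p / (p - 1)) = (max a 0) ^ p - (1 / p) * (max a 0) ^ p := by
    field_simp
  rw [e4] at hy
  rw [mul_sub, e1]
  have e5 : (max b 0) ^ p / p = (1 / p) * (max b 0) ^ p := by ring
  rw [e5] at hy
  linarith

/-- The flux is the derivative of the convex function F/p; the negative part is the positive part at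
-a and -b. -/
theorem flux_mul_sub_le (hp : 2 ≤ p) (hkp : 0 ≤ kp) (hkm : 0 ≤ km) (a b : ℝ) :
    flux p kp km a * (b - a) ≤ (1 / p) * (potential p kp km b - potential p kp km a) := by
  have h1 := mul_le_mul_of_nonneg_left (posPart_rpow_mul_sub_le hp a b) hkp
  have h2 := mul_le_mul_of_nonneg_left (posPart_rpow_mul_sub_le hp (-a) (-b)) hkm
  unfold flux potential
  linarith

end Convexity

/-! ### Testing with the difference between a dilation of u and u -/

section Pohozaev

variable {d : ℕ} {p kp km : ℝ} {u : Space d → ℝ}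

/-- The gradient on the half ball, extended by zero. -/
def gradExt (u : Space d → ℝ) : Space d → Space d :=
  (halfBall d 1).indicator fun x => gradient u x

theorem bulkDensity_eq (u : Space d → ℝ) (x : Space d) : bulkDensity u x = ‖gradExt u x‖ ^ 2 := by
  unfold bulkDensity gradExt
  by_cases hx : x ∈ halfBall d 1 <;> simp [hx]

theorem bulkDensity_nonneg (u : Space d → ℝ) (x : Space d) : 0 ≤ bulkDensity u x := by
  rw [bulkDensity_eq]; positivity

theorem flatDensity_nonneg (hkp : 0 ≤ kp) (hkm : 0 ≤ km) (u : Space d → ℝ) (x' : Tangential d) :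
    0 ≤ flatDensity p kp km u x' :=
  indicator_nonneg (fun _ _ => potential_nonneg hkp hkm _) _

/-- The square of the radial derivative on the half ball, extended by zero. -/
def radialSq (u : Space d → ℝ) (x : Space d) : ℝ := (inner ℝ x (gradExt u x) / ‖x‖) ^ 2

theorem radialSq_le (u : Space d → ℝ) (x : Space d) : radialSq u x ≤ bulkDensity u x := by
  rw [bulkDensity_eq, radialSq, ← sq_abs]
  have h := abs_real_inner_le_norm x (gradExt u x)
  gcongr
  rw [abs_div, abs_norm]
  exact div_le_of_le_mul₀ (norm_nonneg _) (norm_nonneg _) (by linarith)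

/-- The vector field `χ(|x|) (∂u/∂r) x`, with a sign. -/
def dilateField (u : Space d → ℝ) (χ : ℝ → ℝ) (x : Space d) : Space d :=
  (-(χ ‖x‖ * (inner ℝ x (gradExt u x) / ‖x‖))) • x

theorem smul_mem_halfBall {t r ρ : ℝ} (ht : 0 < t) (h : t * r ≤ ρ) {x : Space d}
    (hx : x ∈ halfBall d r) : t • x ∈ halfBall d ρ := by
  rw [mem_halfBall] at hx ⊢
  rw [norm_smul, Real.norm_of_nonneg ht.le]
  refine ⟨lt_of_lt_of_le (mul_lt_mul_of_pos_left hx.1 ht) h, ?_⟩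
  have : (t • x) (Fin.last d) = t * x (Fin.last d) := by simp
  rw [this]
  exact mul_pos ht hx.2

namespace IsSolution

variable (hu : IsSolution p kp km u)
include hu

theorem measurable_gradExt : Measurable (gradExt u) :=
  measurable_indicator_of_continuousOn (measurableSet_halfBall 1) hu.continuousOn_gradient

theorem memLp_gradExt : MemLp (gradExt u) 2 :=
  (memLp_indicator_iff_restrict (measurableSet_halfBall 1)).2 hu.memLp_gradient

theorem integrable_radialSq : Integrable (radialSq u) := by
  refine hu.integrable_bulkDensity.mono' ?_ (Eventually.of_forall fun x => ?_)
  · have := hu.measurable_gradExt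
    unfold radialSq
    exact Measurable.aestronglyMeasurable (by fun_prop)
  · rw [Real.norm_of_nonneg (show 0 ≤ radialSq u x from sq_nonneg _)]
    exact radialSq_le u x

theorem measurable_dilateField {χ : ℝ → ℝ} (hχ : Continuous χ) :
    Measurable (dilateField u χ) := by
  have := hu.measurable_gradExt
  unfold dilateField
  fun_prop

theorem memLp_dilateField {χ : ℝ → ℝ} {R : ℝ} (hχ : IsCutoff χ R) :
    MemLp (dilateField u χ) 2 := by
  obtain ⟨R₀, hR₀, hz⟩ := hχ.exists_zero_of_ge
  obtain ⟨C, hC⟩ := hχ.compact.exists_bound_of_continuous hχ.continuous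
  have hC0 : 0 ≤ C := (norm_nonneg _).trans (hC 0)
  refine hu.memLp_gradExt.of_le_mul (c := C * |R₀|)
    (hu.measurable_dilateField hχ.continuous).aestronglyMeasurable
    (Eventually.of_forall fun x => ?_)
  unfold dilateField
  by_cases h : R₀ ≤ ‖x‖
  · rw [(hz _ h).1]
    simp only [zero_mul, neg_zero, zero_smul, norm_zero]
    positivity
  · have h1 : ‖x‖ ≤ |R₀| := (not_le.1 h).le.trans (le_abs_self _)
    have h2 : |inner ℝ x (gradExt u x) / ‖x‖| ≤ ‖gradExt u x‖ := by
      rw [abs_div, abs_norm]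
      exact div_le_of_le_mul₀ (norm_nonneg _) (norm_nonneg _)
        (by linarith [abs_real_inner_le_norm x (gradExt u x)])
    rw [norm_smul, norm_neg, norm_mul]
    calc ‖χ ‖x‖‖ * ‖inner ℝ x (gradExt u x) / ‖x‖‖ * ‖x‖
        ≤ C * ‖gradExt u x‖ * |R₀| := by
          gcongr
          · exact hC _
          · exact h2
      _ = C * |R₀| * ‖gradExt u x‖ := by ring

theorem gradient_dilate_sub {ρ t : ℝ} (hρ : ρ ≤ 1) (ht : 0 < t) (htρ : t * ρ ≤ 1) {x : Space d}
    (hx : x ∈ halfBall d ρ) :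
    gradient (fun x => u (t • x) - u x) x = t • gradExt u (t • x) - gradExt u x := by
  have h1 : t • x ∈ halfBall d 1 := smul_mem_halfBall ht htρ hx
  have h2 : x ∈ halfBall d 1 := halfBall_mono hρ hx
  have h3 : HasFDerivAt (fun x : Space d => t • x) (t • ContinuousLinearMap.id ℝ (Space d)) x :=
    (hasFDerivAt_id x).const_smul t
  have h4 := ((hu.hasFDerivAt h1).comp x h3).sub (hu.hasFDerivAt h2)
  have h5 : fderiv ℝ (fun x => u (t • x) - u x) x = t • fderiv ℝ u (t • x) - fderiv ℝ u x := by
    refine h4.fderiv.trans ?_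
    rw [ContinuousLinearMap.comp_smul, ContinuousLinearMap.comp_id]
  unfold gradExt
  rw [indicator_of_mem h1, indicator_of_mem h2]
  unfold gradient
  rw [h5, map_sub, map_smul]

/-- The larger radius ρ' leaves room for dilations with t slightly above 1. Vertical limits survive
since dilations preserve vertical lines and null sets. -/
theorem isAdmissible_dilate {ρ ρ' K t : ℝ} (hρ : ρ ≤ ρ') (hρ' : ρ' ≤ 1)
    (hb : ∀ x ∈ halfBall d ρ', |u x| ≤ K) (ht : 1 / 2 ≤ t) (htρ : t * ρ ≤ ρ') :
    IsAdmissible (fun x => u (t • x) - u x) ρ (2 * K) where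
  contDiffOn := by
    have h1 : ContDiffOn ℝ 1 u (halfBall d 1) := hu.contDiffOn.of_le (by norm_num)
    refine ContDiffOn.sub (h1.comp (g := u) (by fun_prop) fun x hx => ?_)
      (h1.mono (halfBall_mono (hρ.trans hρ')))
    exact smul_mem_halfBall (by linarith) (htρ.trans hρ') hx
  bound x hx := by
    have h1 := hb _ (smul_mem_halfBall (by linarith) htρ hx)
    have h2 := hb _ (halfBall_mono hρ hx)
    linarith [abs_sub (u (t • x)) (u x)]
  memLp_gradient := by
    have h1 := ((memLp_comp_smul hu.memLp_gradExt ht).1.const_smul t).sub hu.memLp_gradExt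
    refine (h1.restrict (halfBall d ρ)).ae_eq ?_
    filter_upwards [ae_restrict_mem (measurableSet_halfBall ρ)] with x hx
    exact (hu.gradient_dilate_sub (hρ.trans hρ') (by linarith) (htρ.trans hρ') hx).symm
  trace := by
    have ht0 : 0 < t := by linarith
    have h1 := (ae_restrict_iff' measurableSet_ball).1 hu.trace
    have h2 := (Measure.quasiMeasurePreserving_smul (volume : Measure (Tangential d))
      ht0.ne').ae h1
    rw [ae_restrict_iff' measurableSet_ball]
    filter_upwards [h1, h2] with x' hx1 hx2 hx'
    rw [mem_ball_zero_iff] at hx'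
    have h3 := hx1 (mem_ball_zero_iff.2 (hx'.trans_le (hρ.trans hρ')))
    have h4 := hx2 (mem_ball_zero_iff.2 (by
      rw [norm_smul, Real.norm_of_nonneg ht0.le]
      exact (mul_lt_mul_of_pos_left hx' ht0).trans_le (htρ.trans hρ')))
    refine Tendsto.sub ?_ h3
    simp only [smul_pt, mul_zero]
    refine h4.comp (tendsto_nhdsWithin_iff.2 ⟨?_, ?_⟩)
    · have hc : Continuous fun s : ℝ => t * s := by fun_prop
      simpa using (hc.tendsto 0).mono_left (nhdsWithin_le_nhds (s := Ioi 0))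
    · filter_upwards [self_mem_nhdsWithin] with s hs
      exact mul_pos ht0 hs

theorem dilate_sub_eq {t : ℝ} (ht : 0 < t) {x : Space d} (hx : x ∈ halfBall d 1)
    (hx1 : t • x ∈ halfBall d 1) :
    u (t • x) - u x = ∫ τ in (1 : ℝ)..t, inner ℝ x (gradExt u (τ • x)) := by
  have hmem : ∀ τ ∈ uIcc 1 t, τ • x ∈ halfBall d 1 := by
    intro τ hτ
    rw [mem_halfBall] at hx hx1 ⊢
    have hτ0 : 0 < τ := (lt_min one_pos ht).trans_le hτ.1
    rw [norm_smul, Real.norm_of_nonneg ht.le] at hx1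
    rw [norm_smul, Real.norm_of_nonneg hτ0.le]
    have h2 : (τ • x) (Fin.last d) = τ * x (Fin.last d) := by simp
    rw [h2]
    refine ⟨?_, mul_pos hτ0 hx.2⟩
    refine (mul_le_mul_of_nonneg_right hτ.2 (norm_nonneg x)).trans_lt ?_
    rcases max_cases 1 t with ⟨h, -⟩ | ⟨h, -⟩ <;> rw [h] <;> linarith [hx.1, hx1.1]
  have hderiv : ∀ τ ∈ uIcc 1 t, HasDerivAt (fun τ : ℝ => u (τ • x))
      (inner ℝ x (gradExt u (τ • x))) τ := by
    intro τ hτ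
    have h1 : HasDerivAt (fun τ : ℝ => τ • x) x τ := by
      simpa using (hasDerivAt_id τ).smul_const x
    have h2 := (hu.hasFDerivAt (hmem τ hτ)).comp_hasDerivAt τ h1
    refine h2.congr_deriv ?_
    rw [gradExt, indicator_of_mem (hmem τ hτ), real_inner_comm, inner_gradient_left]
  have hcont : ContinuousOn (fun τ : ℝ => (inner ℝ x (gradExt u (τ • x)) : ℝ)) (uIcc 1 t) := by
    refine continuousOn_const.inner ?_
    have : ContinuousOn (fun τ : ℝ => gradient u (τ • x)) (uIcc 1 t) :=
      hu.continuousOn_gradient.comp (f := fun τ : ℝ => τ • x) (by fun_prop) hmem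
    refine this.congr fun τ hτ => ?_
    simp only [gradExt, indicator_of_mem (hmem τ hτ)]
  rw [intervalIntegral.integral_eq_sub_of_hasDerivAt hderiv hcont.intervalIntegrable, one_smul]

/-- Here u(tx) - u(x) is written as the integral of x·∇u(τx) over τ from 1 to t. Together with ∇η =
-χ x/|x| this explains the field `dilateField`, including its sign. -/
theorem setIntegral_dilate_fderiv {ρ t : ℝ} {χ : ℝ → ℝ} (hχ : IsCutoff χ ρ)
    (ht : 0 < t) (htρ : t * ρ ≤ 1) :
    ∫ x in halfBall d 1, (u (t • x) - u x) * fderiv ℝ (fun x => tailInt χ ‖x‖) x (gradient u x) =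
      ∫ x, ∫ τ in (1 : ℝ)..t, inner ℝ (dilateField u χ x) (gradExt u (τ • x)) := by
  obtain ⟨R₀, hR₀, hz⟩ := hχ.exists_zero_of_ge
  rw [← integral_indicator (measurableSet_halfBall 1)]
  refine integral_congr_ae (Eventually.of_forall fun x => ?_)
  simp only [dilateField, inner_smul_left, intervalIntegral.integral_const_mul]
  by_cases hx : x ∈ halfBall d 1
  · have hf := fderiv_tailInt_norm hχ (0 : Space d) x (gradient u x)
    simp only [sub_zero] at hf
    rw [indicator_of_mem hx, hf]
    by_cases h : R₀ ≤ ‖x‖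
    · simp [(hz _ h).1]
    · have hxρ : x ∈ halfBall d ρ := mem_halfBall.2 ⟨by linarith, hx.2⟩
      rw [hu.dilate_sub_eq ht hx (smul_mem_halfBall ht htρ hxρ)]
      have : gradExt u x = gradient u x := indicator_of_mem hx _
      rw [this]
      simp only [map_neg, conj_trivial]
      ring
  · rw [indicator_of_notMem hx]
    have : gradExt u x = 0 := indicator_of_notMem hx _
    simp [this]

/-- The deficit between dilated and undilated energies is nonnegative, by convexity. -/
theorem dilate_deficit_nonneg (hp : 2 ≤ p) (hkp : 0 ≤ kp) (hkm : 0 ≤ km) {ρ ρ' K t : ℝ}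
    (hρ : ρ ≤ ρ') (hρ' : ρ' ≤ 1) (hK : 0 ≤ K) (hb : ∀ x ∈ halfBall d ρ', |u x| ≤ K)
    (ht : 1 / 2 ≤ t) (htρ : t * ρ ≤ ρ') {χ : ℝ → ℝ} (hχ : IsCutoff χ ρ) :
    0 ≤ (∫ x, ∫ τ in (1 : ℝ)..t, inner ℝ (dilateField u χ x) (gradExt u (τ • x))) +
      (1 / 2) * (t ^ 2 * ((t ^ (d + 1))⁻¹ * ∫ x, bulkDensity u x * tailInt χ (‖x‖ / t)) -
        ∫ x, bulkDensity u x * tailInt χ ‖x‖) +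
      (1 / p) * ((t ^ d)⁻¹ * (∫ x', flatDensity p kp km u x' * tailInt χ (‖x'‖ / t)) -
        ∫ x', flatDensity p kp km u x' * tailInt χ ‖x'‖) := by
  obtain ⟨R₀, hR₀, hz⟩ := hχ.exists_zero_of_ge
  have ht0 : 0 < t := by linarith
  have hρ1 := hρ.trans hρ'
  have hη1 : ContDiff ℝ 1 fun x : Space d => tailInt χ ‖x‖ := by
    simpa using contDiff_tailInt_norm hχ (0 : Space d)
  obtain ⟨i1, i2, i3, e⟩ := hu.weak_admissible hp hkp hkm (η := fun x => tailInt χ ‖x‖)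
    (ρ := R₀) (by linarith) hρ1 (by positivity) (hu.isAdmissible_dilate hρ hρ' hb ht htρ) hη1
    fun x hx => (hz _ hx).2
  rw [hu.setIntegral_dilate_fderiv hχ ht0 (htρ.trans hρ')] at e
  have hbt : ∀ {F : Type} [NormedAddCommGroup F] [MeasurableSpace F] [BorelSpace F]
      {μ : Measure F} {f : F → ℝ}, Integrable f μ → Integrable (fun x => f x * tailInt χ ‖x‖) μ :=
    fun hf => hf.mul_bdd (c := ∫ τ, χ τ)
      (hχ.continuous_tailInt.comp continuous_norm).aestronglyMeasurable
      (Eventually.of_forall fun y => by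
        rw [Real.norm_of_nonneg (hχ.tailInt_nonneg _)]; exact hχ.tailInt_le _)
  have j1 := hbt hu.integrable_bulkDensity
  have j2 := hbt ((integrable_comp_smul_iff volume (bulkDensity u) ht0.ne').2
    hu.integrable_bulkDensity)
  have j3 := hbt (hu.integrable_flatDensity hp hkp hkm)
  have j4 := hbt ((integrable_comp_smul_iff volume (flatDensity p kp km u) ht0.ne').2
    (hu.integrable_flatDensity hp hkp hkm))
  have b1 : ∫ x in halfBall d 1, tailInt χ ‖x‖ *
      inner ℝ (gradient u x) (gradient (fun x => u (t • x) - u x) x) ≤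
      (1 / 2) * (t ^ 2 * (∫ x, bulkDensity u (t • x) * tailInt χ ‖x‖) -
        ∫ x, bulkDensity u x * tailInt χ ‖x‖) := by
    rw [← integral_indicator (measurableSet_halfBall 1), ← integral_const_mul,
      ← integral_sub (j2.const_mul _) j1, ← integral_const_mul]
    refine integral_mono (i2.integrable_indicator (measurableSet_halfBall 1))
      (((j2.const_mul _).sub j1).const_mul _) fun x => ?_
    have hη := hχ.tailInt_nonneg ‖x‖
    by_cases hx : x ∈ halfBall d 1
    · rw [indicator_of_mem hx]
      by_cases h : R₀ ≤ ‖x‖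
      · simp [(hz _ h).2]
      · have hxρ : x ∈ halfBall d ρ := mem_halfBall.2 ⟨by linarith, hx.2⟩
        rw [hu.gradient_dilate_sub hρ1 ht0 (htρ.trans hρ') hxρ]
        have h1 : gradExt u x = gradient u x := indicator_of_mem hx _
        rw [← h1, inner_sub_right, inner_smul_right, real_inner_self_eq_norm_sq]
        simp only [bulkDensity_eq]
        have h2 := real_inner_le_norm (gradExt u x) (gradExt u (t • x))
        have h3 := mul_le_mul_of_nonneg_left h2 ht0.le
        -- Convexity of the square: ∇u·(∇u_t - ∇u) ≤ ½(|∇u_t|² - |∇u|²) for u_t(x) = u(tx), whose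
        -- gradient carries a factor t.
        have h4 : t * inner ℝ (gradExt u x) (gradExt u (t • x)) - ‖gradExt u x‖ ^ 2 ≤
            1 / 2 * (t ^ 2 * ‖gradExt u (t • x)‖ ^ 2 - ‖gradExt u x‖ ^ 2) := by
          nlinarith [sq_nonneg (t * ‖gradExt u (t • x)‖ - ‖gradExt u x‖)]
        have h5 := mul_le_mul_of_nonneg_left h4 hη
        linarith
    · rw [indicator_of_notMem hx]
      have h1 : bulkDensity u x = 0 := indicator_of_notMem hx _
      rw [h1]
      have := mul_nonneg (bulkDensity_nonneg u (t • x)) hη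
      have h2 : 0 ≤ t ^ 2 := sq_nonneg t
      nlinarith [mul_nonneg h2 this]
  have b2 : ∫ x' in Metric.ball (0 : Tangential d) 1, flux p kp km (u (pt x' 0)) *
      (tailInt χ ‖pt x' 0‖ * (u (t • pt x' 0) - u (pt x' 0))) ≤
      (1 / p) * ((∫ x', flatDensity p kp km u (t • x') * tailInt χ ‖x'‖) -
        ∫ x', flatDensity p kp km u x' * tailInt χ ‖x'‖) := by
    rw [← integral_indicator measurableSet_ball, ← integral_sub j4 j3, ← integral_const_mul]
    refine integral_mono (i3.integrable_indicator measurableSet_ball)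
      ((j4.sub j3).const_mul _) fun x' => ?_
    have hη := hχ.tailInt_nonneg ‖x'‖
    have hp0 : 0 ≤ 1 / p := by positivity
    by_cases hx : x' ∈ Metric.ball (0 : Tangential d) 1
    · rw [indicator_of_mem hx, norm_pt_zero]
      by_cases h : R₀ ≤ ‖x'‖
      · simp [(hz _ h).2]
      · have hx1 : t • x' ∈ Metric.ball (0 : Tangential d) 1 := by
          rw [mem_ball_zero_iff, norm_smul, Real.norm_of_nonneg ht0.le]
          have : t * ‖x'‖ < t * ρ := mul_lt_mul_of_pos_left (by linarith) ht0
          linarith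
        simp only [flatDensity, indicator_of_mem hx, indicator_of_mem hx1, smul_pt, mul_zero]
        have h5 := mul_le_mul_of_nonneg_left (flux_mul_sub_le hp hkp hkm (u (pt x' 0))
          (u (pt (t • x') 0))) hη
        linarith
    · rw [indicator_of_notMem hx]
      have h1 : flatDensity p kp km u x' = 0 := indicator_of_notMem hx _
      rw [h1, zero_mul, sub_zero]
      exact mul_nonneg hp0 (mul_nonneg (flatDensity_nonneg hkp hkm u _) hη)
  -- The substitution y = tx moves the dilation from the densities, which are only integrable, to
  -- the C¹ cutoff. The bulk term acquires t^(-(d+1)), the flat term t^(-d).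
  rw [integral_mul_tailInt_comp_smul volume (bulkDensity u) χ ht0] at b1
  rw [integral_mul_tailInt_comp_smul volume (flatDensity p kp km u) χ ht0] at b2
  simp only [finrank_euclideanSpace, Fintype.card_fin] at b1 b2
  unfold flatIntegral at e
  linarith

end IsSolution

end Pohozaev

/-! ### The Pohozaev identity and the differential inequality for the energy -/

section Rellich

variable {d : ℕ} {p kp km : ℝ} {u : Space d → ℝ}

namespace IsSolution

variable (hu : IsSolution p kp km u)
include hu

/-- The Pohozaev identity, tested with a radial cutoff. -/
theorem pohozaev_cutoff (hp : 2 ≤ p) (hkp : 0 ≤ kp) (hkm : 0 ≤ km) {ρ : ℝ} (hρ0 : 0 < ρ)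
    (hρ : ρ < 1) {χ : ℝ → ℝ} (hχ : IsCutoff χ ρ) :
    (∫ x, inner ℝ (dilateField u χ x) (gradExt u x)) +
      (1 / 2) * ((1 - d) * (∫ x, bulkDensity u x * tailInt χ ‖x‖) +
        ∫ x, bulkDensity u x * (χ ‖x‖ * ‖x‖)) +
      (1 / p) * (-d * (∫ x', flatDensity p kp km u x' * tailInt χ ‖x'‖) +
        ∫ x', flatDensity p kp km u x' * (χ ‖x'‖ * ‖x'‖)) = 0 := by
  obtain ⟨ρ', hρρ', hρ'⟩ := exists_between hρ
  obtain ⟨K, hK, hb⟩ := hu.exists_bound hp hkp hkm hρ'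
  set X : ℝ → ℝ := fun t =>
    (∫ x, ∫ τ in (1 : ℝ)..t, inner ℝ (dilateField u χ x) (gradExt u (τ • x))) +
      (1 / 2) * (t ^ 2 * ((t ^ (d + 1))⁻¹ * ∫ x, bulkDensity u x * tailInt χ (‖x‖ / t)) -
        ∫ x, bulkDensity u x * tailInt χ ‖x‖) +
      (1 / p) * ((t ^ d)⁻¹ * (∫ x', flatDensity p kp km u x' * tailInt χ (‖x'‖ / t)) -
        ∫ x', flatDensity p kp km u x' * tailInt χ ‖x'‖) with hX
  have hX1 : X 1 = 0 := by simp [hX]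
  -- The one-sided convexity inequality holds for t on both sides of 1, so X has an interior minimum
  -- there and its derivative vanishes: an identity results from an inequality.
  have hmin : IsLocalMin X 1 := by
    have h1 : 1 < ρ' / ρ := (one_lt_div hρ0).2 hρρ'
    filter_upwards [Ioo_mem_nhds (show (1 / 2 : ℝ) < 1 by norm_num) h1] with t ht
    rw [hX1]
    exact hu.dilate_deficit_nonneg hp hkp hkm hρρ'.le hρ'.le hK hb ht.1.le
      ((lt_div_iff₀ hρ0).1 ht.2).le hχ
  have d1 := hasDerivAt_integral_inner_dilate (hu.memLp_dilateField hχ)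
    (hu.measurable_dilateField hχ.continuous) hu.memLp_gradExt hu.measurable_gradExt
  have d2 := (hχ.hasDerivAt_integral_tailInt_div hu.integrable_bulkDensity).2
  have d3 := (hχ.hasDerivAt_integral_tailInt_div (hu.integrable_flatDensity hp hkp hkm)).2
  have dpow : ∀ k : ℕ, HasDerivAt (fun t : ℝ => (t ^ k)⁻¹) (-(k : ℝ)) 1 := by
    intro k
    have := (hasDerivAt_pow k (1 : ℝ)).inv (by simp)
    exact (show HasDerivAt (fun t : ℝ => (t ^ k)⁻¹) _ 1 from this).congr_deriv (by simp)
  have dX := (d1.add ((((hasDerivAt_pow 2 (1 : ℝ)).mul ((dpow (d + 1)).mul d2)).sub_const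
    (∫ x, bulkDensity u x * tailInt χ ‖x‖)).const_mul (1 / 2))).add
    ((((dpow d).mul d3).sub_const
    (∫ x', flatDensity p kp km u x' * tailInt χ ‖x'‖)).const_mul (1 / p))
  have h0 := hmin.hasDerivAt_eq_zero dX
  simp only [Pi.mul_apply, one_pow, inv_one, div_one, one_mul, mul_one] at h0
  push_cast at h0
  linarith

/-- The terms of `pohozaev_cutoff` with χ(|x|)|x| become sphere integrals in polar coordinates,
those with the cutoff itself become ball integrals; `ae_eq_ballIntegral` then removes χ. -/
theorem pohozaev (hd : 1 ≤ d) (hp : 2 ≤ p) (hkp : 0 ≤ kp) (hkm : 0 ≤ km) {ρ : ℝ} (hρ0 : 0 < ρ)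
    (hρ : ρ < 1) : ∀ᵐ s ∂(volume.restrict (Ioo 0 ρ)),
      s * (sphereInt (bulkDensity u) s + 2 / p * sphereInt (flatDensity p kp km u) s) =
      (d - 1) * dirichlet u s + 2 / p * d * penalty p kp km u s +
        2 * s * sphereInt (radialSq u) s := by
  have := nontrivial_tangential hd
  have j0 := hu.integrable_radialSq
  have j1 := hu.integrable_bulkDensity
  have j2 := hu.integrable_flatDensity hp hkp hkm
  have hsub : Ioo 0 ρ ⊆ Ioi 0 := Ioo_subset_Ioi_self
  have hmulK : ∀ {k : ℝ → ℝ}, IntegrableOn k (Ioo 0 ρ) →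
      IntegrableOn (fun s => s * k s) (Ioo 0 ρ) := fun hk =>
    hk.bdd_mul (c := ρ) continuous_id.aestronglyMeasurable (by
      filter_upwards [ae_restrict_mem measurableSet_Ioo] with s hs
      change ‖s‖ ≤ ρ
      rw [Real.norm_of_nonneg hs.1.le]; exact hs.2.le)
  have k0 := hmulK ((integrableOn_sphereInt j0).mono_set hsub)
  have k1 := hmulK ((integrableOn_sphereInt j1).mono_set hsub)
  have k2 := hmulK ((integrableOn_sphereInt j2).mono_set hsub)
  have key := ae_eq_ballIntegral (f := fun x => (1 / 2) * (1 - d) * bulkDensity u x)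
    (g := fun x' => -(d / p) * flatDensity p kp km u x')
    (K := fun s => s * sphereInt (radialSq u) s - (1 / 2) * (s * sphereInt (bulkDensity u) s) -
      (1 / p) * (s * sphereInt (flatDensity p kp km u) s)) (R := ρ)
    (j1.const_mul _) (j2.const_mul _) ((k0.sub (k1.const_mul _)).sub (k2.const_mul _)) ?_
  · filter_upwards [key, ae_restrict_mem measurableSet_Ioo] with s hs hmem
    rw [integral_const_mul, integral_const_mul,
      ← dirichlet_eq_setIntegral u (hmem.2.trans hρ).le,
      ← penalty_eq_setIntegral p kp km u (hmem.2.trans hρ).le] at hs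
    have e1 : 2 / p * d * penalty p kp km u s = 2 * (d / p * penalty p kp km u s) := by ring
    have e2 : s * (sphereInt (bulkDensity u) s + 2 / p * sphereInt (flatDensity p kp km u) s) =
      s * sphereInt (bulkDensity u) s +
        2 * (1 / p * (s * sphereInt (flatDensity p kp km u) s)) := by ring
    rw [e1, e2]
    linarith
  · intro χ hχ
    have e := hu.pohozaev_cutoff hp hkp hkm hρ0 hρ hχ
    obtain ⟨C, hC⟩ := hχ.compact.exists_bound_of_continuous hχ.continuous
    have hb : ∀ {k : ℝ → ℝ}, IntegrableOn k (Ioo 0 ρ) →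
        IntegrableOn (fun s => χ s * k s) (Ioo 0 ρ) := fun hk =>
      hk.bdd_mul hχ.continuous.aestronglyMeasurable (Eventually.of_forall hC)
    have hpolar : ∀ {F : Type} [NormedAddCommGroup F] [InnerProductSpace ℝ F]
        [FiniteDimensional ℝ F] [MeasurableSpace F] [BorelSpace F] [Nontrivial F] {f : F → ℝ},
        Integrable f → ∫ x, f x * (χ ‖x‖ * ‖x‖) =
          ∫ s in Ioo 0 ρ, χ s * (s * sphereInt f s) := by
      intro F _ _ _ _ _ _ f hf
      have h1 : ∀ x : F, f x * (χ ‖x‖ * ‖x‖) = (fun s => χ s * s) ‖x‖ * f x := fun x => by ring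
      simp only [h1]
      rw [integral_mul_norm (fun s => χ s * s) (((hχ.hasDerivAt_integral_tailInt_div hf).1).congr
        (Eventually.of_forall h1)), ← hχ.setIntegral_eq]
      simp only [mul_assoc]
    have e0 : ∫ x, inner ℝ (dilateField u χ x) (gradExt u x) =
        -∫ x, radialSq u x * (χ ‖x‖ * ‖x‖) := by
      rw [← integral_neg]
      refine integral_congr_ae (Eventually.of_forall fun x => ?_)
      simp only [dilateField, radialSq, inner_smul_left, conj_trivial]
      rcases eq_or_ne ‖x‖ 0 with h | h
      · simp [h]
      · field_simp
    rw [e0, hpolar j0, hpolar j1, hpolar j2] at e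
    have m0 := hb k0
    have m1 := (hb k1).const_mul (1 / 2 : ℝ)
    have m2 := (hb k2).const_mul (1 / p)
    have l1 : ∫ s in Ioo 0 ρ, χ s * (s * sphereInt (radialSq u) s -
        (1 / 2) * (s * sphereInt (bulkDensity u) s) -
        (1 / p) * (s * sphereInt (flatDensity p kp km u) s)) =
        (∫ s in Ioo 0 ρ, χ s * (s * sphereInt (radialSq u) s)) -
        (1 / 2) * (∫ s in Ioo 0 ρ, χ s * (s * sphereInt (bulkDensity u) s)) -
        (1 / p) * ∫ s in Ioo 0 ρ, χ s * (s * sphereInt (flatDensity p kp km u) s) := by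
      have m01 := m0.sub m1
      simp only [Pi.sub_def] at m01
      rw [← integral_const_mul, ← integral_const_mul, ← integral_sub m0 m1,
        ← integral_sub m01 m2]
      exact integral_congr_ae (Eventually.of_forall fun s => by ring)
    rw [l1]
    simp only [mul_assoc, integral_const_mul] at e ⊢
    have e3 : (d : ℝ) / p = 1 / p * d := by ring
    rw [e3]
    linarith

/-- Cauchy–Schwarz in its quadratic form: integrate (u_r - c u)² ≥ 0 over the half sphere. The
quantifier over c stands inside the almost everywhere statement, so c may depend on s. -/
theorem ae_le_sphereInt_radialSq (hp : 2 ≤ p) (hkp : 0 ≤ kp) (hkm : 0 ≤ km) {ρ : ℝ}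
    (hρ : ρ < 1) : ∀ᵐ s ∂(volume.restrict (Ioo 0 ρ)), ∀ c : ℝ,
      2 * c * (dirichlet u s + penalty p kp km u s) - c ^ 2 * height u s ≤
        sphereInt (radialSq u) s := by
  obtain ⟨K, hK, hb⟩ := hu.exists_bound hp hkp hkm hρ
  have h := hu.isConvexTest_sq hρ.le hb
  have hsub : Ioo 0 ρ ⊆ Ioi 0 := Ioo_subset_Ioi_self
  have a0 := ae_restrict_of_ae_restrict_of_subset hsub
    (ae_integrable_sphere hu.integrable_radialSq)
  have a1 := ae_restrict_of_ae_restrict_of_subset hsub (ae_integrable_sphere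
    (hu.integrable_radialDensity h.contDiff.continuous hρ.le (fun x hx => (h.bound x hx).1) 0))
  have a2 := ae_restrict_of_ae_restrict_of_subset hsub
    (ae_integrable_sphere (h.integrable_valueDensity 0))
  filter_upwards [hu.ae_sphereInt_radial hp hkp hkm hρ, a0, a1, a2,
    ae_restrict_mem measurableSet_Ioo] with s hs h0 h1 h2 hmem c
  have hfr : Module.finrank ℝ (Space d) - 1 = d := by simp
  have key : 0 ≤ ∫ ω : Metric.sphere (0 : Space d) 1, (radialSq u (s • (ω : Space d)) -
      c * radialDensity u (fun s => 2 * s) ρ 0 (s • (ω : Space d)) +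
      c ^ 2 * valueDensity (fun x => u x ^ 2) ρ 0 (s • (ω : Space d)))
      ∂((volume : Measure (Space d)).toSphere) := by
    refine integral_nonneg fun ω => ?_
    have hn : ‖s • (ω : Space d)‖ < ρ := by
      rw [norm_smul_sphere ω hmem.1.le]; exact hmem.2
    generalize s • (ω : Space d) = z at hn
    simp only [radialDensity, valueDensity, zero_add, sub_zero, radialSq, gradExt]
    by_cases hz : z ∈ halfBall d ρ
    · rw [indicator_of_mem hz, indicator_of_mem hz, indicator_of_mem (halfBall_mono hρ.le hz)]
      have := sq_nonneg (inner ℝ z (gradient u z) / ‖z‖ - c * u z)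
      change (0 : ℝ) ≤ _
      linarith
    · have hz1 : z ∉ halfBall d 1 := fun h1 => hz (mem_halfBall.2 ⟨hn, h1.2⟩)
      rw [indicator_of_notMem hz, indicator_of_notMem hz, indicator_of_notMem hz1]
      simp
  have h01 := h0.sub (h1.const_mul c)
  simp only [Pi.sub_def] at h01
  rw [integral_add h01 (h2.const_mul _), integral_sub h0 (h1.const_mul _), integral_const_mul,
    integral_const_mul, ← heightMean_eq u hmem.1 hmem.2] at key
  have k2 := mul_nonneg (pow_nonneg hmem.1.le d) key
  rw [height_eq]
  rw [sphereInt, hfr] at hs ⊢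
  linear_combination k2 - c * hs

/-- The differential inequality behind the monotonicity of the perturbed frequency. -/
theorem ae_energy_deriv_ge (hd : 1 ≤ d) (hp : 2 ≤ p) (hkp : 0 ≤ kp) (hkm : 0 ≤ km) {ρ : ℝ}
    (hρ0 : 0 < ρ) (hρ : ρ < 1) : ∀ᵐ s ∂(volume.restrict (Ioo 0 ρ)), 0 < height u s →
      ((d - 1) / s + 2 * (dirichlet u s + penalty p kp km u s) / height u s) *
        (dirichlet u s + 2 / p * penalty p kp km u s) ≤
      sphereInt (bulkDensity u) s + 2 / p * sphereInt (flatDensity p kp km u) s := by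
  filter_upwards [hu.pohozaev hd hp hkp hkm hρ0 hρ, hu.ae_le_sphereInt_radialSq hp hkp hkm hρ,
    ae_restrict_mem measurableSet_Ioo] with s h1 h2 hmem hH
  have hs := hmem.1
  -- The optimal constant in Cauchy–Schwarz, which yields ∫ u_r² ≥ (D + P)²/H.
  have h3 := h2 ((dirichlet u s + penalty p kp km u s) / height u s)
  set D := dirichlet u s
  set P := penalty p kp km u s
  set H := height u s
  set A := sphereInt (bulkDensity u) s + 2 / p * sphereInt (flatDensity p kp km u) s
  have hD : 0 ≤ D := dirichlet_nonneg u s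
  have hP : 0 ≤ P := penalty_nonneg hkp hkm u s
  have hp2 : 2 / p ≤ 1 := by rw [div_le_one (by linarith)]; exact hp
  have hp0 : 0 ≤ 2 / p := by positivity
  have e3 : 2 * ((D + P) / H) * (D + P) - ((D + P) / H) ^ 2 * H = (D + P) / H * (D + P) := by
    field_simp
    ring
  rw [e3] at h3
  have h4 : (D + P) / H * (D + 2 / p * P) ≤ (D + P) / H * (D + P) := by
    have : 2 / p * P ≤ P := mul_le_of_le_one_left hP hp2
    gcongr
  have h5 : s * (((d - 1) / s + 2 * (D + P) / H) * (D + 2 / p * P)) ≤ s * A := by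
    rw [h1]
    have e5 : s * ((((d : ℝ) - 1) / s + 2 * (D + P) / H) * (D + 2 / p * P)) =
        (d - 1) * (D + 2 / p * P) + 2 * s * ((D + P) / H * (D + 2 / p * P)) := by
      field_simp
    rw [e5]
    have h6 : 2 * s * ((D + P) / H * (D + 2 / p * P)) ≤ 2 * s * sphereInt (radialSq u) s := by
      gcongr
      exact h4.trans h3
    -- The Pohozaev identity has the factor d in front of (2/p) P where only d - 1 is needed; the
    -- surplus is discarded.
    have h7 : 0 ≤ 2 / p * P := mul_nonneg hp0 hP
    nlinarith
  exact le_of_mul_le_mul_left h5 hs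

end IsSolution

end Rellich

/-! ### Monotonicity of the perturbed frequency, its limit, and growth of the height -/

section Monotonicity

/-- A Gronwall inequality for functions controlled by the integral of a multiple of themselves. -/
theorem mul_le_mul_of_integral_le {f c q : ℝ → ℝ} {a b : ℝ} (hab : a ≤ b)
    (hf : ContinuousOn f (Icc a b)) (hc : ContinuousOn c (Icc a b))
    (hc0 : ∀ s ∈ Icc a b, 0 ≤ c s) (hq0 : ∀ s ∈ Icc a b, 0 ≤ q s)
    (hq : ∀ s ∈ Icc a b, HasDerivAt q (-(c s * q s)) s)
    (h : ∀ s ∈ Icc a b, ∫ τ in a..s, c τ * f τ ≤ f s - f a) : q a * f a ≤ q b * f b := by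
  -- Differentiability of f is avoided by passing to its differentiable minorant g = f(a) + ∫ c f,
  -- for which (q g)' = c q (f - g) ≥ 0.
  have hcf : ContinuousOn (fun τ => c τ * f τ) (Icc a b) := hc.mul hf
  set g : ℝ → ℝ := fun s => f a + ∫ τ in a..s, c τ * f τ with hg
  have hgf : ∀ s ∈ Icc a b, g s ≤ f s := fun s hs => by simp only [hg]; linarith [h s hs]
  have hgc : ContinuousOn g (Icc a b) := by
    refine continuousOn_const.add ?_
    have := intervalIntegral.continuousOn_primitive_interval (μ := volume)
      (f := fun τ => c τ * f τ) (a := a) (b := b)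
      (by rw [uIcc_of_le hab]; exact hcf.integrableOn_compact isCompact_Icc)
    rwa [uIcc_of_le hab] at this
  have hgd : ∀ s ∈ Ioo a b, HasDerivAt g (c s * f s) s := by
    intro s hs
    refine (intervalIntegral.integral_hasDerivAt_right ?_ ?_ ?_).const_add _
    · refine (hcf.mono ?_).intervalIntegrable
      rw [uIcc_of_le hs.1.le]
      exact Icc_subset_Icc_right hs.2.le
    · exact (hcf.mono Ioo_subset_Icc_self).stronglyMeasurableAtFilter isOpen_Ioo s hs
    · exact hcf.continuousAt (Icc_mem_nhds hs.1 hs.2)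
  have hqc : ContinuousOn q (Icc a b) := fun s hs => (hq s hs).continuousAt.continuousWithinAt
  have hmono : MonotoneOn (fun s => q s * g s) (Icc a b) := by
    refine monotoneOn_of_hasDerivWithinAt_nonneg (convex_Icc a b) (hqc.mul hgc)
      (f' := fun s => -(c s * q s) * g s + q s * (c s * f s)) (fun s hs => ?_) fun s hs => ?_
    · rw [interior_Icc] at hs ⊢
      exact ((hq s (Ioo_subset_Icc_self hs)).mul (hgd s hs)).hasDerivWithinAt
    · rw [interior_Icc] at hs
      have hs' := Ioo_subset_Icc_self hs
      have := mul_nonneg (mul_nonneg (hc0 s hs') (hq0 s hs')) (sub_nonneg.2 (hgf s hs'))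
      linarith
  have ha : a ∈ Icc a b := left_mem_Icc.2 hab
  have hb : b ∈ Icc a b := right_mem_Icc.2 hab
  have h1 := hmono ha hb hab
  have h2 := mul_le_mul_of_nonneg_left (hgf b hb) (hq0 b hb)
  have h3 : g a = f a := by simp [hg]
  simp only [h3] at h1
  exact h1.trans h2

variable {d : ℕ} {p kp km : ℝ} {u : Space d → ℝ}

theorem height_nonneg (u : Space d → ℝ) {r : ℝ} (hr : 0 ≤ r) : 0 ≤ height u r :=
  mul_nonneg (pow_nonneg hr _) (heightMean_nonneg u r)

/-- The perturbed energy `D(r) + (2 / p) ∫_{Γ_r} F(u)`. -/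
def perturbedEnergy (p kp km : ℝ) (u : Space d → ℝ) (r : ℝ) : ℝ :=
  dirichlet u r + 2 / p * penalty p kp km u r

theorem perturbedEnergy_nonneg (hp : 2 ≤ p) (hkp : 0 ≤ kp) (hkm : 0 ≤ km) (u : Space d → ℝ)
    (r : ℝ) : 0 ≤ perturbedEnergy p kp km u r :=
  add_nonneg (dirichlet_nonneg u r) (mul_nonneg (by positivity) (penalty_nonneg hkp hkm u r))

theorem perturbedEnergy_le (hp : 2 ≤ p) (hkp : 0 ≤ kp) (hkm : 0 ≤ km) (u : Space d → ℝ)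
    (r : ℝ) : perturbedEnergy p kp km u r ≤ dirichlet u r + penalty p kp km u r := by
  have : 2 / p ≤ 1 := by rw [div_le_one (by linarith)]; exact hp
  have := mul_le_of_le_one_left (penalty_nonneg (p := p) hkp hkm u r) this
  unfold perturbedEnergy
  linarith

namespace IsSolution

variable (hu : IsSolution p kp km u)
include hu

theorem hasDerivAt_height (hd : 1 ≤ d) (hp : 2 ≤ p) (hkp : 0 ≤ kp) (hkm : 0 ≤ km) {r : ℝ}
    (hr : r ∈ Ioo 0 1) : HasDerivAt (height u)
      (d / r * height u r + 2 * (dirichlet u r + penalty p kp km u r)) r := by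
  have hr0 : r ≠ 0 := hr.1.ne'
  have h := (hasDerivAt_pow d r).mul (hu.hasDerivAt_heightMean hd hp hkp hkm hr)
  refine h.congr_deriv ?_
  rw [height_eq]
  have e : (r : ℝ) ^ d = r ^ (d - 1) * r := by
    rw [← pow_succ, Nat.sub_add_cancel hd]
  rw [mul_div_cancel₀ _ (pow_ne_zero d hr0)]
  congr 1
  rw [e]
  field_simp

theorem continuousOn_perturbedEnergy (hd : 1 ≤ d) (hp : 2 ≤ p) (hkp : 0 ≤ kp) (hkm : 0 ≤ km) :
    ContinuousOn (perturbedEnergy p kp km u) (Icc 0 1) :=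
  hu.continuousOn_dirichlet.add ((hu.continuousOn_penalty hd hp hkp hkm).const_smul (2 / p))

theorem perturbedEnergy_sub (hd : 1 ≤ d) (hp : 2 ≤ p) (hkp : 0 ≤ kp) (hkm : 0 ≤ km) {a b : ℝ}
    (ha : 0 ≤ a) (hab : a ≤ b) (hb : b ≤ 1) :
    IntervalIntegrable (fun s => sphereInt (bulkDensity u) s +
      2 / p * sphereInt (flatDensity p kp km u) s) volume a b ∧
    perturbedEnergy p kp km u b - perturbedEnergy p kp km u a =
      ∫ s in a..b, (sphereInt (bulkDensity u) s + 2 / p * sphereInt (flatDensity p kp km u) s) := by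
  have := nontrivial_tangential hd
  have hI : ∀ {f : ℝ → ℝ}, IntegrableOn f (Ioi 0) → ∀ x y : ℝ, 0 ≤ x → 0 ≤ y →
      IntervalIntegrable f volume x y := fun hf x y hx hy => by
    rw [intervalIntegrable_iff]
    exact hf.mono_set fun s hs => (le_min hx hy).trans_lt hs.1
  have i1 := hI (integrableOn_sphereInt hu.integrable_bulkDensity)
  have i2 := hI (integrableOn_sphereInt (hu.integrable_flatDensity hp hkp hkm))
  have hb0 := ha.trans hab
  refine ⟨(i1 a b ha hb0).add ((i2 a b ha hb0).const_mul _), ?_⟩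
  unfold perturbedEnergy
  rw [hu.dirichlet_eq ha (hab.trans hb), hu.dirichlet_eq hb0 hb,
    hu.penalty_eq hd hp hkp hkm ha (hab.trans hb), hu.penalty_eq hd hp hkp hkm hb0 hb,
    intervalIntegral.integral_add (i1 a b ha hb0) ((i2 a b ha hb0).const_mul _),
    intervalIntegral.integral_const_mul,
    ← intervalIntegral.integral_add_adjacent_intervals (i1 0 a le_rfl ha) (i1 a b ha hb0),
    ← intervalIntegral.integral_add_adjacent_intervals (i2 0 a le_rfl ha) (i2 a b ha hb0)]
  ring

/-- The frequency is E multiplied by s/H, and s/H is the integrating factor for the coefficient (d -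
1)/s + 2 (D + P)/H of the differential inequality for E. The Gronwall lemma in integrated form
applies because E is the integral of its almost everywhere derivative. -/
theorem perturbedFrequency_mono (hd : 1 ≤ d) (hp : 2 ≤ p) (hkp : 0 ≤ kp) (hkm : 0 ≤ km)
    (hpos : ∀ s ∈ Ioo 0 1, 0 < height u s) :
    MonotoneOn (perturbedFrequency p kp km u) (Ioo 0 1) := by
  intro a ha b hb hab
  have hsub : Icc a b ⊆ Ioo 0 1 := fun s hs => ⟨ha.1.trans_le hs.1, hs.2.trans_lt hb.2⟩
  have hsub1 : Icc a b ⊆ Icc 0 1 := hsub.trans Ioo_subset_Icc_self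
  have hne : ∀ s ∈ Icc a b, height u s ≠ 0 := fun s hs => (hpos s (hsub hs)).ne'
  have hE := (hu.continuousOn_perturbedEnergy hd hp hkp hkm).mono hsub1
  have hd1 : (0 : ℝ) ≤ d - 1 := by
    have : (1 : ℝ) ≤ d := by exact_mod_cast hd
    linarith
  have hI : ∀ s, 0 ≤ dirichlet u s + penalty p kp km u s := fun s =>
    add_nonneg (dirichlet_nonneg u s) (penalty_nonneg hkp hkm u s)
  have hc : ContinuousOn (fun s => ((d : ℝ) - 1) / s +
      2 * (dirichlet u s + penalty p kp km u s) / height u s) (Icc a b) := by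
    refine (continuousOn_const.div continuousOn_id fun s hs => (hsub hs).1.ne').add
      (ContinuousOn.div ?_ ((hu.continuousOn_height hd hp hkp hkm).mono hsub) hne)
    exact (((hu.continuousOn_dirichlet.add (hu.continuousOn_penalty hd hp hkp hkm)).mono
      hsub1).const_smul (2 : ℝ))
  have key := mul_le_mul_of_integral_le (f := perturbedEnergy p kp km u)
    (q := fun s => s / height u s) hab hE hc ?_ ?_ ?_ ?_
  · have e : ∀ s, perturbedFrequency p kp km u s =
        s / height u s * perturbedEnergy p kp km u s := fun s => by
      unfold perturbedFrequency perturbedEnergy; ring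
    rw [e, e]
    exact key
  · intro s hs
    have h1 := hI s
    have h2 := (hpos s (hsub hs)).le
    have h3 := (hsub hs).1.le
    positivity
  · exact fun s hs => div_nonneg (hsub hs).1.le (hpos s (hsub hs)).le
  · intro s hs
    have h1 := (hasDerivAt_id s).div (hu.hasDerivAt_height hd hp hkp hkm (hsub hs)) (hne s hs)
    refine h1.congr_deriv ?_
    have h2 := hne s hs
    have h3 : s ≠ 0 := (hsub hs).1.ne'
    simp only [id]
    field_simp
    ring
  · intro s hs
    obtain ⟨i1, e1⟩ := hu.perturbedEnergy_sub hd hp hkp hkm ha.1.le hs.1 (hsub1 hs).2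
    rw [e1]
    have hsub2 : Icc a s ⊆ Icc a b := Icc_subset_Icc_right hs.2
    refine intervalIntegral.integral_mono_ae_restrict hs.1 ?_ i1 ?_
    · refine ((hc.mul hE).mono ?_).intervalIntegrable
      rw [uIcc_of_le hs.1]; exact hsub2
    · rw [← restrict_Ioo_eq_restrict_Icc]
      obtain ⟨ρ, hbρ, hρ⟩ := exists_between hb.2
      have hsub3 : Ioo a s ⊆ Ioo 0 ρ := fun t ht => ⟨ha.1.trans ht.1, by linarith [ht.2, hs.2]⟩
      filter_upwards [ae_restrict_of_ae_restrict_of_subset hsub3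
        (hu.ae_energy_deriv_ge hd hp hkp hkm (by linarith [hb.1]) hρ),
        ae_restrict_mem measurableSet_Ioo] with t ht hmem
      exact ht (hpos t (hsub (hsub2 (Ioo_subset_Icc_self hmem))))

/-- The limit of the frequencies at the origin, with the inequalities relating the energy to the
height that hold also where the height vanishes. -/
theorem exists_frequency_limit (hd : 1 ≤ d) (hp : 2 ≤ p) (hkp : 0 ≤ kp) (hkm : 0 ≤ km)
    {C : ℝ} (hC : 0 ≤ C) (hpen : PenaltyBound p kp km u C) :
    ∃ μ : ℝ, 0 ≤ μ ∧ Tendsto (perturbedFrequency p kp km u) (𝓝[>] 0) (𝓝 μ) ∧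
      Tendsto (frequency u) (𝓝[>] 0) (𝓝 μ) ∧
      (∀ s ∈ Ioo 0 1, μ * height u s ≤ s * perturbedEnergy p kp km u s) ∧
      ∀ δ : ℝ, 0 < δ → ∃ R₀ : ℝ, 0 < R₀ ∧ R₀ ≤ 1 / 2 ∧
        ∀ s ∈ Ioo 0 R₀, s * perturbedEnergy p kp km u s ≤ (μ + δ) * height u s := by
  by_cases hpos : ∀ s ∈ Ioo 0 1, 0 < height u s
  · have hmono := hu.perturbedFrequency_mono hd hp hkp hkm hpos
    have hnn : ∀ s ∈ Ioo (0 : ℝ) 1, 0 ≤ perturbedFrequency p kp km u s := fun s hs =>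
      mul_nonneg hs.1.le (div_nonneg (perturbedEnergy_nonneg hp hkp hkm u s) (hpos s hs).le)
    have hbdd : BddBelow (perturbedFrequency p kp km u '' Ioo 0 1) :=
      ⟨0, by rintro _ ⟨s, hs, rfl⟩; exact hnn s hs⟩
    have hne : (Ioo (0 : ℝ) 1).Nonempty := nonempty_Ioo.2 one_pos
    have hlim := hmono.tendsto_nhdsWithin_Ioo_right hne hbdd
    set μ := sInf (perturbedFrequency p kp km u '' Ioo 0 1) with hμ
    have hμ0 : 0 ≤ μ := le_csInf (hne.image _) (by rintro _ ⟨s, hs, rfl⟩; exact hnn s hs)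
    refine ⟨μ, hμ0, hlim, ?_, ?_, ?_⟩
    · have hid : Tendsto (fun s : ℝ => s) (𝓝[>] 0) (𝓝 0) :=
        tendsto_id.mono_left nhdsWithin_le_nhds
      -- The gap between the two frequencies is (2/p) s P/H, and the penalty bound gives P/H ≤ C (N
      -- + 1). The factor s makes the gap vanish in the limit.
      have hz : Tendsto (fun s => 2 / p * C * (s * (perturbedFrequency p kp km u s + 1)))
          (𝓝[>] 0) (𝓝 0) := by
        simpa using (hid.mul (hlim.add_const 1)).const_mul (2 / p * C)
      refine tendsto_of_tendsto_of_tendsto_of_le_of_le' (by simpa using hlim.sub hz) hlim ?_ ?_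
      all_goals
        filter_upwards [Ioo_mem_nhdsGT (show (0 : ℝ) < 1 / 2 by norm_num)] with s hs
        have hH := hpos s ⟨hs.1, by linarith [hs.2]⟩
        have hP : 0 ≤ penalty p kp km u s := penalty_nonneg hkp hkm u s
        have hp2 : 0 ≤ 2 / p := by positivity
        have e : perturbedFrequency p kp km u s = frequency u s +
            2 / p * (s * (penalty p kp km u s / height u s)) := by
          unfold perturbedFrequency frequency; ring
        have h1 : 0 ≤ s * (penalty p kp km u s / height u s) :=
          mul_nonneg hs.1.le (div_nonneg hP hH.le)
      · have h2 : penalty p kp km u s / height u s ≤ C * (frequency u s + 1) := by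
          rw [div_le_iff₀ hH]
          refine (hpen s hs.1 hs.2).trans (le_of_eq ?_)
          unfold frequency
          field_simp
        have h3 : frequency u s ≤ perturbedFrequency p kp km u s := by
          rw [e]; linarith [mul_nonneg hp2 h1]
        have h4 : s * (penalty p kp km u s / height u s) ≤
            s * (C * (perturbedFrequency p kp km u s + 1)) := by
          refine mul_le_mul_of_nonneg_left (h2.trans ?_) hs.1.le
          gcongr
        have h5 := mul_le_mul_of_nonneg_left h4 hp2
        linarith
      · rw [e]; linarith [mul_nonneg hp2 h1]
    · intro s hs
      have h1 : μ ≤ perturbedFrequency p kp km u s := csInf_le hbdd ⟨s, hs, rfl⟩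
      have h2 := mul_le_mul_of_nonneg_right h1 (hpos s hs).le
      refine h2.trans (le_of_eq ?_)
      have := (hpos s hs).ne'
      unfold perturbedFrequency perturbedEnergy
      field_simp
    · intro δ hδ
      have h1 := hlim.eventually_lt_const (show μ < μ + δ by linarith)
      obtain ⟨R, hR, hRs⟩ := mem_nhdsGT_iff_exists_Ioo_subset.1 h1
      refine ⟨min R (1 / 2), lt_min hR (by norm_num), min_le_right _ _, fun s hs => ?_⟩
      have hs1 : s ∈ Ioo (0 : ℝ) 1 :=
        ⟨hs.1, by linarith [hs.2, min_le_right R (1 / 2)]⟩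
      have h2 : perturbedFrequency p kp km u s < μ + δ :=
        hRs ⟨hs.1, hs.2.trans_le (min_le_left _ _)⟩
      have h3 := mul_le_mul_of_nonneg_right h2.le (hpos s hs1).le
      refine (le_of_eq ?_).trans h3
      have := (hpos s hs1).ne'
      unfold perturbedFrequency perturbedEnergy
      field_simp
  -- Degenerate case: H vanishes at some r. The mean height is nondecreasing, hence zero up to r;
  -- its derivative forces D = P = 0 there, and both frequencies are 0 by the convention 0/0 = 0.
  -- The two inequalities are stated without division so that they remain meaningful here.
  · push Not at hpos
    obtain ⟨r, hr, hr0⟩ := hpos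
    have hzero : ∀ s, 0 < s → s ≤ r → heightMean u s = 0 := by
      intro s hs hsr
      have h1 : heightMean u r ≤ 0 := by
        rw [height_eq] at hr0
        by_contra h
        exact absurd hr0 (not_le.2 (mul_pos (pow_pos hr.1 d) (not_le.1 h)))
      exact le_antisymm ((hu.heightMean_mono hp hkp hkm hs hsr hr.2).trans h1)
        (heightMean_nonneg u s)
    have hDP : ∀ s ∈ Ioo 0 r, dirichlet u s = 0 ∧ penalty p kp km u s = 0 := by
      intro s hs
      have h1 := hu.hasDerivAt_heightMean hd hp hkp hkm ⟨hs.1, hs.2.trans hr.2⟩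
      have h2 : HasDerivAt (heightMean u) 0 s := by
        refine (hasDerivAt_const s (0 : ℝ)).congr_of_eventuallyEq ?_
        filter_upwards [Ioo_mem_nhds hs.1 hs.2] with t ht
        exact hzero t ht.1 ht.2.le
      have h3 := h1.unique h2
      have h4 := dirichlet_nonneg u s
      have h5 := penalty_nonneg (p := p) hkp hkm u s
      have h6 : 0 < s ^ d := pow_pos hs.1 d
      rw [div_eq_zero_iff, or_iff_left h6.ne'] at h3
      constructor <;> linarith
    have hE : ∀ s ∈ Ioo 0 r, perturbedEnergy p kp km u s = 0 := fun s hs => by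
      unfold perturbedEnergy
      rw [(hDP s hs).1, (hDP s hs).2]; ring
    refine ⟨0, le_rfl, ?_, ?_, ?_, ?_⟩
    · refine tendsto_const_nhds.congr' ?_
      filter_upwards [Ioo_mem_nhdsGT hr.1] with s hs
      have : dirichlet u s + 2 / p * penalty p kp km u s = 0 := hE s hs
      rw [perturbedFrequency, this, zero_div, mul_zero]
    · refine tendsto_const_nhds.congr' ?_
      filter_upwards [Ioo_mem_nhdsGT hr.1] with s hs
      rw [frequency, (hDP s hs).1, zero_div, mul_zero]
    · intro s hs
      rw [zero_mul]
      exact mul_nonneg hs.1.le (perturbedEnergy_nonneg hp hkp hkm u s)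
    · intro δ hδ
      refine ⟨min r (1 / 2), lt_min hr.1 (by norm_num), min_le_right _ _, fun s hs => ?_⟩
      rw [hE s ⟨hs.1, hs.2.trans_le (min_le_left _ _)⟩, mul_zero]
      exact mul_nonneg (by linarith) (height_nonneg u hs.1.le)

/-- The logarithmic derivative of the mean height, times s, is 2 s (D + P)/H ≥ 2 s E/H ≥ 2μ; the
computation is arranged so that H may vanish. -/
theorem rpow_mul_heightMean_mono (hd : 1 ≤ d) (hp : 2 ≤ p) (hkp : 0 ≤ kp) (hkm : 0 ≤ km) {μ : ℝ}
    (hμ : ∀ s ∈ Ioo 0 1, μ * height u s ≤ s * perturbedEnergy p kp km u s) :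
    MonotoneOn (fun r : ℝ => r ^ (-2 * μ) * heightMean u r) (Ioo 0 1) := by
  have hder : ∀ s ∈ Ioo (0 : ℝ) 1, HasDerivAt (fun r : ℝ => r ^ (-2 * μ) * heightMean u r)
      (-2 * μ * s ^ (-2 * μ - 1) * heightMean u s + s ^ (-2 * μ) *
        (2 * (dirichlet u s + penalty p kp km u s) / s ^ d)) s := fun s hs =>
    (Real.hasDerivAt_rpow_const (Or.inl hs.1.ne')).mul (hu.hasDerivAt_heightMean hd hp hkp hkm hs)
  refine monotoneOn_of_hasDerivWithinAt_nonneg (convex_Ioo 0 1)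
    (fun s hs => (hder s hs).continuousAt.continuousWithinAt)
    (fun s hs => (hder s (interior_subset hs)).hasDerivWithinAt) fun s hs => ?_
  replace hs := interior_subset hs
  have h1 := hμ s hs
  have h2 := mul_le_mul_of_nonneg_left (perturbedEnergy_le hp hkp hkm u s) hs.1.le
  have h3 := h1.trans h2
  rw [height_eq] at h3
  have hsd : 0 < s ^ d := pow_pos hs.1 d
  have h4 : μ * heightMean u s / s ≤ (dirichlet u s + penalty p kp km u s) / s ^ d := by
    rw [div_le_div_iff₀ hs.1 hsd]
    linarith
  have h5 : s ^ (-2 * μ - 1) = s ^ (-2 * μ) / s := by rw [Real.rpow_sub_one hs.1.ne']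
  have h6 : 0 ≤ s ^ (-2 * μ) := Real.rpow_nonneg hs.1.le _
  have h7 := mul_le_mul_of_nonneg_left h4 h6
  rw [h5]
  have e : -2 * μ * (s ^ (-2 * μ) / s) * heightMean u s + s ^ (-2 * μ) *
      (2 * (dirichlet u s + penalty p kp km u s) / s ^ d) =
      2 * (s ^ (-2 * μ) * ((dirichlet u s + penalty p kp km u s) / s ^ d) -
        s ^ (-2 * μ) * (μ * heightMean u s / s)) := by ring
  rw [e]
  linarith

/-- The upper counterpart: D + P exceeds E by (1 - 2/p) P, and P ≤ C (s D + H) ≤ C (ν + 1) H since s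
D ≤ s E ≤ ν H. This excess produces the exponential factor, which disappears for p = 2. -/
theorem heightMean_le_doubling (hd : 1 ≤ d) (hp : 2 ≤ p) (hkp : 0 ≤ kp) (hkm : 0 ≤ km)
    {C ν R₀ : ℝ} (hC : 0 ≤ C) (hpen : PenaltyBound p kp km u C) (hR₀ : R₀ ≤ 1 / 2)
    (hν : ∀ s ∈ Ioo 0 R₀, s * perturbedEnergy p kp km u s ≤ ν * height u s)
    {r R : ℝ} (hr : 0 < r) (hrR : r < R) (hR : R ≤ R₀) :
    heightMean u R ≤ Real.exp (2 * C * (1 - 2 / p) * (ν + 1) * (R - r)) *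
      (R / r) ^ (2 * ν) * heightMean u r := by
  set κ := 2 * C * (1 - 2 / p) * (ν + 1) with hκ
  have hp2 : 2 / p ≤ 1 := by rw [div_le_one (by linarith)]; exact hp
  have hsub : Icc r R ⊆ Ioo 0 1 := fun s hs => ⟨hr.trans_le hs.1, by linarith [hs.2]⟩
  have hder : ∀ s ∈ Icc r R, HasDerivAt
      (fun s : ℝ => Real.exp (-κ * s) * s ^ (-(2 * ν)) * heightMean u s)
      ((Real.exp (-κ * s) * -κ * s ^ (-(2 * ν)) +
        Real.exp (-κ * s) * (-(2 * ν) * s ^ (-(2 * ν) - 1))) * heightMean u s +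
        Real.exp (-κ * s) * s ^ (-(2 * ν)) *
        (2 * (dirichlet u s + penalty p kp km u s) / s ^ d)) s := by
    intro s hs
    have h1 : HasDerivAt (fun s : ℝ => Real.exp (-κ * s)) (Real.exp (-κ * s) * -κ) s := by
      have h2 : HasDerivAt (fun s : ℝ => -κ * s) (-κ) s := by
        simpa using (hasDerivAt_id s).const_mul (-κ)
      exact h2.exp
    exact (h1.mul (Real.hasDerivAt_rpow_const (Or.inl (hsub hs).1.ne'))).mul
      (hu.hasDerivAt_heightMean hd hp hkp hkm (hsub hs))
  have hanti : AntitoneOn (fun s : ℝ => Real.exp (-κ * s) * s ^ (-(2 * ν)) * heightMean u s)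
      (Icc r R) := by
    refine antitoneOn_of_hasDerivWithinAt_nonpos (convex_Icc r R)
      (fun s hs => (hder s hs).continuousAt.continuousWithinAt)
      (fun s hs => (hder s (interior_subset hs)).hasDerivWithinAt) fun s hs => ?_
    rw [interior_Icc] at hs
    have hs0 : 0 < s := hr.trans hs.1
    have hsR : s ∈ Ioo 0 R₀ := ⟨hs0, hs.2.trans_le hR⟩
    have h1 := hν s hsR
    have hP := hpen s hs0 (by linarith [hsR.2])
    have hH := height_nonneg u hs0.le
    have hsd : 0 < s ^ d := pow_pos hs0 d
    have hDE : s * dirichlet u s ≤ s * perturbedEnergy p kp km u s := by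
      refine mul_le_mul_of_nonneg_left ?_ hs0.le
      have : 0 ≤ 2 / p * penalty p kp km u s :=
        mul_nonneg (by positivity) (penalty_nonneg hkp hkm u s)
      unfold perturbedEnergy; linarith
    have h2 : penalty p kp km u s ≤ C * ((ν + 1) * height u s) := by
      refine hP.trans (mul_le_mul_of_nonneg_left ?_ hC)
      linarith
    have h3 : (1 - 2 / p) * penalty p kp km u s ≤ (1 - 2 / p) * (C * ((ν + 1) * height u s)) :=
      mul_le_mul_of_nonneg_left h2 (by linarith)
    have h4 : s * (dirichlet u s + penalty p kp km u s) ≤ (ν + s * κ / 2) * height u s := by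
      have e : s * (dirichlet u s + penalty p kp km u s) = s * perturbedEnergy p kp km u s +
          s * ((1 - 2 / p) * penalty p kp km u s) := by unfold perturbedEnergy; ring
      have h5 := mul_le_mul_of_nonneg_left h3 hs0.le
      rw [e]
      have e2 : (ν + s * κ / 2) * height u s = ν * height u s +
        s * ((1 - 2 / p) * (C * ((ν + 1) * height u s))) := by rw [hκ]; ring
      rw [e2]
      linarith
    rw [height_eq] at h4
    have h5 : (dirichlet u s + penalty p kp km u s) / s ^ d ≤
        (ν + s * κ / 2) * heightMean u s / s := by
      rw [div_le_div_iff₀ hsd hs0]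
      linarith
    have h6 : s ^ (-(2 * ν) - 1) = s ^ (-(2 * ν)) / s := by rw [Real.rpow_sub_one hs0.ne']
    rw [h6]
    have h7 : 0 ≤ Real.exp (-κ * s) * s ^ (-(2 * ν)) := by positivity
    have h8 := mul_le_mul_of_nonneg_left h5 h7
    have e : (Real.exp (-κ * s) * -κ * s ^ (-(2 * ν)) +
        Real.exp (-κ * s) * (-(2 * ν) * (s ^ (-(2 * ν)) / s))) * heightMean u s +
        Real.exp (-κ * s) * s ^ (-(2 * ν)) *
        (2 * (dirichlet u s + penalty p kp km u s) / s ^ d) =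
        2 * (Real.exp (-κ * s) * s ^ (-(2 * ν)) *
          ((dirichlet u s + penalty p kp km u s) / s ^ d) -
          Real.exp (-κ * s) * s ^ (-(2 * ν)) * ((ν + s * κ / 2) * heightMean u s / s)) := by
      field_simp
      ring
    rw [e]
    linarith
  have hR0 : 0 < R := hr.trans hrR
  have key := hanti (left_mem_Icc.2 hrR.le) (right_mem_Icc.2 hrR.le) hrR.le
  simp only at key
  have h1 := mul_le_mul_of_nonneg_left key
    (show 0 ≤ Real.exp (κ * R) * R ^ (2 * ν) by positivity)
  have e1 : Real.exp (κ * R) * R ^ (2 * ν) *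
      (Real.exp (-κ * R) * R ^ (-(2 * ν)) * heightMean u R) = heightMean u R := by
    have h2 : Real.exp (κ * R) * Real.exp (-κ * R) = 1 := by
      rw [← Real.exp_add]; simp
    have h3 : R ^ (2 * ν) * R ^ (-(2 * ν)) = 1 := by
      rw [← Real.rpow_add hR0]; simp
    calc _ = (Real.exp (κ * R) * Real.exp (-κ * R)) * (R ^ (2 * ν) * R ^ (-(2 * ν))) *
          heightMean u R := by ring
      _ = _ := by rw [h2, h3]; ring
  have e2 : Real.exp (κ * R) * R ^ (2 * ν) *
      (Real.exp (-κ * r) * r ^ (-(2 * ν)) * heightMean u r) =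
      Real.exp (κ * (R - r)) * (R / r) ^ (2 * ν) * heightMean u r := by
    have h2 : Real.exp (κ * (R - r)) = Real.exp (κ * R) * Real.exp (-κ * r) := by
      rw [← Real.exp_add]; ring_nf
    rw [h2, Real.div_rpow hR0.le hr.le, Real.rpow_neg hr.le]
    ring
  rwa [e1, e2] at h1

end IsSolution

end Monotonicity

/-! ### Comparison of pointwise values with spherical means -/

section Growth

variable {d : ℕ} {p kp km : ℝ} {u : Space d → ℝ}

/-- The area of the upper half of the unit sphere. -/
def upperArea (d : ℕ) : ℝ :=
  ∫ _ in {ω : Metric.sphere (0 : Space d) 1 | 0 < (ω : Space d) (Fin.last d)}, (1 : ℝ)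
    ∂((volume : Measure (Space d)).toSphere)

theorem upperArea_nonneg (d : ℕ) : 0 ≤ upperArea d := integral_nonneg fun _ => zero_le_one

theorem sphereMean_eq (u : Space d → ℝ) {r : ℝ} (hr : 0 < r) :
    sphereMean u r = heightMean u r / upperArea d := by
  rw [sphereMean, height_eq]
  exact mul_div_mul_left _ _ (pow_pos hr d).ne'

namespace IsSolution

variable (hu : IsSolution p kp km u)
include hu

/-- The half sphere of radius r is not contained in the open half ball where the bound holds, so the
estimate is taken at radii s < r and passed to the limit. -/
theorem heightMean_le (hd : 1 ≤ d) (hp : 2 ≤ p) (hkp : 0 ≤ kp) (hkm : 0 ≤ km) {r K : ℝ}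
    (hr0 : 0 < r) (hr : r < 1) (hb : ∀ x ∈ halfBall d r, |u x| ≤ K) :
    heightMean u r ≤ K ^ 2 * upperArea d := by
  have hc := (hu.hasDerivAt_heightMean hd hp hkp hkm ⟨hr0, hr⟩).continuousAt
  have hc' := hc.tendsto.mono_left (nhdsWithin_le_nhds (s := Iio r))
  refine le_of_tendsto hc' ?_
  filter_upwards [Ioo_mem_nhdsLT hr0] with s hs
  rw [upperArea, ← integral_const_mul, heightMean]
  refine integral_mono_of_nonneg (Eventually.of_forall fun _ => sq_nonneg _)
    ((integrable_const _).const_mul _) ?_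
  filter_upwards [ae_restrict_mem measurableSet_upperSphere] with ω hω
  rw [mul_one, ← sq_abs]
  have : s • (ω : Space d) ∈ halfBall d r := by
    rw [mem_halfBall, norm_smul_sphere ω hs.1.le]
    refine ⟨hs.2, ?_⟩
    have e : (s • (ω : Space d)) (Fin.last d) = s * (ω : Space d) (Fin.last d) := by simp
    rw [e]
    exact mul_pos hs.1 hω
  have h1 := hb _ this
  gcongr

/-- `local_bound` for u² between the radii r and 2r; the factor 8 there times the ratio 2 of the
radii makes 16. -/
theorem sq_le_heightMean (hp : 2 ≤ p) (hkp : 0 ≤ kp) (hkm : 0 ≤ km) {r : ℝ} (hr0 : 0 < r)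
    (hr : 2 * r < 1) {x : Space d} (hx : x ∈ halfBall d r) :
    u x ^ 2 * volume.real (Metric.ball (0 : Space d) 1) ≤ 16 ^ (d + 1) * heightMean u (2 * r) := by
  obtain ⟨K, hK, hb⟩ := hu.exists_bound hp hkp hkm hr
  have h1 := hu.local_bound hp hkp hkm hr.le (by positivity) (hu.isConvexTest_sq hr.le hb)
    (ρ₀ := r) (by linarith) hx
  have h2 := hu.integral_sq_le hp hkp hkm (mul_pos two_pos hr0) hr
  have hrd : 0 < r ^ (d + 1) := pow_pos hr0 _
  have hh := heightMean_nonneg u (2 * r)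
  have h3 : 2 * r / (d + 1) * height u (2 * r) ≤ (2 * r) ^ (d + 1) * heightMean u (2 * r) := by
    rw [height_eq, pow_succ]
    have h4 : 2 * r / (d + 1) ≤ 2 * r :=
      div_le_self (by positivity) (by linarith [(Nat.cast_nonneg d : (0 : ℝ) ≤ d)])
    have h5 : 0 ≤ (2 * r) ^ d * heightMean u (2 * r) := by positivity
    nlinarith
  have e : 2 * r - r = r := by ring
  rw [e] at h1
  have h6 := h1.trans (mul_le_mul_of_nonneg_left (h2.trans h3) (by positivity))
  have e2 : (8 : ℝ) ^ (d + 1) * ((2 * r) ^ (d + 1) * heightMean u (2 * r)) =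
      16 ^ (d + 1) * heightMean u (2 * r) * r ^ (d + 1) := by
    rw [mul_pow, show (16 : ℝ) = 8 * 2 by norm_num, mul_pow]; ring
  rw [e2] at h6
  exact le_of_mul_le_mul_right h6 hrd

theorem heightMean_le_rpow (hd : 1 ≤ d) (hp : 2 ≤ p) (hkp : 0 ≤ kp) (hkm : 0 ≤ km) {μ : ℝ}
    (hμ : ∀ s ∈ Ioo 0 1, μ * height u s ≤ s * perturbedEnergy p kp km u s) {r : ℝ} (hr0 : 0 < r)
    (hr : r ≤ 1 / 2) : heightMean u r ≤ (2 * r) ^ (2 * μ) * heightMean u (1 / 2) := by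
  have h := hu.rpow_mul_heightMean_mono hd hp hkp hkm hμ (a := r) (b := 1 / 2)
    ⟨hr0, by linarith⟩ ⟨by norm_num, by norm_num⟩ hr
  simp only at h
  have h1 := mul_le_mul_of_nonneg_left h (Real.rpow_nonneg hr0.le (2 * μ))
  have e1 : r ^ (2 * μ) * (r ^ (-2 * μ) * heightMean u r) = heightMean u r := by
    rw [← mul_assoc, ← Real.rpow_add hr0]; simp
  have e2 : r ^ (2 * μ) * ((1 / 2 : ℝ) ^ (-2 * μ) * heightMean u (1 / 2)) =
      (2 * r) ^ (2 * μ) * heightMean u (1 / 2) := by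
    rw [Real.mul_rpow two_pos.le hr0.le, neg_mul, Real.rpow_neg (by norm_num),
      one_div, Real.inv_rpow two_pos.le, inv_inv]
    ring
  rwa [e1, e2] at h1

end IsSolution

end Growth

end

end PenalizedObstacle

/-! ### The theorem with explicit constants -/

open PenalizedObstacle in
theorem corollary6 (d : ℕ) (hd : 1 ≤ d) :
    ∃ Ca Ct Cs : ℝ, 0 < Ca ∧ 0 < Ct ∧ 0 < Cs ∧
      ∀ (p kp km : ℝ), 2 ≤ p → 0 ≤ kp → 0 ≤ km →
      ∀ u : Space d → ℝ, IsSolution p kp km u →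
        BddAbove ((fun x => |u x|) '' halfBall d (1 / 2)) ∧
        ∃ μ : ℝ, 0 ≤ μ ∧
          Tendsto (perturbedFrequency p kp km u) (𝓝[>] 0) (𝓝 μ) ∧
          Tendsto (frequency u) (𝓝[>] 0) (𝓝 μ) ∧
          MonotoneOn (fun r : ℝ => r ^ (-2 * μ) * sphereMean u r) (Ioo 0 (1 / 2)) ∧
          (∀ r : ℝ, 0 < r → r < 1 / 2 →
            sphereMean u r ≤ (2 * r) ^ (2 * μ) * sphereMean u (1 / 2) ∧
            (2 * r) ^ (2 * μ) * sphereMean u (1 / 2) ≤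
              Ca * (2 * r) ^ (2 * μ) * supHalf u ^ 2) ∧
          PenaltyBound p kp km u (Ct * max kp km * supHalf u ^ (p - 2)) ∧
          (∀ δ : ℝ, 0 < δ → ∃ R₀ : ℝ, 0 < R₀ ∧ R₀ ≤ 1 / 2 ∧
            ∀ C : ℝ, 0 ≤ C → PenaltyBound p kp km u C →
            ∀ r R : ℝ, 0 < r → r < 1 / 2 → r < R → R ≤ R₀ →
              sphereMean u R ≤
                Real.exp (2 * C * (1 - 2 / p) * (μ + δ + 1) * (R - r)) *
                  (R / r) ^ (2 * (μ + δ)) * sphereMean u r) ∧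
          (∀ r : ℝ, 0 < r → r < 1 / 2 → ∀ x ∈ halfBall d r,
            |u x| ≤ Cs * (4 * r) ^ μ * supHalf u) := by
  set V := volume.real (Metric.ball (0 : Space d) 1) with hV
  have hVpos : 0 < V :=
    ENNReal.toReal_pos (Metric.measure_ball_pos volume _ one_pos).ne' measure_ball_lt_top.ne
  -- The constant in u² ≤ c (4r)^(2μ) M², from `sq_le_heightMean` and the bound of the mean height
  -- at 1/2 by M² times the area. Using 1 + c for `Cs` gives a number at least 1 whose square
  -- dominates c.
  set c := 16 ^ (d + 1) * upperArea d / V with hc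
  have hc0 : 0 ≤ c := by have := upperArea_nonneg d; positivity
  refine ⟨1, 2, 1 + c, one_pos, two_pos, by positivity, fun p kp km hp hkp hkm u hu => ?_⟩
  have hbdd : BddAbove ((fun x => |u x|) '' halfBall d (1 / 2)) := by
    obtain ⟨K, -, hb⟩ := hu.exists_bound hp hkp hkm (ρ := 1 / 2) (by norm_num)
    exact ⟨K, by rintro _ ⟨x, hx, rfl⟩; exact hb x hx⟩
  refine ⟨hbdd, ?_⟩
  have hM : ∀ x ∈ halfBall d (1 / 2), |u x| ≤ supHalf u := fun x hx =>
    le_csSup hbdd ⟨x, hx, rfl⟩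
  have hM0 : 0 ≤ supHalf u :=
    Real.sSup_nonneg (by rintro _ ⟨x, -, rfl⟩; exact abs_nonneg _)
  have hpen := hu.penaltyBound hd hp hkp hkm hM
  have hC0 : 0 ≤ 2 * max kp km * supHalf u ^ (p - 2) :=
    mul_nonneg (mul_nonneg two_pos.le (le_max_of_le_left hkp)) (Real.rpow_nonneg hM0 _)
  obtain ⟨μ, hμ0, hlim, hlim', hμ, hδ⟩ := hu.exists_frequency_limit hd hp hkp hkm hC0 hpen
  have hA := upperArea_nonneg d
  have hhalf := hu.heightMean_le hd hp hkp hkm (r := 1 / 2) (by norm_num) (by norm_num) hM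
  have hmean : sphereMean u (1 / 2) ≤ supHalf u ^ 2 := by
    rw [sphereMean_eq u (by norm_num)]
    exact div_le_of_le_mul₀ hA (sq_nonneg _) hhalf
  refine ⟨μ, hμ0, hlim, hlim', ?_, ?_, hpen, ?_, ?_⟩
  · intro a ha b hb hab
    have h := hu.rpow_mul_heightMean_mono hd hp hkp hkm hμ (a := a) (b := b)
      ⟨ha.1, by linarith [ha.2]⟩ ⟨hb.1, by linarith [hb.2]⟩ hab
    simp only [sphereMean_eq u ha.1, sphereMean_eq u hb.1, ← mul_div_assoc]
    exact div_le_div_of_nonneg_right h hA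
  · intro r hr0 hr
    constructor
    · rw [sphereMean_eq u hr0, sphereMean_eq u (by norm_num), ← mul_div_assoc]
      exact div_le_div_of_nonneg_right (hu.heightMean_le_rpow hd hp hkp hkm hμ hr0 hr.le) hA
    · rw [one_mul]
      exact mul_le_mul_of_nonneg_left hmean (by positivity)
  · intro δ hδ0
    obtain ⟨R₀, hR₀, hR₀', hν⟩ := hδ δ hδ0
    refine ⟨R₀, hR₀, hR₀', fun C hC hpC r R hr _ hrR hR => ?_⟩
    rw [sphereMean_eq u hr, sphereMean_eq u (hr.trans hrR), ← mul_div_assoc]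
    exact div_le_div_of_nonneg_right
      (hu.heightMean_le_doubling hd hp hkp hkm hC hpC hR₀' hν hr hrR hR) hA
  · intro r hr0 hr x hx
    -- For r ≥ 1/4 the factor (4r)^μ is at least 1 and the bound by M suffices. For smaller r the
    -- doubled radius 2r stays below 1/2, where the growth of the mean height applies and turns
    -- (2·2r)^(2μ) into the square of (4r)^μ.
    rcases le_or_gt (1 / 4) r with h4 | h4
    · have h1 : 1 ≤ (4 * r) ^ μ := Real.one_le_rpow (by linarith) hμ0
      have h2 : 1 ≤ (1 + c) * (4 * r) ^ μ := one_le_mul_of_one_le_of_one_le (by linarith) h1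
      exact (hM x (halfBall_mono hr.le hx)).trans (le_mul_of_one_le_left hM0 h2)
    · have h1 := hu.sq_le_heightMean hp hkp hkm hr0 (by linarith) hx
      have h2 := hu.heightMean_le_rpow hd hp hkp hkm hμ (r := 2 * r) (by linarith) (by linarith)
      have e : 2 * (2 * r) = 4 * r := by ring
      rw [e, mul_comm 2 μ, Real.rpow_mul (by linarith), Real.rpow_two] at h2
      set q := (4 * r) ^ μ with hq
      have hq0 : 0 ≤ q := by positivity
      have h3 : u x ^ 2 ≤ c * (q * supHalf u) ^ 2 := by
        have h4 : u x ^ 2 * V ≤ 16 ^ (d + 1) * (q ^ 2 * (supHalf u ^ 2 * upperArea d)) := by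
          refine h1.trans (mul_le_mul_of_nonneg_left (h2.trans ?_) (by positivity))
          exact mul_le_mul_of_nonneg_left hhalf (by positivity)
        rw [← le_div_iff₀ hVpos] at h4
        refine h4.trans (le_of_eq ?_)
        rw [hc]; ring
      refine abs_le_of_sq_le_sq (h3.trans ?_) (by positivity)
      have h5 : c ≤ (1 + c) ^ 2 := by nlinarith
      have h6 := mul_le_mul_of_nonneg_right h5 (sq_nonneg (q * supHalf u))
      refine h6.trans (le_of_eq (by ring))
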